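/- Fix $\eta\in\mathbb C\setminus\{0\}$ and let $x$ range over a set $X\subseteq\mathbb C$ with $X+\eta\mathbb Z=X$. Functions of the times ${\bf t}=(t_1,t_2,\dots)$, $\bar{\bf t}=(\bar t_1,\bar t_2,\dots)$ are formal power series over $\mathbb C$ in the times, depending on $x\in X$ in an arbitrary way. For difference operators put $(f(x)e^{n\eta\partial_x})^\dagger=e^{-n\eta\partial_x}f(x)$, and $\xi({\bf t},k)=\sum_{j\ge1}t_jk^j$, ${\bf t}\pm[k^{-1}]=(t_j\pm\frac1jk^{-j})_{j\ge1}$. Let $\mathcal L=e^{\eta\partial_x}+\sum_{j\ge0}U_j(x)e^{-j\eta\partial_x}$, $\bar{\mathcal L}=e^{\varphi(x)-\varphi(x-\eta)}e^{-\eta\partial_x}+\sum_{j\ge0}\bar U_j(x)e^{j\eta\partial_x}$ be a solution of the 2D Toda lattice hierarchy $$\partial_{t_m}A=[\mathcal B_m,A],\quad \partial_{\bar t_m}A=[\bar{\mathcal B}_m,A],\qquad A\in\{\mathcal L,\bar{\mathcal L}\},\quad \mathcal B_m=(\mathcal L^m)_{\ge0},\ \bar{\mathcal B}_m=(\bar{\mathcal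 L}^m)_{<0},\ m\ge1 .$$ Let $\mathcal W=1+\sum_{s\ge1}\xi_s(x)e^{-s\eta\partial_x}$, $\bar{\mathcal W}=e^{\varphi(x)}\bigl(1+\sum_{s\ge1}\chi_s(x)e^{s\eta\partial_x}\bigr)$ be wave operators of it. This means that $\mathcal L\mathcal W=\mathcal We^{\eta\partial_x}$, $\bar{\mathcal L}\bar{\mathcal W}=\bar{\mathcal W}e^{-\eta\partial_x}$, and that the wave function $\psi$ with the expansions $\psi=\mathcal W\,k^{x/\eta}e^{\xi({\bf t},k)}$ ($k\to\infty$) and $\psi=\bar{\mathcal W}\,k^{x/\eta}e^{\xi(\bar{\bf t},k^{-1})}$ ($k\to0$) satisfies $\partial_{t_m}\psi=\mathcal B_m\psi$, $\partial_{\bar t_m}\psi=\bar{\mathcal B}_m\psi$ for all $m\ge1$. Suppose that the solution belongs to the C-Toda hierarchy: with $\mathcal L^s=e^{-\varphi/2}\mathcal Le^{\varphi/2}$, $\bar{\mathcal L}^s=e^{-\varphi/2}\bar{\mathcal L}e^{\varphi/2}$, one has $\bar{\mathcal L}^s=(\mathcal L^s)^\dagger$ at $t_j+\bar t_j=0$ (all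 $j$). Put $\mathcal W^s=e^{-\varphi/2}\mathcal W$, $\bar{\mathcal W}^s=e^{-\varphi/2}\bar{\mathcal W}$. (i) There are wave operators $\mathcal W',\bar{\mathcal W}$ of the same solution, with the same $\bar{\mathcal W}$, that are normalized by $$\bar{\mathcal W}^s(\mathcal W'^s)^\dagger=\mathcal W'^s(\bar{\mathcal W}^s)^\dagger=1\quad\text{at } t_j+\bar t_j=0,\qquad \mathcal W'^s=e^{-\varphi/2}\mathcal W'.$$ (ii) If $\mathcal W,\bar{\mathcal W}$ are themselves normalized, $\bar{\mathcal W}^s(\mathcal W^s)^\dagger=\mathcal W^s(\bar{\mathcal W}^s)^\dagger=1$ at $t_j+\bar t_j=0$, then there is a function $\tau^C(x,{\bf t})$ of $x$ and of the times $T_j=\frac12(t_j-\bar t_j)$ only (equal to $t_j$, and denoted so, at $t_j+\bar t_j=0$), invertible as a power series in ${\bf t}$ for every $x$, such that at $t_j+\bar t_j=0$, for all $x$, $$e^{\varphi(x,{\bf t})}=\left(\frac{\tau^C(x+\eta,{\bf t})}{\tau^C(x,{\bf t})}\right)^2,$$ $$\psi(x,{\bf t};k)=e^{\frac12\varphi(x,{\bf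 t})}\sqrt{\chi^2(x,{\bf t};k)-\chi^2(x-\eta,{\bf t};k)},\qquad \psi(x,{\bf t};k^{-1})=e^{\frac12\varphi(x,{\bf t})}\sqrt{\bar\chi^2(x,{\bf t};k)-\bar\chi^2(x+\eta,{\bf t};k)}$$ as formal expansions for $k\to\infty$, where $$\chi(x,{\bf t};k)=k^{x/\eta}e^{\xi({\bf t},k)-\frac12\varphi(x,{\bf t})}\frac{\tau^C(x,{\bf t}-[k^{-1}])}{\tau^C(x,{\bf t})},\qquad \bar\chi(x,{\bf t};k)=k^{-x/\eta}e^{-\xi({\bf t},k)}\frac{\tau^C(x+\eta,{\bf t}+[k^{-1}])}{\tau^C(x,{\bf t})},$$ and the square roots are the branches of the form $\chi\cdot(1+O(k^{-1}))$ and $\bar\chi\cdot(1+O(k^{-1}))$. -/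

import Mathlib

open scoped ComplexOrder

noncomputable section

namespace CToda

/-! ### Functions of the times

The positive times are `t_1, t_2, …` and the negative times are `t̄_1, t̄_2, …`; functions of the
times are formal power series.  `Sum.inl j` is the index of `t_j`, `Sum.inr j` that of `t̄_j`. -/

/-- Functions of all the times `t_j`, `t̄_j` of the 2D Toda lattice hierarchy. -/
abbrev TodaFun : Type := MvPowerSeries (ℕ+ ⊕ ℕ+) ℂ

/-- Functions of the times `T_j = (t_j - t̄_j) / 2` only. On the slice `t_j + t̄_j = 0` one has
`T_j = t_j`. -/
abbrev TimeFun : Type := MvPowerSeries ℕ+ ℂ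

/-- Restriction of a function of the times to the slice `t̄_j = -t_j` for all `j`. -/
def restrict (f : TodaFun) : TimeFun :=
  MvPowerSeries.subst
    (Sum.elim (fun j => MvPowerSeries.X j) (fun j => -MvPowerSeries.X j) : ℕ+ ⊕ ℕ+ → TimeFun) f

/-- The exponential `e ^ f` of a formal power series with an arbitrary constant term. -/
def expSeries {σ : Type} (f : MvPowerSeries σ ℂ) : MvPowerSeries σ ℂ :=
  MvPowerSeries.C (Complex.exp (MvPowerSeries.constantCoeff f)) *
    PowerSeries.subst (f - MvPowerSeries.C (MvPowerSeries.constantCoeff f)) (PowerSeries.exp ℂ)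

/-! ### The variable `x` and difference operators -/

/-- The range of the variable `x`: a set of complex numbers that is invariant under all the shifts
`x ↦ x + n η`; for example the whole plane, the plane without the poles of the coefficients, or
one lattice `x₀ + η ℤ`. -/
structure ShiftDomain (η : ℂ) where
  /-- The underlying set. -/
  carrier : Set ℂ
  shift_mem : ∀ x ∈ carrier, ∀ n : ℤ, x + n * η ∈ carrier

/-- The points of the domain. -/
abbrev ShiftDomain.Pt {η : ℂ} (D : ShiftDomain η) : Type := D.carrier

/-- The point `x + n η`. -/
def ShiftDomain.shift {η : ℂ} (D : ShiftDomain η) (n : ℤ) (x : D.Pt) : D.Pt :=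
  ⟨(x : ℂ) + n * η, D.shift_mem x x.2 n⟩

/-- Formal difference operators `∑_{n ∈ ℤ} A_n(x) e^{n η ∂_x}`, written as `A n x`, with
coefficients in the ring `R` of functions of the times. -/
abbrev DiffOp {η : ℂ} (D : ShiftDomain η) (R : Type) : Type := ℤ → D.Pt → R

section Operators

variable {η : ℂ} {D : ShiftDomain η} {R : Type} [CommRing R]

/-- Composition, by the rule `(f e^{i η ∂_x}) (g e^{j η ∂_x}) = f(x) g(x + i η) e^{(i+j) η ∂_x}`.
It is only used where at every point the sum has finitely many nonzero terms (both factors are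
bounded above, or both are bounded below, or one of them is a finite sum). -/
def DiffOp.comp (A B : DiffOp D R) : DiffOp D R :=
  fun n x => ∑ᶠ i : ℤ, A i x * B (n - i) (D.shift i x)

/-- The operator `e^{m η ∂_x}`. -/
def DiffOp.shiftOp (m : ℤ) : DiffOp D R := fun n _ => if n = m then 1 else 0

/-- Powers of an operator. -/
def DiffOp.pow (A : DiffOp D R) : ℕ → DiffOp D R
  | 0 => DiffOp.shiftOp 0
  | m + 1 => DiffOp.comp (DiffOp.pow A m) A

/-- Commutator. -/
def DiffOp.comm (A B : DiffOp D R) : DiffOp D R := DiffOp.comp A B - DiffOp.comp B A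

/-- The part `(A)_{≥ 0}`. -/
def DiffOp.nonnegPart (A : DiffOp D R) : DiffOp D R := fun n x => if 0 ≤ n then A n x else 0

/-- The part `(A)_{< 0}`. -/
def DiffOp.negPart (A : DiffOp D R) : DiffOp D R := fun n x => if n < 0 then A n x else 0

/-- The formal adjoint `(f(x) e^{n η ∂_x})† = e^{-n η ∂_x} f(x) = f(x - n η) e^{-n η ∂_x}`. -/
def DiffOp.adjoint (A : DiffOp D R) : DiffOp D R := fun n x => A (-n) (D.shift n x)

/-- Multiplication of an operator by the function `f` from the left. -/
def DiffOp.leftMul (f : D.Pt → R) (A : DiffOp D R) : DiffOp D R := fun n x => f x * A n x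

/-- The operator `A ∘ f`, multiplication by the function `f` from the right. -/
def DiffOp.rightMul (A : DiffOp D R) (f : D.Pt → R) : DiffOp D R :=
  fun n x => A n x * f (D.shift n x)

end Operators

/-! ### The 2D Toda lattice hierarchy -/

section Toda

variable {η : ℂ} {D : ShiftDomain η}

/-- Partial derivative of an operator with respect to one of the times, coefficient by
coefficient. -/
def timeDeriv (i : ℕ+ ⊕ ℕ+) (A : DiffOp D TodaFun) : DiffOp D TodaFun :=
  fun n x => MvPowerSeries.pderiv ℂ i (A n x)

/-- The generator `B_m = (L^m)_{≥ 0}` of the `t_m`-flow. -/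
def genB (L : DiffOp D TodaFun) (m : ℕ+) : DiffOp D TodaFun := (L.pow m).nonnegPart

/-- The generator `B̄_m = (L̄^m)_{< 0}` of the `t̄_m`-flow. -/
def genBbar (Lb : DiffOp D TodaFun) (m : ℕ+) : DiffOp D TodaFun := (Lb.pow m).negPart

/-- A solution of the 2D Toda lattice hierarchy in the standard gauge: Lax operators
`L = e^{η ∂_x} + ∑_{k ≥ 0} U_k(x) e^{-k η ∂_x}`,
`L̄ = c(x) e^{-η ∂_x} + ∑_{k ≥ 0} Ū_k(x) e^{k η ∂_x}`, `c(x) = e^{φ(x) - φ(x - η)}`,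
subject to the Lax equations. -/
structure IsTodaSolution (L Lb : DiffOp D TodaFun) (φ : D.Pt → TodaFun) : Prop where
  L_top : ∀ n : ℤ, 1 < n → ∀ x, L n x = 0
  L_lead : ∀ x, L 1 x = 1
  Lb_bot : ∀ n : ℤ, n < -1 → ∀ x, Lb n x = 0
  Lb_lead : ∀ x, Lb (-1) x = expSeries (φ x - φ (D.shift (-1) x))
  lax_t_L : ∀ m : ℕ+, timeDeriv (Sum.inl m) L = (genB L m).comm L
  lax_t_Lb : ∀ m : ℕ+, timeDeriv (Sum.inl m) Lb = (genB L m).comm Lb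
  lax_tb_L : ∀ m : ℕ+, timeDeriv (Sum.inr m) L = (genBbar Lb m).comm L
  lax_tb_Lb : ∀ m : ℕ+, timeDeriv (Sum.inr m) Lb = (genBbar Lb m).comm Lb

/-- `W = 1 + ∑_{s ≥ 1} ξ_s(x) e^{-s η ∂_x}` and `W̄ = e^{φ(x)} (1 + ∑_{s ≥ 1} χ_s(x) e^{s η ∂_x})`
are wave operators of the solution: they dress the shift operators to the Lax operators, and the
wave function `ψ` with the expansions `ψ = W k^{x/η} e^{ξ(t,k)}` for `k → ∞` and
`ψ = W̄ k^{x/η} e^{ξ(t̄,k⁻¹)}` for `k → 0` satisfies the linear problems `∂_{t_m} ψ = B_m ψ`,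
`∂_{t̄_m} ψ = B̄_m ψ`.  The linear problems are written for the operators; for instance
`∂_{t_m} (W k^{x/η} e^{ξ(t,k)}) = (∂_{t_m} W + W e^{m η ∂_x}) k^{x/η} e^{ξ(t,k)}`. -/
structure IsWavePair (L Lb : DiffOp D TodaFun) (φ : D.Pt → TodaFun) (W Wb : DiffOp D TodaFun) :
    Prop where
  W_top : ∀ n : ℤ, 0 < n → ∀ x, W n x = 0
  W_lead : ∀ x, W 0 x = 1
  Wb_bot : ∀ n : ℤ, n < 0 → ∀ x, Wb n x = 0
  Wb_lead : ∀ x, Wb 0 x = expSeries (φ x)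
  dress_L : L.comp W = W.comp (DiffOp.shiftOp 1)
  dress_Lb : Lb.comp Wb = Wb.comp (DiffOp.shiftOp (-1))
  lin_t_W : ∀ m : ℕ+,
    timeDeriv (Sum.inl m) W + W.comp (DiffOp.shiftOp (m : ℤ)) = (genB L m).comp W
  lin_t_Wb : ∀ m : ℕ+, timeDeriv (Sum.inl m) Wb = (genB L m).comp Wb
  lin_tb_W : ∀ m : ℕ+, timeDeriv (Sum.inr m) W = (genBbar Lb m).comp W
  lin_tb_Wb : ∀ m : ℕ+,
    timeDeriv (Sum.inr m) Wb + Wb.comp (DiffOp.shiftOp (-(m : ℤ))) = (genBbar Lb m).comp Wb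

/-! ### The constraint -/

/-- A Lax operator in the symmetric gauge, `A^s = e^{-φ/2} A e^{φ/2}`. -/
def symLax (φ : D.Pt → TodaFun) (A : DiffOp D TodaFun) : DiffOp D TodaFun :=
  (DiffOp.leftMul (fun x => expSeries (-((1 / 2 : ℂ) • φ x))) A).rightMul
    (fun x => expSeries ((1 / 2 : ℂ) • φ x))

/-- A wave operator in the symmetric gauge, `A^s = e^{-φ/2} A`. -/
def symWave (φ : D.Pt → TodaFun) (A : DiffOp D TodaFun) : DiffOp D TodaFun :=
  DiffOp.leftMul (fun x => expSeries (-((1 / 2 : ℂ) • φ x))) A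

/-- Restriction of an operator to the slice `t_j + t̄_j = 0`. -/
def restrictOp (A : DiffOp D TodaFun) : DiffOp D TimeFun := fun n x => restrict (A n x)

/-- The C-Toda constraint `L̄^s = (L^s)†` at `t_j + t̄_j = 0`. -/
def IsCToda (L Lb : DiffOp D TodaFun) (φ : D.Pt → TodaFun) : Prop :=
  restrictOp (symLax φ Lb) = (restrictOp (symLax φ L)).adjoint

/-- The form of the constraint for wave operators, `W̄^s (W^s)† = W^s (W̄^s)† = 1` at
`t_j + t̄_j = 0`. -/
def IsCTodaWave (φ : D.Pt → TodaFun) (W Wb : DiffOp D TodaFun) : Prop :=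
  (restrictOp (symWave φ Wb)).comp (restrictOp (symWave φ W)).adjoint = DiffOp.shiftOp 0 ∧
  (restrictOp (symWave φ W)).comp (restrictOp (symWave φ Wb)).adjoint = DiffOp.shiftOp 0

end Toda

/-! ### Formal wave functions for `k → ∞` -/

/-- Formal series `∑ c_α k^{-α}` with complex exponents `α` (and well-ordered real parts of the
exponents in finitely many vertical levels), a commutative ring. -/
abbrev KSeries : Type := HahnSeries ℂ ℂ

/-- Formal functions of the times and of `k → ∞`. -/
abbrev WaveFun : Type := MvPowerSeries ℕ+ KSeries

/-- The function `k^α`. -/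
def kPow (α : ℂ) : WaveFun := MvPowerSeries.C (HahnSeries.single (-α) (1 : ℂ))

/-- The function `e^{ε ξ(t,k)}`, `ξ(t,k) = ∑_{j ≥ 1} t_j k^j`; the coefficient of the monomial
`∏_j t_j^{μ_j}` is `∏_j (ε k^j)^{μ_j} / μ_j!`. -/
def expXi (ε : ℂ) : WaveFun := fun μ =>
  HahnSeries.single (-(μ.sum fun j e => ((j : ℕ) : ℂ) * (e : ℂ)))
    (μ.prod fun _ e => ε ^ e / (Nat.factorial e : ℂ))

/-- A function of the times, as a function of the times and of `k`. -/
def ofTime (f : TimeFun) : WaveFun := MvPowerSeries.map HahnSeries.C f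

/-- The function `∑_{s ≥ 0} f_s(t) k^{-s}`. -/
def ofSeries (f : PowerSeries TimeFun) : WaveFun := fun μ =>
  HahnSeries.ofPowerSeries ℂ ℂ
    (PowerSeries.mk fun s => MvPowerSeries.coeff μ (PowerSeries.coeff s f))

/-- The Miwa shift `f(t + ε [z])`, where `t + ε [z]` has the components `t_j + ε z^j / j`, as a
power series in `z` and the times; the index `none` stands for the variable `z` and the index
`some j` for `t_j`. -/
def miwaAux (ε : ℂ) (f : TimeFun) : MvPowerSeries (Option ℕ+) ℂ :=
  MvPowerSeries.subst
    (fun j : ℕ+ => MvPowerSeries.X (some j) +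
      MvPowerSeries.C (ε / ((j : ℕ) : ℂ)) * MvPowerSeries.X none ^ (j : ℕ)) f

/-- The Miwa shift `f(t + ε [z])` as a power series in `z` whose coefficients are functions of
the times. -/
def miwa (ε : ℂ) (f : TimeFun) : PowerSeries TimeFun :=
  PowerSeries.mk fun s => fun μ : ℕ+ →₀ ℕ =>
    MvPowerSeries.coeff (Finsupp.mapDomain some μ + Finsupp.single none s) (miwaAux ε f)

section Wave

variable {η : ℂ} {D : ShiftDomain η}

/-- The wave function on the slice `t_j + t̄_j = 0` for `k → ∞`,
`ψ(x,t;k) = k^{x/η} e^{ξ(t,k)} (1 + ∑_{s ≥ 1} ξ_s(x) k^{-s})`. -/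
def psi (W : DiffOp D TodaFun) (x : D.Pt) : WaveFun :=
  kPow ((x : ℂ) / η) * expXi 1 *
    ofSeries (PowerSeries.mk fun s : ℕ => restrict (W (-(s : ℤ)) x))

/-- The function `ψ(x,t;k⁻¹)` on the slice `t_j + t̄_j = 0` for `k → ∞`: the expansion of the wave
function at zero, with `k⁻¹` in place of `k` and `t̄ = -t`, that is
`k^{-x/η} e^{-ξ(t,k)} e^{φ(x)} (1 + ∑_{s ≥ 1} χ_s(x) k^{-s})`. -/
def psiInv (Wb : DiffOp D TodaFun) (x : D.Pt) : WaveFun :=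
  kPow (-((x : ℂ) / η)) * expXi (-1) *
    ofSeries (PowerSeries.mk fun s : ℕ => restrict (Wb (s : ℤ) x))

/-- `χ(x,t;k) = k^{x/η} e^{ξ(t,k) - φ(x,t)/2} τ(x, t - [k⁻¹]) / τ(x,t)`. -/
def chi (φ τ : D.Pt → TimeFun) (x : D.Pt) : WaveFun :=
  kPow ((x : ℂ) / η) * (expXi 1 * ofTime (expSeries (-((1 / 2 : ℂ) • φ x)))) *
    (ofSeries (miwa (-1) (τ x)) * ofTime (τ x)⁻¹)

/-- `χ̄(x,t;k) = k^{-x/η} e^{-ξ(t,k)} τ(x + η, t + [k⁻¹]) / τ(x,t)`. -/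
def chiBar (τ : D.Pt → TimeFun) (x : D.Pt) : WaveFun :=
  kPow (-((x : ℂ) / η)) * expXi (-1) *
    (ofSeries (miwa 1 (τ (D.shift 1 x))) * ofTime (τ x)⁻¹)

/-- `s = √d` for `k → ∞`, with the branch `s = p (1 + O(k⁻¹))`. -/
def IsSqrtWithLeading (s d p : WaveFun) : Prop :=
  s ^ 2 = d ∧ ∃ u : PowerSeries TimeFun, PowerSeries.constantCoeff u = 1 ∧ s = p * ofSeries u

/-- `τ` is a tau-function of the C-Toda hierarchy for the wave function given by `W`, `W̄`: it is
invertible and, with `φ` restricted to `t_j + t̄_j = 0`,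
`e^{φ(x)} = (τ(x + η) / τ(x))²`,
`ψ(x;k) = e^{φ(x)/2} √(χ²(x) - χ²(x - η))` and `ψ(x;k⁻¹) = e^{φ(x)/2} √(χ̄²(x) - χ̄²(x + η))`,
where the roots are the ones with leading terms `χ(x)` and `χ̄(x)`. -/
structure IsCTodaTau (φ : D.Pt → TodaFun) (W Wb : DiffOp D TodaFun) (τ : D.Pt → TimeFun) :
    Prop where
  unit : ∀ x, IsUnit (τ x)
  exp_phi : ∀ x, expSeries (restrict (φ x)) = (τ (D.shift 1 x) * (τ x)⁻¹) ^ 2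
  psi_eq : ∀ x, ∃ s : WaveFun,
    IsSqrtWithLeading s
      (chi (fun y => restrict (φ y)) τ x ^ 2
        - chi (fun y => restrict (φ y)) τ (D.shift (-1) x) ^ 2)
      (chi (fun y => restrict (φ y)) τ x) ∧
    psi W x = ofTime (expSeries ((1 / 2 : ℂ) • restrict (φ x))) * s
  psiInv_eq : ∀ x, ∃ s : WaveFun,
    IsSqrtWithLeading s (chiBar τ x ^ 2 - chiBar τ (D.shift 1 x) ^ 2) (chiBar τ x) ∧
    psiInv Wb x = ofTime (expSeries ((1 / 2 : ℂ) • restrict (φ x))) * s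

end Wave

end CToda

end

/-! On the slice put w = W^s and v = (W̄^s)†, two operators of order at most 0, and Λ = e^{η∂_x}.
The linear problems combine to ∂_m w = A_m w − w Λ^m, where A_m is B_m − B̄_m conjugated by e^{φ/2},
minus ∂_m φ/2. The C-Toda constraint makes A_m antisymmetric: the parts of B_m and B̄_m off the
diagonal are adjoint to each other in the symmetric gauge, and the diagonal part of B_m is ∂_m φ/2
(`IsWavePair.timeDer_gauge`, `adjoint_symGen`).

For (i), Z = vw commutes with Λ and does not depend on the times, so it is a series in Λ⁻¹ with
constant periodic coefficients and leading term 1; W' = W Z⁻¹ is again a wave operator, and it is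
normalized.

For (ii), wv = vw = 1. The evolution from t to t − [z] is N(z) = w(t−[z]) (1 − zΛ) v(t), because
exp(−∑ z^j Λ^j / j) = 1 − zΛ. Antisymmetric generators give an orthogonal evolution, so N† = N⁻¹ =
w(t) (1 − zΛ)⁻¹ v(t−[z]) (`adjoint_evolution`). This plays the role of the bilinear identity. Let
β(x;z) = ∑ w_{-s}(x) z^s, let b(x;z) = ∑ v_{-s}(x+sη) z^s, and let b̃ be b with its coefficients
taken at t − [z]. Put K(x;z,y) = ∑_m (zy)^m β(x−mη;z) β(x−mη;y) and F(x;z) = K(x;z,z). The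
coefficient of N† = N⁻¹ at Λ gives `adjointAmplitude_mul_amplitude`, and its action on the wave
function gives `map_amplitude_eq`. Together they yield the law F(x) → F(x+η) (`squareSum_shift`), a
formula for b̃²F, and the Fay identity `fay`.

By the Fay identity r = F/w_0² is a multiplicative cocycle: r(y) at t − [z] times r(z) is symmetric
in y and z. Its logarithmic derivative comes from a closed one-form (`exists_closed_of_cocycle`),
and the Poincaré lemma integrates half of it to log τ, so that r = (τ(t−[z])/τ(t))². The law for F
makes this compatible with τ(x+η) = e^{φ/2} τ(x), which fixes τ along each orbit. The formula for
ψ(k) is then the telescoping β(x)² = F(x) − z²F(x−η) with z = k⁻¹, and the formula for ψ(k⁻¹) is the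
one for b̃²F moved back from t − [z] to t. -/

noncomputable section

namespace CToda

open PowerSeries Finset

/-! ### Power series in z, and in an outer variable y and an inner variable z. -/

section Iterated

/-- The Euler operator `z d/dz` on formal power series. -/
def euler {S : Type*} [Semiring S] : S⟦X⟧ →+ S⟦X⟧ where
  toFun f := PowerSeries.mk fun k => k • coeff k f
  map_zero' := by ext; simp
  map_add' f g := by ext; simp [smul_add]

@[simp]
theorem coeff_euler {S : Type*} [Semiring S] (f : S⟦X⟧) (k : ℕ) :
    coeff k (euler f) = k • coeff k f := by
  simp [euler]

theorem euler_mul {S : Type*} [Semiring S] (f g : S⟦X⟧) :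
    euler (f * g) = euler f * g + f * euler g := by
  ext k
  simp only [coeff_euler, map_add, coeff_mul, smul_sum, ← sum_add_distrib]
  refine sum_congr rfl fun p hp => ?_
  rw [← mem_antidiagonal.1 hp, add_smul, smul_mul_assoc, mul_smul_comm]

@[simp]
theorem euler_C {S : Type*} [Semiring S] (a : S) : euler (C a) = 0 := by
  ext k
  rcases k with _ | k
  · simp
  · simp [coeff_succ_C]

theorem euler_one {S : Type*} [Semiring S] : euler (1 : S⟦X⟧) = 0 := by
  rw [← map_one C, euler_C]

theorem euler_map {S S' : Type*} [Semiring S] [Semiring S'] (g : S →+* S') (f : S⟦X⟧) :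
    euler (map g f) = map g (euler f) := by
  ext k
  simp

/-- Linear first-order equations for `z d/dz` determine a power series by its constant term. -/
theorem eq_of_euler_eq_mul {S : Type*} [Ring S] [IsAddTorsionFree S] {p u v : S⟦X⟧}
    (hp : coeff 0 p = 0) (hu : euler u = p * u) (hv : euler v = p * v)
    (h0 : coeff 0 u = coeff 0 v) : u = v := by
  ext k
  induction k using Nat.strong_induction_on with
  | _ k ih =>
    rcases Nat.eq_zero_or_pos k with rfl | hk
    · exact h0
    · have h1 : k • coeff k u = k • coeff k v := by
        rw [← coeff_euler, ← coeff_euler, hu, hv, coeff_mul, coeff_mul]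
        refine sum_congr rfl fun q hq => ?_
        have hq' := mem_antidiagonal.1 hq
        rcases Nat.eq_zero_or_pos q.1 with h | h
        · rw [h, hp, zero_mul, zero_mul]
        · rw [ih q.2 (by omega)]
      exact nsmul_right_injective hk.ne' h1

variable {R : Type*} [CommRing R]

/-- Exchange of the two variables of an iterated power series. -/
def swap : R⟦X⟧⟦X⟧ →+* R⟦X⟧⟦X⟧ where
  toFun f := PowerSeries.mk fun j => PowerSeries.mk fun i => coeff j (coeff i f)
  map_one' := by
    ext j i
    simp only [coeff_mk, coeff_one]
    by_cases hi : i = 0 <;> by_cases hj : j = 0 <;> simp [hi, hj, coeff_one]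
  map_zero' := by ext; simp
  map_add' f g := by ext; simp
  map_mul' f g := by
    ext j i
    simp only [coeff_mk, coeff_mul, map_sum]
    rw [sum_comm]

@[simp]
theorem coeff_coeff_swap (f : R⟦X⟧⟦X⟧) (i j : ℕ) :
    coeff i (coeff j (swap f)) = coeff j (coeff i f) := by
  simp [swap]

@[simp]
theorem swap_swap (f : R⟦X⟧⟦X⟧) : swap (swap f) = f := by
  ext; simp

@[simp]
theorem swap_C (f : R⟦X⟧) : swap (C f) = map C f := by
  ext j i
  simp only [coeff_coeff_swap, coeff_map, coeff_C]
  split_ifs <;> simp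

@[simp]
theorem swap_map_C (f : R⟦X⟧) : swap (map C f) = C f := by
  rw [← swap_C, swap_swap]

@[simp]
theorem swap_X : swap (X : R⟦X⟧⟦X⟧) = C X := by
  rw [← map_X (C (R := R)), swap_map_C]

/-- Restriction of an iterated power series to the diagonal. -/
def diag : R⟦X⟧⟦X⟧ →+* R⟦X⟧ where
  toFun f := PowerSeries.mk fun k => ∑ p ∈ antidiagonal k, coeff p.1 (coeff p.2 f)
  map_one' := by
    ext k
    rw [coeff_mk, coeff_one]
    rcases Nat.eq_zero_or_pos k with rfl | hk
    · simp
    · rw [if_neg hk.ne']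
      refine sum_eq_zero fun p hp => ?_
      have := mem_antidiagonal.1 hp
      rw [coeff_one]
      split_ifs with h
      · rw [coeff_one, if_neg (by omega)]
      · simp
  map_zero' := by ext; simp
  map_add' f g := by ext; simp [sum_add_distrib]
  map_mul' f g := by
    ext k
    simp only [coeff_mk, coeff_mul, map_sum, sum_mul_sum]
    simp only [sum_sigma']
    refine sum_nbij' (fun s => ⟨(s.2.2.1 + s.2.1.1, s.2.2.2 + s.2.1.2),
        (s.2.2.1, s.2.1.1), (s.2.2.2, s.2.1.2)⟩)
      (fun s => ⟨(s.2.1.1 + s.2.2.1, s.2.1.2 + s.2.2.2),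
        (s.2.1.2, s.2.2.2), (s.2.1.1, s.2.2.1)⟩) ?_ ?_ ?_ ?_ ?_
    · rintro ⟨⟨a, b⟩, ⟨c, d⟩, ⟨e, f⟩⟩ h
      simp only [mem_sigma, HasAntidiagonal.mem_antidiagonal] at h ⊢
      refine ⟨by omega, trivial, trivial⟩
    · rintro ⟨⟨a, b⟩, ⟨c, d⟩, ⟨e, f⟩⟩ h
      simp only [mem_sigma, HasAntidiagonal.mem_antidiagonal] at h ⊢
      refine ⟨by omega, trivial, trivial⟩
    · rintro ⟨⟨a, b⟩, ⟨c, d⟩, ⟨e, f⟩⟩ h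
      simp only [mem_sigma, HasAntidiagonal.mem_antidiagonal] at h
      obtain ⟨h1, rfl, rfl⟩ := h
      rfl
    · rintro ⟨⟨a, b⟩, ⟨c, d⟩, ⟨e, f⟩⟩ h
      simp only [mem_sigma, HasAntidiagonal.mem_antidiagonal] at h
      obtain ⟨h1, rfl, rfl⟩ := h
      rfl
    · rintro ⟨⟨a, b⟩, ⟨c, d⟩, ⟨e, f⟩⟩ h
      rfl

theorem coeff_diag (f : R⟦X⟧⟦X⟧) (k : ℕ) :
    coeff k (diag f) = ∑ p ∈ antidiagonal k, coeff p.1 (coeff p.2 f) := by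
  simp [diag]

@[simp]
theorem diag_C (f : R⟦X⟧) : diag (C f) = f := by
  ext k
  rw [coeff_diag, sum_eq_single (k, 0)]
  · simp
  · rintro ⟨i, j⟩ h1 h2
    have h3 : j ≠ 0 := by
      rintro rfl
      apply h2
      simpa using h1
    simp [coeff_C, h3]
  · simp

@[simp]
theorem diag_map_C (f : R⟦X⟧) : diag (map C f) = f := by
  ext k
  rw [coeff_diag, sum_eq_single (0, k)]
  · simp
  · rintro ⟨i, j⟩ h1 h2
    have h3 : i ≠ 0 := by
      rintro rfl
      apply h2
      simpa using h1
    simp [coeff_C, h3]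
  · simp

@[simp]
theorem diag_X : diag (X : R⟦X⟧⟦X⟧) = X := by
  rw [← map_X (C (R := R)), diag_map_C]

/-- A family of power series over the points of a dynamical system that reproduces itself up to a
factor divisible by the variable vanishes. -/
theorem eq_zero_of_eq_X_mul {P : Type*} (s : P → P) {c f : P → R⟦X⟧}
    (h : ∀ x, f x = X * c x * f (s x)) : f = 0 := by
  suffices H : ∀ k x, coeff k (f x) = 0 by
    ext x k
    simpa using H k x
  intro k
  induction k using Nat.strong_induction_on with
  | _ k ih =>
    intro x
    rw [h x, mul_assoc]
    rcases k with _ | k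
    · simp
    · rw [coeff_succ_X_mul, coeff_mul]
      refine sum_eq_zero fun p hp => ?_
      rw [ih p.2 (by have := mem_antidiagonal.1 hp; omega), mul_zero]

/-- This is the cancellation of y − z. Comparing powers of y gives z f_0 = 0 and z f_{k+1} = f_k,
and multiplication by z is injective over any coefficient ring. -/
theorem X_sub_C_X_mul_cancel {f : R⟦X⟧⟦X⟧} (h : (X - C X) * f = 0) : f = 0 := by
  have h1 : ∀ k, X * coeff k f = if k = 0 then 0 else coeff (k - 1) f := by
    intro k
    have h2 := congrArg (coeff k) h
    rw [sub_mul, map_sub, coeff_C_mul, map_zero, sub_eq_zero] at h2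
    rw [← h2]
    rcases k with _ | k
    · simp
    · simp [coeff_succ_X_mul]
  ext1 k
  induction k with
  | zero =>
    have h2 := h1 0
    rw [if_pos rfl, ← mul_zero X] at h2
    simpa using X_mul_cancel h2
  | succ k ih =>
    have h2 := h1 (k + 1)
    rw [if_neg k.succ_ne_zero, Nat.add_sub_cancel, ih, map_zero, ← mul_zero X] at h2
    simpa using X_mul_cancel h2

end Iterated

/-! ### Miwa shifts as flows in z. -/

section MiwaShift

variable {R : Type*} [CommRing R]

/-- The `z`-linear extension to `R⟦z⟧` of a homomorphism `R → R⟦z⟧`. -/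
def zExtend (T : R →+* R⟦X⟧) : R⟦X⟧ →+* R⟦X⟧ := diag.comp (map T)

theorem coeff_zExtend (T : R →+* R⟦X⟧) (f : R⟦X⟧) (k : ℕ) :
    coeff k (zExtend T f) = ∑ p ∈ antidiagonal k, coeff p.1 (T (coeff p.2 f)) := by
  simp [zExtend, coeff_diag]

@[simp]
theorem zExtend_C (T : R →+* R⟦X⟧) (a : R) : zExtend T (C a) = T a := by
  simp [zExtend]

@[simp]
theorem zExtend_X (T : R →+* R⟦X⟧) : zExtend T X = X := by
  simp [zExtend]

/-- `T` is a Miwa shift by `ε [z]` for the commuting derivations `D_j` (with `D_0 = 0`), that is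
`T f = exp (ε ∑_j z^j D_j / j) f`; the condition is the differential equation of `T f` in `z`. -/
structure IsMiwaShift (D : ℕ → Derivation ℤ R R) (ε : ℤ) (T : R →+* R⟦X⟧) : Prop where
  D_zero : D 0 = 0
  D_comm : ∀ i j f, D i (D j f) = D j (D i f)
  coeff_zero : ∀ f, coeff 0 (T f) = f
  euler_eq : ∀ k f, k • coeff k (T f) =
    ε • ∑ p ∈ antidiagonal k, coeff p.1 (T (D p.2 f))

namespace IsMiwaShift

variable {D : ℕ → Derivation ℤ R R} {ε : ℤ} {T : R →+* R⟦X⟧}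

theorem euler_apply (hT : IsMiwaShift D ε T) (f : R) :
    euler (T f) = ε • zExtend T (PowerSeries.mk fun j => D j f) := by
  ext k
  rw [coeff_euler, hT.euler_eq, map_zsmul, coeff_zExtend]
  simp

/-- Since D_0 = 0, the differential equation in z expresses the coefficient of order k through those
of lower order, and the derivations commute. -/
theorem coeff_D [IsAddTorsionFree R] (hT : IsMiwaShift D ε T) (j k : ℕ) (f : R) :
    coeff k (T (D j f)) = D j (coeff k (T f)) := by
  induction k using Nat.strong_induction_on generalizing f with
  | _ k ih =>
    rcases Nat.eq_zero_or_pos k with rfl | hk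
    · rw [hT.coeff_zero, hT.coeff_zero]
    · apply nsmul_right_injective hk.ne'
      change k • _ = k • _
      rw [hT.euler_eq, ← map_nsmul, hT.euler_eq, map_zsmul, map_sum]
      congr 1
      refine sum_congr rfl fun p hp => ?_
      have hp' := mem_antidiagonal.1 hp
      rcases Nat.eq_zero_or_pos p.2 with h | h
      · rw [h, hT.D_zero]
        simp
      · rw [hT.D_comm, ih p.1 (by omega)]

/-- The recursion in z for T again, with `coeff_D` used to move the derivations through T'. -/
theorem coeff_comm [IsAddTorsionFree R] {ε' : ℤ} {T' : R →+* R⟦X⟧} (hT : IsMiwaShift D ε T)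
    (hT' : IsMiwaShift D ε' T') (i j : ℕ) (f : R) :
    coeff i (T (coeff j (T' f))) = coeff j (T' (coeff i (T f))) := by
  induction i using Nat.strong_induction_on generalizing f with
  | _ i ih =>
    rcases Nat.eq_zero_or_pos i with rfl | hk
    · rw [hT.coeff_zero, hT.coeff_zero]
    · apply nsmul_right_injective hk.ne'
      change i • _ = i • _
      rw [hT.euler_eq, ← map_nsmul, ← map_nsmul, hT.euler_eq, map_zsmul, map_zsmul, map_sum,
        map_sum]
      congr 1
      refine sum_congr rfl fun p hp => ?_
      have hp' := mem_antidiagonal.1 hp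
      rcases Nat.eq_zero_or_pos p.2 with h | h
      · rw [h, hT.D_zero]
        simp
      · rw [← hT'.coeff_D, ih p.1 (by omega)]

/-- At z = 0 the shift is the identity, so the extension is triangular on coefficients with identity
diagonal. -/
theorem zExtend_injective (hT : IsMiwaShift D ε T) : Function.Injective (zExtend T) := by
  rw [injective_iff_map_eq_zero]
  intro f hf
  ext k
  induction k using Nat.strong_induction_on with
  | _ k ih =>
    have h := congrArg (coeff k) hf
    rw [coeff_zExtend, sum_eq_single (0, k)] at h
    · simpa [hT.coeff_zero] using h
    · rintro ⟨i, j⟩ h1 h2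
      have h3 : i + j = k := mem_antidiagonal.1 h1
      have h4 : j < k := by
        rcases Nat.eq_zero_or_pos i with rfl | h
        · exact absurd (by simp [← h3]) h2
        · omega
      simp [ih j h4]
    · simp

/-- Opposite Miwa shifts are inverse to each other. -/
theorem zExtend_apply_apply [IsAddTorsionFree R] {T' : R →+* R⟦X⟧} (hT : IsMiwaShift D ε T)
    (hT' : IsMiwaShift D (-ε) T') (f : R) : zExtend T' (T f) = C f := by
  ext k
  rcases Nat.eq_zero_or_pos k with rfl | hk
  · simp [coeff_zExtend, hT.coeff_zero, hT'.coeff_zero]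
  rw [coeff_C, if_neg hk.ne']
  apply nsmul_right_injective hk.ne'
  change k • _ = k • 0
  rw [smul_zero, coeff_zExtend, smul_sum]
  -- The weight k = p.1 + p.2 is split between the differential equations of the two shifts. The two
  -- triple sums that result carry opposite signs and agree after reindexing.
  have h1 : ∀ p ∈ antidiagonal k, k • coeff p.1 (T' (coeff p.2 (T f))) =
      -(ε • ∑ q ∈ antidiagonal p.1, coeff q.1 (T' (coeff p.2 (T (D q.2 f))))) +
      ε • ∑ q ∈ antidiagonal p.2, coeff p.1 (T' (coeff q.1 (T (D q.2 f)))) := by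
    intro p hp
    have hp' := mem_antidiagonal.1 hp
    rw [← hp', add_smul, hT'.euler_eq, ← map_nsmul, ← map_nsmul, hT.euler_eq, map_zsmul, map_zsmul,
      map_sum, map_sum, neg_smul]
    congr 4 with q
    rw [hT.coeff_D]
  rw [sum_congr rfl h1, sum_add_distrib, sum_neg_distrib, neg_add_eq_zero, ← smul_sum, ← smul_sum]
  congr 1
  simp only [sum_sigma']
  refine sum_nbij' (fun s => ⟨(s.2.1, s.1.2 + s.2.2), (s.1.2, s.2.2)⟩)
    (fun s => ⟨(s.1.1 + s.2.2, s.2.1), (s.1.1, s.2.2)⟩) ?_ ?_ ?_ ?_ ?_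
  · rintro ⟨⟨a, b⟩, ⟨c, d⟩⟩ h
    simp only [mem_sigma, HasAntidiagonal.mem_antidiagonal] at h ⊢
    exact ⟨by omega, by simp⟩
  · rintro ⟨⟨a, b⟩, ⟨c, d⟩⟩ h
    simp only [mem_sigma, HasAntidiagonal.mem_antidiagonal] at h ⊢
    exact ⟨by omega, by simp⟩
  · rintro ⟨⟨a, b⟩, ⟨c, d⟩⟩ h
    simp only [mem_sigma, HasAntidiagonal.mem_antidiagonal] at h
    obtain ⟨h1, rfl⟩ := h
    rfl
  · rintro ⟨⟨a, b⟩, ⟨c, d⟩⟩ h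
    simp only [mem_sigma, HasAntidiagonal.mem_antidiagonal] at h
    obtain ⟨h1, rfl⟩ := h
    rfl
  · rintro ⟨⟨a, b⟩, ⟨c, d⟩⟩ h
    rfl

theorem zExtend_zExtend [IsAddTorsionFree R] {T' : R →+* R⟦X⟧} (hT : IsMiwaShift D ε T)
    (hT' : IsMiwaShift D (-ε) T') (f : R⟦X⟧) : zExtend T' (zExtend T f) = f := by
  ext k
  simp only [coeff_zExtend, map_sum]
  calc _ = ∑ p ∈ antidiagonal k, coeff p.1 (zExtend T' (T (coeff p.2 f))) := by
        simp only [coeff_zExtend, sum_sigma']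
        refine sum_nbij' (fun s => ⟨(s.1.1 + s.2.1, s.2.2), (s.1.1, s.2.1)⟩)
          (fun s => ⟨(s.2.1, s.2.2 + s.1.2), (s.2.2, s.1.2)⟩) ?_ ?_ ?_ ?_ ?_
        · rintro ⟨⟨a, b⟩, ⟨c, d⟩⟩ h
          simp only [mem_sigma, HasAntidiagonal.mem_antidiagonal] at h ⊢
          exact ⟨by omega, by simp⟩
        · rintro ⟨⟨a, b⟩, ⟨c, d⟩⟩ h
          simp only [mem_sigma, HasAntidiagonal.mem_antidiagonal] at h ⊢
          exact ⟨by omega, by simp⟩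
        · rintro ⟨⟨a, b⟩, ⟨c, d⟩⟩ h
          simp only [mem_sigma, HasAntidiagonal.mem_antidiagonal] at h
          obtain ⟨h1, rfl⟩ := h
          rfl
        · rintro ⟨⟨a, b⟩, ⟨c, d⟩⟩ h
          simp only [mem_sigma, HasAntidiagonal.mem_antidiagonal] at h
          obtain ⟨h1, rfl⟩ := h
          rfl
        · rintro ⟨⟨a, b⟩, ⟨c, d⟩⟩ h
          rfl
    _ = ∑ p ∈ antidiagonal k, coeff p.1 (C (coeff p.2 f)) := by
        simp only [hT.zExtend_apply_apply hT']
    _ = coeff k f := by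
        rw [← congrArg (coeff k) (diag_map_C f), coeff_diag]
        simp

end IsMiwaShift

end MiwaShift

end CToda

end

noncomputable section

namespace CToda

open PowerSeries Finset

/-! ### Integration of multiplicative cocycles of the Miwa shifts. -/

section Cocycle

variable {R : Type*} [CommRing R]

/-- A derivation acting on the coefficients of a power series. -/
def coeffDeriv (d : Derivation ℤ R R) : R⟦X⟧ →+ R⟦X⟧ where
  toFun f := PowerSeries.mk fun k => d (coeff k f)
  map_zero' := by ext; simp
  map_add' f g := by ext; simp

@[simp]
theorem coeff_coeffDeriv (d : Derivation ℤ R R) (f : R⟦X⟧) (k : ℕ) :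
    coeff k (coeffDeriv d f) = d (coeff k f) := by
  simp [coeffDeriv]

theorem coeffDeriv_mul (d : Derivation ℤ R R) (f g : R⟦X⟧) :
    coeffDeriv d (f * g) = coeffDeriv d f * g + f * coeffDeriv d g := by
  ext k
  simp only [coeff_coeffDeriv, map_add, coeff_mul, map_sum, Derivation.leibniz, smul_eq_mul,
    ← sum_add_distrib]
  refine sum_congr rfl fun p _ => by ring

theorem euler_coeffDeriv (d : Derivation ℤ R R) (f : R⟦X⟧) :
    euler (coeffDeriv d f) = coeffDeriv d (euler f) := by
  ext k
  simp

variable [IsAddTorsionFree R] {D : ℕ → Derivation ℤ R R} {T T' : R →+* R⟦X⟧}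

/-- A multiplicative cocycle `r(z)` for the Miwa shifts, `r(z) T_z r(y) = r(y) T_y r(z)`, has a
logarithmic derivative that comes from a closed one-form `∑ f_j dt_j`. -/
theorem exists_closed_of_cocycle (hT : IsMiwaShift D (-1) T) (hT' : IsMiwaShift D 1 T')
    {r : R⟦X⟧} (hr : IsUnit r) (hsymm : swap (C r * map T r) = C r * map T r) :
    ∃ f : R⟦X⟧, (∀ i j, D i (coeff j f) = D j (coeff i f)) ∧
      euler r = -(zExtend T f * r) := by
  obtain ⟨s, hs⟩ := hr.exists_right_inv
  obtain ⟨h, hh⟩ : ∃ h, euler r = -(h * r) :=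
    ⟨-(euler r * s), by rw [neg_mul, neg_neg, mul_assoc, mul_comm s r, hs, mul_one]⟩
  -- The opposite shift inverts T, so h can be written as f evaluated at t − [z].
  obtain ⟨f, hf⟩ : ∃ f, zExtend T f = h := ⟨zExtend T' h, hT'.zExtend_zExtend hT h⟩
  refine ⟨f, ?_, by rw [hf, hh]⟩
  -- `TT` is the shift by −[y] in the outer variable, linear in both variables, whereas `map T` is
  -- the shift by −[z].
  let TT : R⟦X⟧⟦X⟧ →+* R⟦X⟧⟦X⟧ := swap.comp ((map (zExtend T)).comp swap)
  have TT_apply : ∀ g, TT g = swap (map (zExtend T) (swap g)) := fun g => rfl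
  have TT_inj : Function.Injective TT := by
    intro a b hab
    rw [TT_apply, TT_apply] at hab
    have h1 := congrArg swap hab
    rw [swap_swap, swap_swap] at h1
    have h2 := congrArg swap (PowerSeries.map_injective _ hT.zExtend_injective h1)
    rwa [swap_swap, swap_swap] at h2
  have TT_C : TT (C r) = swap (map T r) := by
    rw [TT_apply, swap_C]
    congr 1
    ext1 k
    simp
  have TT_map_C : TT (map C f) = map C h := by
    rw [TT_apply, swap_map_C, map_C, swap_C, hf]
  have TT_map_T : TT (map T f) = map T h := by
    rw [← hf, TT_apply]
    ext k l
    simp only [coeff_coeff_swap, coeff_map, coeff_zExtend, map_sum]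
    exact sum_congr rfl fun p _ => hT.coeff_comm hT _ _ _
  let Dr : R⟦X⟧⟦X⟧ := PowerSeries.mk fun j => coeffDeriv (D j) r
  have TT_Dr : euler (swap (map T r)) = -TT Dr := by
    rw [TT_apply]
    ext k l
    simp only [coeff_euler, map_neg, map_nsmul, coeff_coeff_swap, coeff_map, hT.euler_eq,
      coeff_zExtend, neg_smul, one_smul, Dr, coeff_mk, coeff_coeffDeriv]
  have hS : C r * map T r = map C r * swap (map T r) := by
    rw [← hsymm, map_mul, swap_C]
  -- `e1` and `e2` are y d/dy applied to the two sides of r(z) r(y)|_{t−[z]} = r(y) r(z)|_{t−[y]}.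
  have e1 : euler (C r * map T r) = -(map C r * swap (map T r) * map T h) := by
    rw [euler_mul, euler_C, zero_mul, zero_add, euler_map, hh, ← hS]
    simp only [map_neg, map_mul]
    ring
  have e2 : euler (C r * map T r) =
      -(map C r * swap (map T r) * map C h) - map C r * TT Dr := by
    rw [hS, euler_mul, TT_Dr, euler_map, hh]
    simp only [map_neg, map_mul]
    ring
  have e3 : map C r * (TT (C r) * (TT (map T f) - TT (map C f)) - TT Dr) = 0 := by
    rw [TT_map_C, TT_map_T, TT_C]
    linear_combination e1 - e2
  -- Every term of `e3` apart from the unit r(y) is an image of `TT`, so the shift by −[y] can be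
  -- undone. The result says D_j log r(z) = f_j(t−[z]) − f_j(t).
  have e4 : C r * (map T f - map C f) = Dr := by
    apply TT_inj
    have hu : IsUnit (map (C (R := R)) r) := hr.map _
    rw [map_mul, map_sub, ← sub_eq_zero]
    exact hu.mul_right_eq_zero.1 e3
  have e5 : ∀ j, r * (T (coeff j f) - C (coeff j f)) = coeffDeriv (D j) r := by
    intro j
    have := congrArg (coeff j) e4
    rw [coeff_C_mul, map_sub, coeff_map, coeff_map] at this
    rw [this, coeff_mk]
  -- Apply z d/dz to `e5` and compare with D_j applied to the logarithmic derivative of r: this is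
  -- closedness, evaluated at t − [z].
  have e6 : ∀ j, zExtend T (PowerSeries.mk fun i => D i (coeff j f)) =
      zExtend T (coeffDeriv (D j) f) := by
    intro j
    have h1 := congrArg euler (e5 j)
    rw [euler_mul, euler_coeffDeriv, hh, map_neg, coeffDeriv_mul, map_sub, euler_C, sub_zero,
      hT.euler_apply, ← e5 j, neg_one_smul] at h1
    have h2 : coeffDeriv (D j) h = zExtend T (coeffDeriv (D j) f) := by
      rw [← hf]
      ext k
      simp only [coeff_coeffDeriv, coeff_zExtend, map_sum, hT.coeff_D]
    rw [← h2]
    have h3 : r * (zExtend T (PowerSeries.mk fun i => D i (coeff j f)) - coeffDeriv (D j) h) =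
        0 := by
      linear_combination -h1
    exact sub_eq_zero.1 (hr.mul_right_eq_zero.1 h3)
  intro i j
  have := congrArg (coeff i) (hT.zExtend_injective (e6 j))
  simpa using this

/-- A power series with logarithmic derivatives `f_j / 2` is the square root of the potential of
the cocycle. -/
theorem miwa_sq_of_log_deriv (hT : IsMiwaShift D (-1) T) {r f : R⟦X⟧} (hr0 : coeff 0 r = 1)
    (hf0 : coeff 0 f = 0) (hr : euler r = -(zExtend T f * r)) {τ : R}
    (hτ : ∀ j, 2 * D j τ = coeff j f * τ) : T τ ^ 2 = C τ ^ 2 * r := by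
  have h1 : euler (T τ) * 2 = -(zExtend T f * T τ) := by
    rw [hT.euler_apply, neg_one_smul, neg_mul, ← zExtend_C T τ, ← map_mul]
    congr 1
    have h2 : (2 : R⟦X⟧) = zExtend T 2 := (map_ofNat (zExtend T) 2).symm
    rw [h2, ← map_mul]
    congr 1
    ext k
    rw [coeff_mul_C, ← hτ, mul_comm (PowerSeries.mk _), show (2 : R⟦X⟧) = C 2 from (map_ofNat C 2).symm,
      coeff_C_mul, coeff_mk]
  -- Both sides have the logarithmic derivative −f(t−[z]) in z and the same value at z = 0.
  refine eq_of_euler_eq_mul (p := -zExtend T f) ?_ ?_ ?_ ?_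
  · rw [map_neg, coeff_zExtend]
    simp only [Nat.antidiagonal_zero, sum_singleton, hT.coeff_zero, hf0, neg_zero]
  · rw [pow_two, euler_mul]
    linear_combination T τ * h1
  · rw [euler_mul, hr, ← map_pow, euler_C]
    ring
  · rw [← map_pow, hT.coeff_zero, ← map_pow, coeff_C_mul, hr0, mul_one]

end Cocycle

end CToda

end

noncomputable section

namespace CToda

open Finset

/-! ### The ring of difference operators of order bounded above. -/

section Shift

variable {η : ℂ} (D : ShiftDomain η)

@[simp]
theorem ShiftDomain.shift_zero (x : D.Pt) : D.shift 0 x = x := by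
  apply Subtype.ext
  simp [ShiftDomain.shift]

@[simp]
theorem ShiftDomain.shift_shift (m n : ℤ) (x : D.Pt) :
    D.shift m (D.shift n x) = D.shift (m + n) x := by
  apply Subtype.ext
  simp only [ShiftDomain.shift]
  push_cast
  ring

theorem DiffOp.adjoint_adjoint {R : Type} (A : DiffOp D R) : A.adjoint.adjoint = A := by
  funext n x
  simp [DiffOp.adjoint]

end Shift

section LowerOperators

variable {η : ℂ} {D : ShiftDomain η} {R : Type} [CommRing R]

/-- The order of the operator is at most `N`. -/
def DiffOp.OrderLE (A : DiffOp D R) (N : ℤ) : Prop := ∀ n, N < n → ∀ x, A n x = 0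

theorem DiffOp.OrderLE.mono {A : DiffOp D R} {M N : ℤ} (h : A.OrderLE M) (hMN : M ≤ N) :
    A.OrderLE N := fun n hn => h n (hMN.trans_lt hn)

theorem DiffOp.comp_apply {A B : DiffOp D R} {a b : ℤ} (hA : A.OrderLE a) (hB : B.OrderLE b)
    (n : ℤ) (x : D.Pt) {l u : ℤ} (hl : l ≤ n - b) (hu : a ≤ u) :
    A.comp B n x = ∑ i ∈ Icc l u, A i x * B (n - i) (D.shift i x) := by
  refine finsum_eq_sum_of_support_subset _ fun i hi => ?_
  rw [Function.mem_support] at hi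
  rw [coe_Icc, Set.mem_Icc]
  constructor
  · by_contra h
    exact hi (by rw [hB (n - i) (by omega), mul_zero])
  · by_contra h
    exact hi (by rw [hA i (by omega), zero_mul])

theorem DiffOp.OrderLE.comp {A B : DiffOp D R} {a b : ℤ} (hA : A.OrderLE a) (hB : B.OrderLE b) :
    (A.comp B).OrderLE (a + b) := by
  intro n hn x
  rw [DiffOp.comp_apply hA hB n x le_rfl le_rfl, Icc_eq_empty (by omega), sum_empty]

/-- Bounded orders make all sums finite. The ranges are enlarged until none depends on the other
summation index, and then the sums are exchanged. -/
theorem DiffOp.comp_assoc {A B C : DiffOp D R} {a b c : ℤ} (hA : A.OrderLE a) (hB : B.OrderLE b)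
    (hC : C.OrderLE c) : (A.comp B).comp C = A.comp (B.comp C) := by
  funext n x
  rw [DiffOp.comp_apply (hA.comp hB) hC n x le_rfl le_rfl,
    DiffOp.comp_apply hA (hB.comp hC) n x (l := n - b - c) (by omega) le_rfl]
  calc _ = ∑ k ∈ Icc (n - c) (a + b), ∑ i ∈ Icc (n - b - c) a,
        A i x * (B (k - i) (D.shift i x) * C (n - k) (D.shift k x)) := by
        refine sum_congr rfl fun k hk => ?_
        rw [mem_Icc] at hk
        rw [DiffOp.comp_apply hA hB k x (l := n - b - c) (by omega) le_rfl, sum_mul]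
        exact sum_congr rfl fun i _ => mul_assoc _ _ _
    _ = _ := by
        rw [sum_comm]
        refine sum_congr rfl fun i hi => ?_
        rw [mem_Icc] at hi
        rw [← mul_sum, DiffOp.comp_apply hB hC _ _ (l := n - i - c) (u := a + b - i)
          (by omega) (by omega)]
        congr 1
        refine sum_nbij' (fun k => k - i) (fun j => j + i) ?_ ?_ ?_ ?_ ?_
        · intro k hk
          rw [mem_Icc] at hk ⊢
          omega
        · intro k hk
          rw [mem_Icc] at hk ⊢
          omega
        · intro k _
          simp
        · intro k _
          simp
        · intro k _
          rw [D.shift_shift]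
          simp

theorem DiffOp.adjoint_comp (A B : DiffOp D R) :
    (A.comp B).adjoint = B.adjoint.comp A.adjoint := by
  funext n x
  simp only [DiffOp.adjoint, DiffOp.comp]
  rw [← finsum_comp_equiv (Equiv.subRight n)]
  refine finsum_congr fun i => ?_
  simp only [Equiv.subRight_apply, D.shift_shift]
  rw [mul_comm]
  congr 2
  · ring
  · congr 1; ring
  · ring
  · congr 1; ring

theorem DiffOp.adjoint_shiftOp (m : ℤ) :
    (DiffOp.shiftOp m : DiffOp D R).adjoint = DiffOp.shiftOp (-m) := by
  funext n x
  simp only [DiffOp.adjoint, DiffOp.shiftOp]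
  congr 1
  exact propext ⟨fun h => by omega, fun h => by omega⟩

variable (D R) in
/-- The operators of bounded order. -/
def lowerAddSubgroup : AddSubgroup (DiffOp D R) where
  carrier := {A | ∃ N, A.OrderLE N}
  zero_mem' := ⟨0, fun _ _ _ => rfl⟩
  add_mem' := by
    rintro A B ⟨M, hM⟩ ⟨N, hN⟩
    refine ⟨max M N, fun n hn x => ?_⟩
    change A n x + B n x = 0
    rw [hM n (by omega), hN n (by omega), add_zero]
  neg_mem' := by
    rintro A ⟨M, hM⟩
    refine ⟨M, fun n hn x => ?_⟩
    change -A n x = 0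
    rw [hM n hn, neg_zero]

variable (D R) in
/-- The ring of difference operators of bounded order. -/
def LowerOp : Type := lowerAddSubgroup D R

namespace LowerOp

instance : AddCommGroup (LowerOp D R) := inferInstanceAs (AddCommGroup (lowerAddSubgroup D R))

/-- The underlying difference operator. -/
def toOp (A : LowerOp D R) : DiffOp D R := A.1

theorem exists_orderLE (A : LowerOp D R) : ∃ N, A.toOp.OrderLE N := A.2

/-- A difference operator of bounded order. -/
def of (A : DiffOp D R) {N : ℤ} (h : A.OrderLE N) : LowerOp D R := ⟨A, N, h⟩

@[simp]
theorem toOp_of (A : DiffOp D R) {N : ℤ} (h : A.OrderLE N) : (of A h).toOp = A := rfl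

@[ext]
theorem ext {A B : LowerOp D R} (h : ∀ n x, A.toOp n x = B.toOp n x) : A = B :=
  Subtype.ext (funext fun n => funext fun x => h n x)

theorem toOp_injective : Function.Injective (toOp : LowerOp D R → DiffOp D R) :=
  Subtype.val_injective

@[simp] theorem toOp_zero : (0 : LowerOp D R).toOp = 0 := rfl

@[simp] theorem toOp_add (A B : LowerOp D R) : (A + B).toOp = A.toOp + B.toOp := rfl

@[simp] theorem toOp_neg (A : LowerOp D R) : (-A).toOp = -A.toOp := rfl

@[simp] theorem toOp_sub (A B : LowerOp D R) : (A - B).toOp = A.toOp - B.toOp := rfl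

/-- `toOp` as an additive homomorphism. -/
def toOpHom : LowerOp D R →+ DiffOp D R where
  toFun := toOp
  map_zero' := rfl
  map_add' _ _ := rfl

theorem toOp_sum {ι : Type*} (s : Finset ι) (f : ι → LowerOp D R) :
    (∑ i ∈ s, f i).toOp = ∑ i ∈ s, (f i).toOp := map_sum toOpHom f s

theorem toOp_nsmul (k : ℕ) (A : LowerOp D R) : (k • A).toOp = k • A.toOp :=
  map_nsmul toOpHom k A

/-- The operator `e^{m η ∂_x}`. -/
def shiftBy (m : ℤ) : LowerOp D R :=
  of (DiffOp.shiftOp m) (N := m) fun n hn _ => if_neg (by omega)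

@[simp]
theorem toOp_shiftBy (m : ℤ) : (shiftBy m : LowerOp D R).toOp = DiffOp.shiftOp m := rfl

/-- The composition. -/
def mul (A B : LowerOp D R) : LowerOp D R :=
  ⟨A.toOp.comp B.toOp, A.exists_orderLE.choose + B.exists_orderLE.choose,
    A.exists_orderLE.choose_spec.comp B.exists_orderLE.choose_spec⟩

instance : Mul (LowerOp D R) := ⟨mul⟩

instance : One (LowerOp D R) := ⟨shiftBy 0⟩

@[simp]
theorem toOp_mul (A B : LowerOp D R) : (A * B).toOp = A.toOp.comp B.toOp := rfl

theorem toOp_one : (1 : LowerOp D R).toOp = DiffOp.shiftOp 0 := rfl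

theorem mul_apply (A B : LowerOp D R) {a b : ℤ} (hA : A.toOp.OrderLE a) (hB : B.toOp.OrderLE b)
    (n : ℤ) (x : D.Pt) {l u : ℤ} (hl : l ≤ n - b) (hu : a ≤ u) :
    (A * B).toOp n x = ∑ i ∈ Icc l u, A.toOp i x * B.toOp (n - i) (D.shift i x) :=
  DiffOp.comp_apply hA hB n x hl hu

@[simp]
theorem shiftBy_mul_apply (m : ℤ) (A : LowerOp D R) (n : ℤ) (x : D.Pt) :
    (shiftBy m * A).toOp n x = A.toOp (n - m) (D.shift m x) := by
  change ∑ᶠ i : ℤ, _ = _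
  rw [finsum_eq_single _ m]
  · simp [DiffOp.shiftOp]
  · intro i hi
    simp [DiffOp.shiftOp, hi]

@[simp]
theorem mul_shiftBy_apply (A : LowerOp D R) (m : ℤ) (n : ℤ) (x : D.Pt) :
    (A * shiftBy m).toOp n x = A.toOp (n - m) x := by
  change ∑ᶠ i : ℤ, _ = _
  rw [finsum_eq_single _ (n - m)]
  · simp [DiffOp.shiftOp]
  · intro i hi
    simp only [toOp_shiftBy, DiffOp.shiftOp]
    rw [if_neg (by omega), mul_zero]

theorem right_distrib_comp (A B C : LowerOp D R) : (A + B) * C = A * C + B * C := by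
  obtain ⟨a, ha⟩ := A.exists_orderLE
  obtain ⟨b, hb⟩ := B.exists_orderLE
  obtain ⟨c, hc⟩ := C.exists_orderLE
  obtain ⟨d, hd⟩ := (A + B).exists_orderLE
  ext n x
  rw [toOp_add, Pi.add_apply, Pi.add_apply,
    mul_apply _ _ ha hc n x le_rfl (u := max (max a b) d) (by omega),
    mul_apply _ _ hb hc n x le_rfl (u := max (max a b) d) (by omega),
    mul_apply _ _ hd hc n x le_rfl (u := max (max a b) d) (by omega), ← sum_add_distrib]
  exact sum_congr rfl fun i _ => add_mul _ _ _

theorem left_distrib_comp (A B C : LowerOp D R) : A * (B + C) = A * B + A * C := by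
  obtain ⟨a, ha⟩ := A.exists_orderLE
  obtain ⟨b, hb⟩ := B.exists_orderLE
  obtain ⟨c, hc⟩ := C.exists_orderLE
  obtain ⟨d, hd⟩ := (B + C).exists_orderLE
  ext n x
  rw [toOp_add, Pi.add_apply, Pi.add_apply,
    mul_apply _ _ ha hb n x (l := n - max (max b c) d) (by omega) le_rfl,
    mul_apply _ _ ha hc n x (l := n - max (max b c) d) (by omega) le_rfl,
    mul_apply _ _ ha hd n x (l := n - max (max b c) d) (by omega) le_rfl, ← sum_add_distrib]
  exact sum_congr rfl fun i _ => mul_add _ _ _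

instance : Ring (LowerOp D R) :=
  { (inferInstance : AddCommGroup (LowerOp D R)),
    (inferInstance : Mul (LowerOp D R)),
    (inferInstance : One (LowerOp D R)) with
    left_distrib := left_distrib_comp
    right_distrib := right_distrib_comp
    zero_mul := fun A => by
      have h := right_distrib_comp 0 0 A
      rw [add_zero] at h
      exact left_eq_add.1 h
    mul_zero := fun A => by
      have h := left_distrib_comp A 0 0
      rw [add_zero] at h
      exact left_eq_add.1 h
    mul_assoc := fun A B C => by
      obtain ⟨a, ha⟩ := A.exists_orderLE
      obtain ⟨b, hb⟩ := B.exists_orderLE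
      obtain ⟨c, hc⟩ := C.exists_orderLE
      exact toOp_injective (DiffOp.comp_assoc ha hb hc)
    one_mul := fun A => by
      ext n x
      change (shiftBy 0 * A).toOp n x = _
      simp
    mul_one := fun A => by
      ext n x
      change (A * shiftBy 0).toOp n x = _
      simp
    neg_add_cancel := fun A => neg_add_cancel A
    zsmul := fun k A => k • A
    nsmul := fun k A => k • A }

theorem shiftBy_zero : (shiftBy 0 : LowerOp D R) = 1 := rfl

theorem toOp_pow (A : LowerOp D R) (m : ℕ) : (A ^ m).toOp = A.toOp.pow m := by
  induction m with
  | zero => rw [pow_zero]; rfl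
  | succ m ih => rw [pow_succ, toOp_mul, ih]; rfl

theorem shiftBy_mul_shiftBy (m n : ℤ) :
    (shiftBy m * shiftBy n : LowerOp D R) = shiftBy (m + n) := by
  ext k x
  rw [mul_shiftBy_apply]
  simp only [toOp_shiftBy, DiffOp.shiftOp]
  congr 1
  exact propext ⟨fun h => by omega, fun h => by omega⟩

theorem shiftBy_one_pow (m : ℕ) : (shiftBy 1 : LowerOp D R) ^ m = shiftBy m := by
  induction m with
  | zero => rfl
  | succ m ih => rw [pow_succ, ih, shiftBy_mul_shiftBy]; push_cast; rfl

/-- The operator of multiplication by a function. -/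
def fn (f : D.Pt → R) : LowerOp D R :=
  of (fun n x => if n = 0 then f x else 0) (N := 0) fun n hn _ => if_neg (by omega)

theorem fn_apply (f : D.Pt → R) (n : ℤ) (x : D.Pt) :
    (fn f).toOp n x = if n = 0 then f x else 0 := rfl

@[simp]
theorem fn_mul_apply (f : D.Pt → R) (A : LowerOp D R) (n : ℤ) (x : D.Pt) :
    (fn f * A).toOp n x = f x * A.toOp n x := by
  change ∑ᶠ i : ℤ, _ = _
  rw [finsum_eq_single _ 0]
  · simp [fn_apply]
  · intro i hi
    simp [fn_apply, hi]

@[simp]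
theorem mul_fn_apply (A : LowerOp D R) (f : D.Pt → R) (n : ℤ) (x : D.Pt) :
    (A * fn f).toOp n x = A.toOp n x * f (D.shift n x) := by
  change ∑ᶠ i : ℤ, _ = _
  rw [finsum_eq_single _ n]
  · simp [fn_apply]
  · intro i hi
    rw [fn_apply, if_neg (by omega), mul_zero]

theorem fn_mul_fn (f g : D.Pt → R) : fn f * fn g = (fn (f * g) : LowerOp D R) := by
  ext n x
  rw [fn_mul_apply]
  simp [fn_apply]

theorem fn_one : (fn 1 : LowerOp D R) = 1 := rfl

theorem adjoint_fn (f : D.Pt → R) : (fn f).toOp.adjoint = (fn f).toOp := by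
  funext n x
  simp only [DiffOp.adjoint, fn_apply, neg_eq_zero]
  split_ifs with h
  · simp [h]
  · rfl

section Map

variable {S : Type} [CommRing S]

/-- An additive homomorphism acts on the coefficients of the operators. -/
def map (g : R →+ S) : LowerOp D R →+ LowerOp D S where
  toFun A := of (fun n x => g (A.toOp n x)) (N := A.exists_orderLE.choose)
    fun n hn x => (congrArg g (A.exists_orderLE.choose_spec n hn x)).trans (map_zero g)
  map_zero' := by ext; exact map_zero g
  map_add' A B := by ext; exact map_add g _ _

@[simp]
theorem map_apply (g : R →+ S) (A : LowerOp D R) (n : ℤ) (x : D.Pt) :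
    (map g A).toOp n x = g (A.toOp n x) := rfl

theorem orderLE_map {g : R →+ S} {A : LowerOp D R} {N : ℤ} (h : A.toOp.OrderLE N) :
    (map g A).toOp.OrderLE N := fun n hn x => by rw [map_apply, h n hn, map_zero]

/-- A ring homomorphism acts on the coefficients of the operators. -/
def mapHom (g : R →+* S) : LowerOp D R →+* LowerOp D S :=
  { map g.toAddMonoidHom with
    map_one' := by
      ext n x
      change g (DiffOp.shiftOp 0 n x) = DiffOp.shiftOp 0 n x
      simp only [DiffOp.shiftOp]
      split_ifs <;> simp
    map_mul' := fun A B => by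
      obtain ⟨a, ha⟩ := A.exists_orderLE
      obtain ⟨b, hb⟩ := B.exists_orderLE
      ext n x
      change g ((A * B).toOp n x) =
        (map g.toAddMonoidHom A * map g.toAddMonoidHom B).toOp n x
      rw [mul_apply _ _ ha hb n x le_rfl le_rfl,
        mul_apply _ _ (orderLE_map ha) (orderLE_map hb) n x le_rfl le_rfl, map_sum]
      exact sum_congr rfl fun i _ => map_mul g _ _ }

@[simp]
theorem mapHom_apply (g : R →+* S) (A : LowerOp D R) (n : ℤ) (x : D.Pt) :
    (mapHom g A).toOp n x = g (A.toOp n x) := rfl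

@[simp]
theorem mapHom_shiftBy (g : R →+* S) (m : ℤ) :
    mapHom g (shiftBy m : LowerOp D R) = shiftBy m := by
  ext n x
  simp only [mapHom_apply, toOp_shiftBy, DiffOp.shiftOp]
  split_ifs <;> simp

/-- A derivation acts on the coefficients of the operators. -/
def der (d : Derivation ℤ R R) : LowerOp D R →+ LowerOp D R := map d.toLinearMap.toAddMonoidHom

@[simp]
theorem der_apply (d : Derivation ℤ R R) (A : LowerOp D R) (n : ℤ) (x : D.Pt) :
    (der d A).toOp n x = d (A.toOp n x) := rfl

theorem orderLE_der {d : Derivation ℤ R R} {A : LowerOp D R} {N : ℤ} (h : A.toOp.OrderLE N) :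
    (der d A).toOp.OrderLE N := orderLE_map h

theorem der_mul (d : Derivation ℤ R R) (A B : LowerOp D R) :
    der d (A * B) = der d A * B + A * der d B := by
  obtain ⟨a, ha⟩ := A.exists_orderLE
  obtain ⟨b, hb⟩ := B.exists_orderLE
  ext n x
  rw [toOp_add, Pi.add_apply, Pi.add_apply, der_apply, mul_apply _ _ ha hb n x le_rfl le_rfl,
    mul_apply _ _ (orderLE_der ha) hb n x le_rfl le_rfl,
    mul_apply _ _ ha (orderLE_der hb) n x le_rfl le_rfl, map_sum, ← sum_add_distrib]
  refine sum_congr rfl fun i _ => ?_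
  change d (_ * _) = d _ * _ + _ * d _
  rw [Derivation.leibniz, smul_eq_mul, smul_eq_mul]
  ring

@[simp]
theorem der_shiftBy (d : Derivation ℤ R R) (m : ℤ) : der d (shiftBy m : LowerOp D R) = 0 := by
  ext n x
  simp only [der_apply, toOp_shiftBy, DiffOp.shiftOp]
  split_ifs <;> simp

end Map

/-- Operators with invertible leading coefficient are right-regular. -/
theorem eq_zero_of_mul_eq_zero {q v : LowerOp D R} (hv : v.toOp.OrderLE 0)
    (hv0 : ∀ x, IsUnit (v.toOp 0 x)) (h : q * v = 0) : q = 0 := by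
  obtain ⟨N, hN⟩ := q.exists_orderLE
  suffices H : ∀ k : ℕ, ∀ x, q.toOp (N - k) x = 0 by
    ext n x
    rcases lt_or_ge N n with hn | hn
    · exact hN n hn x
    · have := H (N - n).toNat x
      rwa [Int.toNat_of_nonneg (by omega), sub_sub_cancel] at this
  intro k
  induction k using Nat.strong_induction_on with
  | _ k ih =>
    intro x
    have h1 : (q * v).toOp (N - k) x = 0 := by rw [h]; rfl
    rw [mul_apply q v hN hv (N - k) x (l := N - k) (by omega) le_rfl,
      sum_eq_single (N - (k : ℤ))] at h1
    · rw [sub_self] at h1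
      exact (hv0 _).mul_left_eq_zero.1 h1
    · intro i hi hik
      rw [mem_Icc] at hi
      have := ih (N - i).toNat (by omega) x
      rw [Int.toNat_of_nonneg (by omega), sub_sub_cancel] at this
      rw [this, zero_mul]
    · intro hk
      exact absurd (mem_Icc.2 ⟨le_rfl, by omega⟩) hk

/-- One has (vw − 1)v = v(wv) − v = 0, and v can be cancelled on the right. -/
theorem mul_eq_one_symm {w v : LowerOp D R} (hv : v.toOp.OrderLE 0)
    (hv0 : ∀ x, IsUnit (v.toOp 0 x)) (h : w * v = 1) : v * w = 1 := by
  rw [← sub_eq_zero]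
  apply eq_zero_of_mul_eq_zero hv hv0
  rw [sub_mul, mul_assoc, h, mul_one, one_mul, sub_self]

end LowerOp

end LowerOperators

end CToda

end

noncomputable section

namespace CToda

open PowerSeries Finset

/-! ### Miwa shifts of operators and the geometric series in zΛ. -/

section SumOfShifts

variable {S : Type*} [Ring S]

/-- The series `∑_j z^j f_j(z)`. -/
def shiftedSum (f : ℕ → S⟦X⟧) : S⟦X⟧ :=
  PowerSeries.mk fun k => ∑ p ∈ antidiagonal k, coeff p.1 (f p.2)

theorem coeff_shiftedSum (f : ℕ → S⟦X⟧) (k : ℕ) :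
    coeff k (shiftedSum f) = ∑ p ∈ antidiagonal k, coeff p.1 (f p.2) := by
  simp [shiftedSum]

theorem shiftedSum_sub (f g : ℕ → S⟦X⟧) :
    shiftedSum (fun j => f j - g j) = shiftedSum f - shiftedSum g := by
  ext k
  simp [coeff_shiftedSum]

theorem shiftedSum_mul_right (f : ℕ → S⟦X⟧) (g : S⟦X⟧) :
    shiftedSum (fun j => f j * g) = shiftedSum f * g := by
  ext k
  simp only [coeff_shiftedSum, coeff_mul, sum_mul, sum_sigma']
  refine sum_nbij' (fun s => ⟨(s.2.1 + s.1.2, s.2.2), (s.2.1, s.1.2)⟩)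
    (fun s => ⟨(s.2.1 + s.1.2, s.2.2), (s.2.1, s.1.2)⟩) ?_ ?_ ?_ ?_ ?_
  · rintro ⟨⟨a, b⟩, ⟨c, d⟩⟩ h
    simp only [mem_sigma, HasAntidiagonal.mem_antidiagonal] at h ⊢
    refine ⟨by omega, by simp⟩
  · rintro ⟨⟨a, b⟩, ⟨c, d⟩⟩ h
    simp only [mem_sigma, HasAntidiagonal.mem_antidiagonal] at h ⊢
    refine ⟨by omega, by simp⟩
  · rintro ⟨⟨a, b⟩, ⟨c, d⟩⟩ h
    simp only [mem_sigma, HasAntidiagonal.mem_antidiagonal] at h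
    obtain ⟨h1, rfl⟩ := h
    rfl
  · rintro ⟨⟨a, b⟩, ⟨c, d⟩⟩ h
    simp only [mem_sigma, HasAntidiagonal.mem_antidiagonal] at h
    obtain ⟨h1, rfl⟩ := h
    rfl
  · rintro ⟨⟨a, b⟩, ⟨c, d⟩⟩ h
    rfl

theorem shiftedSum_mul_left (f : ℕ → S⟦X⟧) (g : S⟦X⟧) :
    shiftedSum (fun j => g * f j) = g * shiftedSum f := by
  ext k
  simp only [coeff_shiftedSum, coeff_mul, mul_sum, sum_sigma']
  refine sum_nbij' (fun s => ⟨(s.2.1, s.2.2 + s.1.2), (s.2.2, s.1.2)⟩)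
    (fun s => ⟨(s.1.1 + s.2.1, s.2.2), (s.1.1, s.2.1)⟩) ?_ ?_ ?_ ?_ ?_
  · rintro ⟨⟨a, b⟩, ⟨c, d⟩⟩ h
    simp only [mem_sigma, HasAntidiagonal.mem_antidiagonal] at h ⊢
    refine ⟨by omega, by simp⟩
  · rintro ⟨⟨a, b⟩, ⟨c, d⟩⟩ h
    simp only [mem_sigma, HasAntidiagonal.mem_antidiagonal] at h ⊢
    refine ⟨by omega, by simp⟩
  · rintro ⟨⟨a, b⟩, ⟨c, d⟩⟩ h
    simp only [mem_sigma, HasAntidiagonal.mem_antidiagonal] at h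
    obtain ⟨h1, rfl⟩ := h
    rfl
  · rintro ⟨⟨a, b⟩, ⟨c, d⟩⟩ h
    simp only [mem_sigma, HasAntidiagonal.mem_antidiagonal] at h
    obtain ⟨h1, rfl⟩ := h
    rfl
  · rintro ⟨⟨a, b⟩, ⟨c, d⟩⟩ h
    rfl

theorem shiftedSum_C (f : ℕ → S) : shiftedSum (fun j => C (f j)) = PowerSeries.mk f := by
  ext k
  rw [coeff_shiftedSum, coeff_mk, sum_eq_single (0, k)]
  · simp
  · rintro ⟨i, j⟩ h1 h2
    have h3 : i ≠ 0 := by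
      rintro rfl
      apply h2
      simpa using h1
    simp [coeff_C, h3]
  · simp

end SumOfShifts

section OperatorShift

variable {η : ℂ} {D : ShiftDomain η} {R : Type} [CommRing R]

/-- The adjoint as an additive homomorphism. -/
def adjointHom : DiffOp D R →+ DiffOp D R where
  toFun := DiffOp.adjoint
  map_zero' := rfl
  map_add' _ _ := rfl

theorem adjointHom_apply (A : DiffOp D R) : adjointHom A = A.adjoint := rfl

/-- A homomorphism `T : R → R⟦z⟧` acts on the coefficients of the operators. -/
def opShift (T : R →+* R⟦X⟧) : LowerOp D R →+* (LowerOp D R)⟦X⟧ where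
  toFun A := PowerSeries.mk fun k =>
    LowerOp.map ((coeff k).toAddMonoidHom.comp T.toAddMonoidHom) A
  map_one' := by
    ext k n x
    rw [coeff_mk, LowerOp.map_apply, coeff_one]
    change coeff k (T (DiffOp.shiftOp 0 n x)) = _
    split_ifs with hk
    · rw [LowerOp.toOp_one]
      simp only [DiffOp.shiftOp]
      split_ifs <;> simp [hk]
    · simp only [DiffOp.shiftOp]
      split_ifs <;> simp [hk, coeff_one]
  map_zero' := by ext; simp
  map_add' A B := by ext; simp
  map_mul' A B := by
    obtain ⟨a, ha⟩ := A.exists_orderLE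
    obtain ⟨b, hb⟩ := B.exists_orderLE
    ext k n x
    rw [coeff_mk, coeff_mul, LowerOp.toOp_sum, Finset.sum_apply, Finset.sum_apply,
      LowerOp.map_apply, LowerOp.mul_apply _ _ ha hb n x le_rfl le_rfl]
    simp only [coeff_mk]
    rw [sum_congr rfl fun p _ => LowerOp.mul_apply _ _ (LowerOp.orderLE_map ha)
      (LowerOp.orderLE_map hb) n x le_rfl le_rfl, sum_comm, map_sum]
    refine sum_congr rfl fun i _ => ?_
    change coeff k (T (_ * _)) = _
    rw [map_mul, coeff_mul]
    rfl

theorem coeff_opShift_apply (T : R →+* R⟦X⟧) (A : LowerOp D R) (k : ℕ) (n : ℤ) (x : D.Pt) :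
    (coeff k (opShift T A)).toOp n x = coeff k (T (A.toOp n x)) := by
  simp [opShift]

theorem orderLE_coeff_opShift (T : R →+* R⟦X⟧) {A : LowerOp D R} {N : ℤ} (h : A.toOp.OrderLE N)
    (k : ℕ) : (coeff k (opShift T A)).toOp.OrderLE N := fun n hn x => by
  rw [coeff_opShift_apply, h n hn, map_zero, map_zero]

theorem opShift_shiftBy (T : R →+* R⟦X⟧) (m : ℤ) :
    opShift T (LowerOp.shiftBy m : LowerOp D R) = C (LowerOp.shiftBy m) := by
  ext k n x
  rw [coeff_opShift_apply, LowerOp.toOp_shiftBy, coeff_C]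
  simp only [DiffOp.shiftOp]
  by_cases hk : k = 0 <;> by_cases hn : n = m <;>
    simp [hk, hn, coeff_one, LowerOp.toOp_shiftBy, DiffOp.shiftOp]

theorem adjoint_coeff_opShift (T : R →+* R⟦X⟧) {A : LowerOp D R}
    (hA : A.toOp.adjoint = -A.toOp) (k : ℕ) :
    (coeff k (opShift T A)).toOp.adjoint = -(coeff k (opShift T A)).toOp := by
  funext n x
  have h := congrFun (congrFun hA n) x
  simp only [DiffOp.adjoint, Pi.neg_apply, coeff_opShift_apply] at h ⊢
  rw [h, map_neg, map_neg]

variable {d : ℕ → Derivation ℤ R R} {T : R →+* R⟦X⟧}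

theorem euler_opShift (hT : IsMiwaShift d (-1) T) (A : LowerOp D R) :
    euler (opShift T A) = -shiftedSum fun j => opShift T (LowerOp.der (d j) A) := by
  ext k n x
  rw [coeff_euler, map_neg, LowerOp.toOp_nsmul, LowerOp.toOp_neg, coeff_shiftedSum,
    LowerOp.toOp_sum]
  simp only [Pi.smul_apply, Pi.neg_apply, Finset.sum_apply, coeff_opShift_apply,
    LowerOp.der_apply, hT.euler_eq, neg_smul, one_smul]

/-- The generating series `∑_{j ≥ 1} z^j e^{j η ∂_x}`. -/
def shiftSeries : (LowerOp D R)⟦X⟧ :=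
  PowerSeries.mk fun k => if k = 0 then 0 else LowerOp.shiftBy (k : ℤ)

/-- The geometric series `(1 - z e^{η ∂_x})⁻¹`. -/
def geomSeries : (LowerOp D R)⟦X⟧ := PowerSeries.mk fun k => LowerOp.shiftBy (k : ℤ)

theorem geomSeries_eq : (geomSeries : (LowerOp D R)⟦X⟧) = 1 + shiftSeries := by
  ext1 k
  simp only [geomSeries, shiftSeries, coeff_mk, map_add, coeff_one]
  split_ifs with h
  · rw [h, add_zero]; rfl
  · rw [zero_add]

theorem shiftSeries_eq : (shiftSeries : (LowerOp D R)⟦X⟧) =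
    X * C (LowerOp.shiftBy 1) * geomSeries := by
  ext1 k
  rw [mul_assoc]
  rcases k with _ | k
  · simp [shiftSeries]
  · rw [coeff_succ_X_mul, coeff_C_mul]
    simp only [shiftSeries, geomSeries, coeff_mk, LowerOp.shiftBy_mul_shiftBy]
    rw [if_neg k.succ_ne_zero]
    congr 1
    push_cast
    ring

theorem commute_geomSeries :
    X * C (LowerOp.shiftBy 1) * (geomSeries : (LowerOp D R)⟦X⟧) =
    geomSeries * (X * C (LowerOp.shiftBy 1)) := by
  rw [← mul_assoc geomSeries, ← X_mul (φ := geomSeries), mul_assoc, mul_assoc]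
  congr 1
  ext1 k
  rw [coeff_C_mul, coeff_mul_C]
  simp only [geomSeries, coeff_mk, LowerOp.shiftBy_mul_shiftBy]
  rw [add_comm]

theorem one_sub_mul_geomSeries :
    (1 - X * C (LowerOp.shiftBy 1)) * (geomSeries : (LowerOp D R)⟦X⟧) = 1 := by
  rw [sub_mul, one_mul, ← shiftSeries_eq, geomSeries_eq]
  abel

theorem geomSeries_mul_one_sub :
    (geomSeries : (LowerOp D R)⟦X⟧) * (1 - X * C (LowerOp.shiftBy 1)) = 1 := by
  rw [mul_sub, mul_one, ← commute_geomSeries, ← shiftSeries_eq, geomSeries_eq]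
  abel

theorem euler_X {S : Type*} [Semiring S] : euler (X : S⟦X⟧) = X := by
  ext1 k
  rw [coeff_euler, coeff_X]
  split_ifs with h
  · rw [h, one_smul]
  · rw [smul_zero]

/-- Differentiate (1 − zΛ)(1 − zΛ)⁻¹ = 1. The logarithmic derivative of (1 − zΛ)⁻¹ is the generating
series of the terms wΛ^j of the linear problems. -/
theorem euler_geomSeries :
    euler (geomSeries : (LowerOp D R)⟦X⟧) = geomSeries * shiftSeries := by
  have h4 := congrArg euler (one_sub_mul_geomSeries (D := D) (R := R))
  rw [euler_mul, euler_one, map_sub, euler_one, euler_mul, euler_X, euler_C, mul_zero, add_zero,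
    zero_sub, neg_mul, ← shiftSeries_eq] at h4
  have h5 := congrArg (geomSeries * ·) h4
  simp only [mul_add, mul_zero, ← mul_assoc, geomSeries_mul_one_sub, one_mul, mul_neg] at h5
  exact (neg_add_eq_zero.1 h5).symm

end OperatorShift

end CToda

end

noncomputable section

namespace CToda

open PowerSeries Finset

/-! ### Orthogonality of the evolution from t to t − [z]. -/

section Kernel

variable {η : ℂ} {D : ShiftDomain η} {R : Type} [CommRing R]

/-- A dressing operator `w` and its inverse `v` subject to the linear problems with antisymmetric
generators `A_j`. -/
structure IsSymmetricDressing (d : ℕ → Derivation ℤ R R) (w v : LowerOp D R)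
    (A : ℕ → LowerOp D R) : Prop where
  w_le : w.toOp.OrderLE 0
  v_le : v.toOp.OrderLE 0
  mul_v : w * v = 1
  v_mul : v * w = 1
  A_zero : A 0 = 0
  A_adjoint : ∀ j, (A j).toOp.adjoint = -(A j).toOp
  der_w : ∀ j, 0 < j → LowerOp.der (d j) w = A j * w - w * LowerOp.shiftBy (j : ℤ)

namespace IsSymmetricDressing

variable {d : ℕ → Derivation ℤ R R} {T : R →+* R⟦X⟧} {w v : LowerOp D R} {A : ℕ → LowerOp D R}

theorem der_v (h : IsSymmetricDressing d w v A) (j : ℕ) (hj : 0 < j) :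
    LowerOp.der (d j) v = LowerOp.shiftBy (j : ℤ) * v - v * A j := by
  have h1 := congrArg (LowerOp.der (d j)) h.v_mul
  rw [LowerOp.der_mul, h.der_w j hj, ← LowerOp.shiftBy_zero, LowerOp.der_shiftBy] at h1
  have h2 := congrArg (· * v) h1
  simp only [add_mul, mul_assoc, h.mul_v, mul_one, zero_mul, sub_mul, mul_sub] at h2
  rw [← mul_assoc v w, h.v_mul, one_mul] at h2
  rw [eq_sub_iff_add_eq, ← sub_eq_zero, ← h2]
  abel

theorem opShift_w_eq (hT : IsMiwaShift d (-1) T) (h : IsSymmetricDressing d w v A) :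
    euler (opShift T w) =
      -(shiftedSum (fun j => opShift T (A j)) * opShift T w) + opShift T w * shiftSeries := by
  rw [euler_opShift hT, ← shiftedSum_mul_right, shiftSeries, ← shiftedSum_C,
    ← shiftedSum_mul_left, neg_add_eq_sub, ← neg_sub, ← shiftedSum_sub]
  congr 2
  funext j
  rcases Nat.eq_zero_or_pos j with rfl | hj
  · have : LowerOp.der (d 0) w = 0 := by
      ext n x
      rw [LowerOp.der_apply, hT.D_zero]
      rfl
    rw [this, h.A_zero]
    simp
  · rw [h.der_w j hj, map_sub, map_mul, map_mul, opShift_shiftBy, if_neg hj.ne']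

theorem opShift_v_eq (hT : IsMiwaShift d (-1) T) (h : IsSymmetricDressing d w v A) :
    euler (opShift T v) =
      opShift T v * shiftedSum (fun j => opShift T (A j)) - shiftSeries * opShift T v := by
  rw [euler_opShift hT, ← shiftedSum_mul_left, shiftSeries, ← shiftedSum_C,
    ← shiftedSum_mul_right, ← neg_sub, ← shiftedSum_sub]
  congr 2
  funext j
  rcases Nat.eq_zero_or_pos j with rfl | hj
  · have : LowerOp.der (d 0) v = 0 := by
      ext n x
      rw [LowerOp.der_apply, hT.D_zero]
      rfl
    rw [this, h.A_zero]
    simp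
  · rw [h.der_v j hj, map_sub, map_mul, map_mul, opShift_shiftBy, if_neg hj.ne']

variable (T w v) in
/-- The evolution operator from `t` to `t - [z]`. -/
def evolution : (LowerOp D R)⟦X⟧ :=
  opShift T w * (1 - X * C (LowerOp.shiftBy 1)) * C v

variable (T w v) in
/-- The inverse of the evolution operator from `t` to `t - [z]`. -/
def evolutionInv : (LowerOp D R)⟦X⟧ := C w * (geomSeries * opShift T v)

/-- The factor 1 − zΛ equals exp(−∑ z^j Λ^j / j). Its derivative cancels the terms wΛ^j of the
linear problems, and only the generators at t − [z] remain. -/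
theorem euler_evolution (hT : IsMiwaShift d (-1) T) (h : IsSymmetricDressing d w v A) :
    euler (evolution T w v) =
      -(shiftedSum (fun j => opShift T (A j)) * evolution T w v) := by
  have h4 : (shiftSeries : (LowerOp D R)⟦X⟧) * (1 - X * C (LowerOp.shiftBy 1)) =
      X * C (LowerOp.shiftBy 1) := by
    rw [shiftSeries_eq, mul_assoc _ geomSeries, geomSeries_mul_one_sub, mul_one]
  rw [evolution, euler_mul, euler_C, mul_zero, add_zero, euler_mul, h.opShift_w_eq hT, map_sub,
    euler_one, euler_mul, euler_C, mul_zero, add_zero, euler_X, zero_sub, add_mul, add_mul,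
    mul_assoc (opShift T w) shiftSeries, h4]
  noncomm_ring

theorem euler_evolutionInv (hT : IsMiwaShift d (-1) T) (h : IsSymmetricDressing d w v A) :
    euler (evolutionInv T w v) =
      evolutionInv T w v * shiftedSum (fun j => opShift T (A j)) := by
  rw [evolutionInv, euler_mul, euler_C, zero_mul, zero_add, euler_mul, h.opShift_v_eq hT,
    euler_geomSeries]
  noncomm_ring

/-- For antisymmetric generators the adjoint of N solves the first-order equation in z that N⁻¹
solves, and both are 1 at z = 0. The comparison is made for each power of z in `DiffOp`, because the
adjoint of an operator bounded above is in general only bounded below. -/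
theorem adjoint_evolution [IsAddTorsionFree R] (hT : IsMiwaShift d (-1) T)
    (h : IsSymmetricDressing d w v A) (k : ℕ) :
    (coeff k (evolution T w v)).toOp.adjoint = (coeff k (evolutionInv T w v)).toOp := by
  have hT0 : ∀ B : LowerOp D R, coeff 0 (opShift T B) = B := by
    intro B
    ext n x
    rw [coeff_opShift_apply, hT.coeff_zero]
  induction k using Nat.strong_induction_on with
  | _ k ih =>
    rcases Nat.eq_zero_or_pos k with rfl | hk
    · have h1 : coeff 0 (evolution T w v) = 1 := by
        rw [evolution, coeff_mul_C, coeff_mul]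
        simp [hT0, h.mul_v]
      have h2 : coeff 0 (evolutionInv T w v) = 1 := by
        rw [evolutionInv, coeff_C_mul, coeff_mul]
        simp [hT0, geomSeries, LowerOp.shiftBy_zero, h.mul_v]
      rw [h1, h2, LowerOp.toOp_one, DiffOp.adjoint_shiftOp, neg_zero]
    · have h1 := congrArg (coeff k) (h.euler_evolution hT)
      have h2 := congrArg (coeff k) (h.euler_evolutionInv hT)
      rw [coeff_euler, map_neg, coeff_mul] at h1
      rw [coeff_euler, coeff_mul, ← Nat.sum_antidiagonal_swap] at h2
      have h3 : k • (coeff k (evolution T w v)).toOp.adjoint =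
          k • (coeff k (evolutionInv T w v)).toOp := by
        rw [← LowerOp.toOp_nsmul, h2]
        change k • adjointHom (LowerOp.toOp _) = _
        rw [← map_nsmul, ← LowerOp.toOp_nsmul, h1, LowerOp.toOp_neg, LowerOp.toOp_sum, map_neg,
          map_sum, LowerOp.toOp_sum, ← sum_neg_distrib]
        refine sum_congr rfl fun p hp => ?_
        rw [adjointHom_apply]
        have hp' := HasAntidiagonal.mem_antidiagonal.1 hp
        simp only [Prod.fst_swap, Prod.snd_swap]
        have h4 : (coeff p.1 (shiftedSum fun j => opShift T (A j))).toOp.adjoint =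
            -(coeff p.1 (shiftedSum fun j => opShift T (A j))).toOp := by
          rw [coeff_shiftedSum, LowerOp.toOp_sum]
          rw [← adjointHom_apply, map_sum, ← sum_neg_distrib]
          exact sum_congr rfl fun q _ => adjoint_coeff_opShift T (h.A_adjoint _) _
        rcases Nat.eq_zero_or_pos p.1 with hp1 | hp1
        · have h5 : coeff 0 (shiftedSum fun j => opShift T (A j)) = 0 := by
            rw [coeff_shiftedSum]
            simp [h.A_zero]
          rw [hp1, h5, zero_mul, mul_zero]
          exact neg_zero
        · rw [LowerOp.toOp_mul, DiffOp.adjoint_comp, h4, ih p.2 (by omega), ← LowerOp.toOp_neg,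
            ← LowerOp.toOp_mul, mul_neg, LowerOp.toOp_neg, neg_neg]
      funext n x
      have h4 := congrFun (congrFun h3 n) x
      exact nsmul_right_injective hk.ne' h4

end IsSymmetricDressing

end Kernel

end CToda

end

noncomputable section

namespace CToda

open PowerSeries Finset

/-! ### Coefficients of the inverse evolution in terms of wave amplitudes. -/

section WaveAmplitudes

variable {η : ℂ} {D : ShiftDomain η} {R : Type} [CommRing R]

/-- The amplitude `∑_s w_{-s}(x) z^s` of the wave function. -/
def amplitude (w : LowerOp D R) (x : D.Pt) : R⟦X⟧ :=
  PowerSeries.mk fun s => w.toOp (-(s : ℤ)) x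

/-- The amplitude `∑_s v_{-s}(x + s η) z^s` of the adjoint wave function. -/
def adjointAmplitude (v : LowerOp D R) (x : D.Pt) : R⟦X⟧ :=
  PowerSeries.mk fun s => v.toOp (-(s : ℤ)) (D.shift s x)

theorem orderLE_geomSeries_mul_opShift (T : R →+* R⟦X⟧) {v : LowerOp D R}
    (hv : v.toOp.OrderLE 0) (k : ℕ) :
    (coeff k (geomSeries * opShift T v)).toOp.OrderLE k := by
  intro n hn x
  rw [coeff_mul, LowerOp.toOp_sum, Finset.sum_apply, Finset.sum_apply]
  refine sum_eq_zero fun p hp => ?_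
  have hp' := HasAntidiagonal.mem_antidiagonal.1 hp
  simp only [geomSeries, coeff_mk]
  rw [LowerOp.shiftBy_mul_apply, coeff_opShift_apply, hv _ (by omega), map_zero, map_zero]

/-- The coefficients of `(1 - z e^{η ∂_x})⁻¹ v(t - [z])`. -/
theorem geomSeries_mul_opShift_apply (T : R →+* R⟦X⟧) {v : LowerOp D R} (hv : v.toOp.OrderLE 0)
    (k m : ℕ) (x : D.Pt) : (coeff k (geomSeries * opShift T v)).toOp m x =
      coeff k (X ^ m * zExtend T (adjointAmplitude v (D.shift m x))) := by
  rw [coeff_mul, LowerOp.toOp_sum, Finset.sum_apply, Finset.sum_apply, coeff_X_pow_mul']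
  have h1 : ∀ p ∈ antidiagonal k,
      (coeff p.1 geomSeries * coeff p.2 (opShift T v)).toOp m x =
        coeff p.2 (T (v.toOp ((m : ℤ) - p.1) (D.shift p.1 x))) := by
    intro p _
    simp only [geomSeries, coeff_mk]
    rw [LowerOp.shiftBy_mul_apply, coeff_opShift_apply]
  rw [sum_congr rfl h1]
  split_ifs with hm
  · rw [coeff_zExtend]
    simp only [adjointAmplitude, coeff_mk, D.shift_shift]
    symm
    -- Only the powers Λ^{p.1} with p.1 ≥ m contribute at Λ^m, since v has order at most 0.
    refine sum_of_injOn (fun q => (m + q.2, q.1)) ?_ ?_ ?_ ?_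
    · rintro ⟨a, b⟩ _ ⟨c, e⟩ _ hq
      simp only [Prod.mk.injEq] at hq ⊢
      omega
    · rintro ⟨a, b⟩ hq
      simp only [mem_coe, HasAntidiagonal.mem_antidiagonal] at hq ⊢
      omega
    · rintro ⟨a, b⟩ hq hq'
      rw [HasAntidiagonal.mem_antidiagonal] at hq
      rw [hv _ ?_, map_zero, map_zero]
      by_contra hlt
      apply hq'
      refine ⟨(b, a - m), ?_, ?_⟩
      · simp only [mem_coe, HasAntidiagonal.mem_antidiagonal]
        simp only at hq hlt
        omega
      · simp only [Prod.mk.injEq, and_true]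
        simp only at hlt
        omega
    · rintro ⟨a, b⟩ _
      simp only
      congr 3
      · push_cast; omega
      · congr 1; push_cast; omega
  · refine sum_eq_zero fun p hp => ?_
    have hp' := HasAntidiagonal.mem_antidiagonal.1 hp
    rw [hv _ (by omega), map_zero, map_zero]

/-- The coefficient at `e^{-η ∂_x}` of `(1 - z e^{η ∂_x})⁻¹ v(t - [z])`. -/
theorem geomSeries_mul_opShift_apply_neg_one (T : R →+* R⟦X⟧) {v : LowerOp D R}
    (hv : v.toOp.OrderLE 0) (k : ℕ) (x : D.Pt) :
    (coeff k (geomSeries * opShift T v)).toOp (-1) x =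
      coeff (k + 1) (zExtend T (adjointAmplitude v (D.shift (-1) x))) -
        coeff (k + 1) (T (v.toOp 0 (D.shift (-1) x))) := by
  have h1 := geomSeries_mul_opShift_apply T hv (k + 1) 0 (D.shift (-1) x)
  -- For G = (1 − zΛ)⁻¹ v(t−[z]) one has G = v(t−[z]) + zΛG. This trades the coefficient at Λ⁻¹ for
  -- the one at Λ^0, with one more power of z and at the point x − η.
  have h2 : (geomSeries : (LowerOp D R)⟦X⟧) * opShift T v =
      opShift T v + X * (C (LowerOp.shiftBy 1) * (geomSeries * opShift T v)) := by
    conv_lhs => rw [geomSeries_eq, add_mul, one_mul, shiftSeries_eq]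
    simp only [mul_assoc]
  rw [pow_zero, one_mul, Nat.cast_zero, D.shift_zero] at h1
  rw [← h1]
  conv_rhs => rw [h2]
  rw [map_add, coeff_succ_X_mul, coeff_C_mul, LowerOp.toOp_add, Pi.add_apply, Pi.add_apply,
    LowerOp.shiftBy_mul_apply, coeff_opShift_apply, add_sub_cancel_left, D.shift_shift]
  simp

/-- The nonnegative part of the inverse evolution operator factorizes. -/
theorem evolutionInv_apply (T : R →+* R⟦X⟧) {w v : LowerOp D R} (hw : w.toOp.OrderLE 0)
    (hv : v.toOp.OrderLE 0) (k m : ℕ) (x : D.Pt) :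
    (coeff k (IsSymmetricDressing.evolutionInv T w v)).toOp m x =
      coeff k (X ^ m * (amplitude w x * zExtend T (adjointAmplitude v (D.shift m x)))) := by
  rw [IsSymmetricDressing.evolutionInv, coeff_C_mul, LowerOp.mul_apply _ _ hw
    (orderLE_geomSeries_mul_opShift T hv k) m x (l := -k) (by omega) le_rfl, mul_left_comm,
    coeff_mul k (amplitude w x)]
  symm
  refine sum_nbij' (fun p => -(p.1 : ℤ)) (fun i => ((-i).toNat, k - (-i).toNat)) ?_ ?_ ?_ ?_ ?_
  · intro p hp
    have := HasAntidiagonal.mem_antidiagonal.1 hp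
    rw [mem_Icc]
    omega
  · intro i hi
    rw [mem_Icc] at hi
    rw [HasAntidiagonal.mem_antidiagonal]
    simp only
    omega
  · rintro ⟨a, b⟩ hp
    have := HasAntidiagonal.mem_antidiagonal.1 hp
    simp only [Prod.mk.injEq] at this ⊢
    omega
  · intro i hi
    rw [mem_Icc] at hi
    simp only
    omega
  · rintro ⟨a, b⟩ hp
    have hab := HasAntidiagonal.mem_antidiagonal.1 hp
    simp only at hab ⊢
    have h1 : (m : ℤ) - -(a : ℤ) = ((m + a : ℕ) : ℤ) := by push_cast; omega
    rw [h1, geomSeries_mul_opShift_apply T hv, D.shift_shift, pow_add, ← hab, mul_right_comm,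
      add_comm a b, coeff_mul_X_pow]
    simp only [amplitude, coeff_mk]
    congr 6
    push_cast
    omega

/-- The factorization valid for m ≥ 0, continued to m = −1, would involve a term Λ⁻¹ of the
geometric series. That term is absent, whence the subtracted product of leading coefficients; the
index k + 1 stands for the factor z⁻¹. -/
theorem evolutionInv_apply_neg_one (T : R →+* R⟦X⟧) {w v : LowerOp D R} (hw : w.toOp.OrderLE 0)
    (hv : v.toOp.OrderLE 0) (k : ℕ) (x : D.Pt) :
    (coeff k (IsSymmetricDressing.evolutionInv T w v)).toOp (-1) x =
      coeff (k + 1) (amplitude w x * zExtend T (adjointAmplitude v (D.shift (-1) x)) -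
        C (w.toOp 0 x) * T (v.toOp 0 (D.shift (-1) x))) := by
  rw [IsSymmetricDressing.evolutionInv, coeff_C_mul, LowerOp.mul_apply _ _ hw
    (orderLE_geomSeries_mul_opShift T hv k) (-1) x (l := -(k + 1)) (by omega) le_rfl, map_sub,
    coeff_mul (k + 1) (amplitude w x), coeff_C_mul]
  have h0 : Icc (-((k : ℤ) + 1)) 0 = insert 0 (Icc (-((k : ℤ) + 1)) (-1)) := by
    ext i
    simp only [mem_Icc, mem_insert]
    omega
  rw [h0, sum_insert (by simp), sub_zero, D.shift_zero,
    geomSeries_mul_opShift_apply_neg_one T hv, Nat.sum_antidiagonal_succ]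
  have h1 : ∑ i ∈ Icc (-((k : ℤ) + 1)) (-1), w.toOp i x *
      (coeff k (geomSeries * opShift T v)).toOp (-1 - i) (D.shift i x) =
      ∑ p ∈ antidiagonal k, coeff (p.1 + 1) (amplitude w x) *
        coeff p.2 (zExtend T (adjointAmplitude v (D.shift (-1) x))) := by
    symm
    refine sum_nbij' (fun p => -((p.1 : ℤ) + 1))
      (fun i => ((-i - 1).toNat, k - (-i - 1).toNat)) ?_ ?_ ?_ ?_ ?_
    · intro p hp
      have := HasAntidiagonal.mem_antidiagonal.1 hp
      rw [mem_Icc]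
      omega
    · intro i hi
      rw [mem_Icc] at hi
      rw [HasAntidiagonal.mem_antidiagonal]
      simp only
      omega
    · rintro ⟨a, b⟩ hp
      have := HasAntidiagonal.mem_antidiagonal.1 hp
      simp only [Prod.mk.injEq] at this ⊢
      omega
    · intro i hi
      rw [mem_Icc] at hi
      simp only
      omega
    · rintro ⟨a, b⟩ hp
      have hab := HasAntidiagonal.mem_antidiagonal.1 hp
      simp only at hab ⊢
      have h1 : (-1 : ℤ) - -((a : ℤ) + 1) = (a : ℤ) := by omega
      rw [h1, geomSeries_mul_opShift_apply T hv, D.shift_shift, ← hab, add_comm a b,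
        coeff_X_pow_mul]
      simp only [amplitude, coeff_mk]
      congr 5
      omega
  rw [h1]
  simp only [amplitude, coeff_mk, Nat.cast_zero, neg_zero]
  ring

end WaveAmplitudes

end CToda

end

noncomputable section

namespace CToda

open PowerSeries Finset

/-! ### The bilinear identity for one Miwa shift. -/

section BilinearIdentity

variable {η : ℂ} {D : ShiftDomain η} {R : Type} [CommRing R]

theorem evolution_eq (T : R →+* R⟦X⟧) (w v : LowerOp D R) :
    IsSymmetricDressing.evolution T w v =
      opShift T w * C v - X * (opShift T w * C (LowerOp.shiftBy 1 * v)) := by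
  rw [IsSymmetricDressing.evolution, mul_sub, sub_mul, mul_one, map_mul, X_mul, X_mul]
  simp only [mul_assoc, X_mul]

theorem orderLE_opShift_shiftBy_mul (T : R →+* R⟦X⟧) {w v : LowerOp D R}
    (hw : w.toOp.OrderLE 0) (hv : v.toOp.OrderLE 0) (k : ℕ) :
    (coeff k (opShift T w) * (LowerOp.shiftBy 1 * v)).toOp.OrderLE 1 := by
  have h1 : (LowerOp.shiftBy 1 * v).toOp.OrderLE 1 := by
    intro n hn x
    rw [LowerOp.shiftBy_mul_apply, hv _ (by omega)]
  exact (orderLE_coeff_opShift T hw k).comp h1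

theorem orderLE_evolution (T : R →+* R⟦X⟧) {w v : LowerOp D R}
    (hw : w.toOp.OrderLE 0) (hv : v.toOp.OrderLE 0) (k : ℕ) :
    (coeff k (IsSymmetricDressing.evolution T w v)).toOp.OrderLE 1 := by
  intro n hn x
  have h0 : (coeff k (opShift T w) * v).toOp.OrderLE 0 :=
    (orderLE_coeff_opShift T hw k).comp hv
  rw [evolution_eq, map_sub, coeff_mul_C, LowerOp.toOp_sub, Pi.sub_apply, Pi.sub_apply,
    h0 n (by omega), zero_sub, neg_eq_zero]
  rcases k with _ | k
  · rw [coeff_zero_X_mul]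
    rfl
  · rw [coeff_succ_X_mul, coeff_mul_C, orderLE_opShift_shiftBy_mul T hw hv k n hn]

/-- Only −z w(t−[z]) Λ v reaches order 1, and there the leading coefficients multiply. -/
theorem evolution_apply_one (T : R →+* R⟦X⟧) {w v : LowerOp D R}
    (hw : w.toOp.OrderLE 0) (hv : v.toOp.OrderLE 0) (k : ℕ) (x : D.Pt) :
    (coeff k (IsSymmetricDressing.evolution T w v)).toOp 1 x =
      coeff k (-(X * (T (w.toOp 0 x) * C (v.toOp 0 (D.shift 1 x))))) := by
  have h0 : (coeff k (opShift T w) * v).toOp.OrderLE 0 :=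
    (orderLE_coeff_opShift T hw k).comp hv
  rw [evolution_eq, map_sub, coeff_mul_C, LowerOp.toOp_sub, Pi.sub_apply, Pi.sub_apply,
    h0 1 (by omega), zero_sub, map_neg, neg_inj]
  rcases k with _ | k
  · rw [coeff_zero_X_mul, coeff_zero_X_mul]
    rfl
  · have h1 : (LowerOp.shiftBy 1 * v).toOp.OrderLE 1 := by
      intro n hn x
      rw [LowerOp.shiftBy_mul_apply, hv _ (by omega)]
    rw [coeff_succ_X_mul, coeff_succ_X_mul, coeff_mul_C, coeff_mul_C,
      LowerOp.mul_apply _ _ (orderLE_coeff_opShift T hw k) h1 1 x (l := 0) (by omega) le_rfl]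
    simp [coeff_opShift_apply]

/-- The series `∑_{m ≥ 0} (z y)^m β(x - m η; z) β(x - m η; y)` for the amplitude `β`. -/
def kernelSeries (w : LowerOp D R) (x : D.Pt) : R⟦X⟧⟦X⟧ :=
  PowerSeries.mk fun s => ∑ p ∈ antidiagonal s,
    X ^ p.1 * amplitude w (D.shift (-(p.1 : ℤ)) x) *
      C (w.toOp (-(p.2 : ℤ)) (D.shift (-(p.1 : ℤ)) x))

theorem kernelSeries_eq (w : LowerOp D R) (x : D.Pt) :
    kernelSeries w x = C (amplitude w x) * map C (amplitude w x) +
      X * C X * kernelSeries w (D.shift (-1) x) := by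
  ext1 s
  rw [map_add, mul_assoc, coeff_C_mul, coeff_map, kernelSeries, coeff_mk]
  rcases s with _ | s
  · simp [amplitude]
  · rw [coeff_succ_X_mul, coeff_C_mul, kernelSeries, coeff_mk, Nat.sum_antidiagonal_succ, mul_sum]
    congr 1
    · simp [amplitude]
    · refine sum_congr rfl fun p _ => ?_
      rw [D.shift_shift, pow_succ']
      have h1 : (-((p.1 + 1 : ℕ) : ℤ)) = -(p.1 : ℤ) + -1 := by push_cast; omega
      rw [h1]
      simp only [mul_assoc]

namespace IsSymmetricDressing

variable [IsAddTorsionFree R] {d : ℕ → Derivation ℤ R R} {T : R →+* R⟦X⟧} {w v : LowerOp D R}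
  {A : ℕ → LowerOp D R}

theorem evolution_apply (hT : IsMiwaShift d (-1) T) (h : IsSymmetricDressing d w v A) (k : ℕ)
    (n : ℤ) (x : D.Pt) :
    (coeff k (evolution T w v)).toOp n x =
      (coeff k (evolutionInv T w v)).toOp (-n) (D.shift n x) := by
  have h1 := congrFun (congrFun (h.adjoint_evolution hT k) (-n)) (D.shift n x)
  rw [← h1]
  simp [DiffOp.adjoint]

/-- The bilinear identity for a Miwa shift, at `e^{η ∂_x}`. -/
theorem adjointAmplitude_mul_amplitude (hT : IsMiwaShift d (-1) T)
    (h : IsSymmetricDressing d w v A) (x : D.Pt) :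
    zExtend T (adjointAmplitude v x) * amplitude w (D.shift 1 x) =
      C (w.toOp 0 (D.shift 1 x)) * T (v.toOp 0 x) -
        X ^ 2 * (T (w.toOp 0 x) * C (v.toOp 0 (D.shift 1 x))) := by
  ext k
  rcases k with _ | k
  · rw [coeff_mul, map_sub, coeff_C_mul, hT.coeff_zero, coeff_X_pow_mul']
    simp only [Nat.antidiagonal_zero, sum_singleton, coeff_zExtend, hT.coeff_zero]
    simp [adjointAmplitude, amplitude, mul_comm]
  · have h1 := h.evolution_apply hT k 1 x
    rw [evolution_apply_one T h.w_le h.v_le, evolutionInv_apply_neg_one T h.w_le h.v_le,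
      D.shift_shift, neg_add_cancel, D.shift_zero, map_sub] at h1
    rw [map_sub, pow_two, mul_assoc, coeff_succ_X_mul, mul_comm]
    rw [map_neg] at h1
    linear_combination -h1

/-- The bilinear identity for a Miwa shift, acting on the wave function. -/
theorem map_amplitude_eq (hT : IsMiwaShift d (-1) T) (h : IsSymmetricDressing d w v A)
    (x : D.Pt) :
    (X - C X) * map T (amplitude w x) =
      X * C (zExtend T (adjointAmplitude v x)) * kernelSeries w x -
        C X * C (T (w.toOp 0 x) * C (v.toOp 0 (D.shift 1 x))) *
          map C (amplitude w (D.shift 1 x)) := by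
  -- N transports the dressing operator: N w = w(t−[z]) (1 − zΛ).
  have hN : evolution T w v * C w = opShift T w - X * (opShift T w * C (LowerOp.shiftBy 1)) := by
    rw [evolution_eq, sub_mul, mul_assoc, ← map_mul, h.v_mul, map_one, mul_one, mul_assoc X,
      mul_assoc (opShift T w), ← map_mul, mul_assoc _ v, h.v_mul, mul_one]
  ext t k
  -- The power y^t records Λ^{1−t}. With this normalization Λ on the right acts as y⁻¹, and y (1 − z
  -- y⁻¹) = y − z.
  have h1 : (coeff k (evolution T w v * C w)).toOp (1 - t) x =
      coeff k (coeff t ((X - C X) * map T (amplitude w x))) := by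
    have h2 : (coeff k (opShift T w)).toOp (1 - t) x =
        coeff k (coeff t (X * map T (amplitude w x))) := by
      rw [coeff_opShift_apply]
      rcases t with _ | t
      · rw [coeff_zero_X_mul, h.w_le _ (by simp)]
        simp
      · rw [coeff_succ_X_mul, coeff_map, amplitude, coeff_mk]
        congr 4
        push_cast
        omega
    rw [hN, map_sub, LowerOp.toOp_sub, Pi.sub_apply, Pi.sub_apply, h2, sub_mul, map_sub, map_sub,
      coeff_C_mul]
    congr 1
    rcases k with _ | k
    · rw [coeff_zero_X_mul, coeff_zero_X_mul]
      rfl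
    · rw [coeff_succ_X_mul, coeff_mul_C, LowerOp.mul_shiftBy_apply, coeff_opShift_apply,
        coeff_succ_X_mul, coeff_map, amplitude, coeff_mk]
      congr 4
      omega
  rw [← h1, coeff_mul_C, LowerOp.mul_apply _ _ (orderLE_evolution T h.w_le h.v_le k) h.w_le
    (1 - t) x (l := 1 - t) (by omega) le_rfl]
  -- The coefficient of N at Λ gives the last term of the identity. Those at nonpositive powers are,
  -- by orthogonality, the factorized nonnegative coefficients of N⁻¹, and they sum to the kernel K.
  have h0 : Icc (1 - (t : ℤ)) 1 = insert 1 (Icc (1 - (t : ℤ)) 0) := by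
    ext i
    simp only [mem_Icc, mem_insert]
    omega
  rw [h0, sum_insert (by simp), evolution_apply_one T h.w_le h.v_le, map_sub, map_sub,
    sub_eq_neg_add (coeff k (coeff t (X * C _ * kernelSeries w x)))]
  congr 1
  · rw [mul_assoc, coeff_C_mul, coeff_C_mul, coeff_map, map_neg, neg_mul, neg_inj, amplitude, coeff_mk,
      ← mul_assoc X (T _ * C _) (C _), coeff_mul_C]
    congr 2
    omega
  · rw [mul_assoc]
    rcases t with _ | t
    · simp
    · rw [coeff_succ_X_mul, coeff_C_mul, kernelSeries, coeff_mk, mul_sum, map_sum]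
      symm
      refine sum_nbij' (fun p => -(p.1 : ℤ)) (fun i => ((-i).toNat, t - (-i).toNat))
        ?_ ?_ ?_ ?_ ?_
      · intro p hp
        have := HasAntidiagonal.mem_antidiagonal.1 hp
        rw [mem_Icc]
        omega
      · intro i hi
        rw [mem_Icc] at hi
        rw [HasAntidiagonal.mem_antidiagonal]
        simp only
        omega
      · rintro ⟨a, b⟩ hp
        have := HasAntidiagonal.mem_antidiagonal.1 hp
        simp only [Prod.mk.injEq] at this ⊢
        omega
      · intro i hi
        rw [mem_Icc] at hi
        simp only
        omega
      · rintro ⟨a, b⟩ hp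
        have hab := HasAntidiagonal.mem_antidiagonal.1 hp
        simp only at hab ⊢
        rw [h.evolution_apply hT, neg_neg, evolutionInv_apply T h.w_le h.v_le, D.shift_shift,
          ← mul_assoc, coeff_mul_C]
        congr 2
        · rw [add_neg_cancel, D.shift_zero]
          ring
        · push_cast
          omega

end IsSymmetricDressing

end BilinearIdentity

end CToda

end

noncomputable section

namespace CToda

open PowerSeries Finset

/-! ### The Fay identity and the symmetric cocycle. -/

section FayIdentity

variable {η : ℂ} {D : ShiftDomain η} {R : Type} [CommRing R]

/-- The defect of symmetry at x is yz times the defect at x − η, so it is divisible by every power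
of y. -/
theorem swap_kernelSeries (w : LowerOp D R) (x : D.Pt) :
    swap (kernelSeries w x) = kernelSeries w x := by
  have h : (fun x => swap (kernelSeries w x) - kernelSeries w x) = 0 := by
    refine eq_zero_of_eq_X_mul (D.shift (-1)) (c := fun _ => C X) fun x => ?_
    conv_lhs => rw [kernelSeries_eq w x]
    simp only [map_add, map_mul, swap_C, swap_map_C, swap_X, map_X]
    ring
  exact sub_eq_zero.1 (congrFun h x)

/-- The series `∑_{m ≥ 0} z^{2m} β(x - m η; z)²` for the amplitude `β`. -/
def squareSum (w : LowerOp D R) (x : D.Pt) : R⟦X⟧ := diag (kernelSeries w x)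

theorem squareSum_eq (w : LowerOp D R) (x : D.Pt) :
    squareSum w x = amplitude w x ^ 2 + X ^ 2 * squareSum w (D.shift (-1) x) := by
  rw [squareSum, kernelSeries_eq, map_add, map_mul, map_mul, map_mul, diag_C, diag_map_C, diag_X,
    diag_C, squareSum]
  ring

theorem coeff_zero_squareSum (w : LowerOp D R) (x : D.Pt) :
    coeff 0 (squareSum w x) = w.toOp 0 x ^ 2 := by
  rw [squareSum_eq, map_add, coeff_X_pow_mul', pow_two, coeff_mul]
  simp [amplitude, pow_two]

/-- The algebra behind one step x − η → x of the Fay identity: the defect gets multiplied by y²e'².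
The common factor Fz stays because `h1` has been multiplied by it to eliminate b̃; where the lemma
is applied it is a unit. -/
theorem fay_step {S : Type*} [CommRing S] {y z e e' Fz Fz' Fy K bz bw P G G₁ : S}
    (h1 : Fz * ((y - z) * P) = e * (y * bz * K - z * bw * Fz))
    (h2 : Fz' = bz ^ 2 + z ^ 2 * Fz) (h3 : Fz' = e' ^ 2 * Fz) (h4 : e * e' = 1)
    (hG : G = P ^ 2 + y ^ 2 * G₁) :
    Fz * ((bw ^ 2 + y ^ 2 * Fy) * Fz' - (bz * bw + y * z * K) ^ 2 - Fz' * (y - z) ^ 2 * G) =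
      Fz * (y * (y * e' ^ 2) * (Fy * Fz - K ^ 2 - Fz * (y - z) ^ 2 * G₁)) := by
  have h5 : e' ^ 2 * (Fz * ((y - z) * P)) ^ 2 = (y * bz * K - z * bw * Fz) ^ 2 := by
    rw [h1]
    linear_combination (e * e' + 1) * (y * bz * K - z * bw * Fz) ^ 2 * h4
  have h6 : e' ^ 2 * Fz = bz ^ 2 + z ^ 2 * Fz := h3.symm.trans h2
  rw [hG, h3]
  linear_combination (Fz * bw ^ 2 + y ^ 2 * K ^ 2) * h6 - h5

namespace IsSymmetricDressing

variable {d : ℕ → Derivation ℤ R R} {T : R →+* R⟦X⟧} {w v : LowerOp D R} {A : ℕ → LowerOp D R}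

theorem w_mul_v_zero (h : IsSymmetricDressing d w v A) (x : D.Pt) :
    w.toOp 0 x * v.toOp 0 x = 1 := by
  have h1 : (w * v).toOp 0 x = 1 := by
    rw [h.mul_v, LowerOp.toOp_one]
    simp [DiffOp.shiftOp]
  rw [LowerOp.mul_apply _ _ h.w_le h.v_le 0 x (l := 0) (by omega) le_rfl] at h1
  simpa using h1

theorem isUnit_squareSum (h : IsSymmetricDressing d w v A) (x : D.Pt) :
    IsUnit (squareSum w x) := by
  rw [PowerSeries.isUnit_iff_constantCoeff, ← coeff_zero_eq_constantCoeff_apply,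
    coeff_zero_squareSum]
  exact (IsUnit.of_mul_eq_one _ (h.w_mul_v_zero x)).pow 2

/-- The multiplicative cocycle `τ(t - [z])² / τ(t)²` of the tau-function. -/
def cocycle (w v : LowerOp D R) (x : D.Pt) : R⟦X⟧ := C (v.toOp 0 x) ^ 2 * squareSum w x

theorem coeff_zero_cocycle (h : IsSymmetricDressing d w v A) (x : D.Pt) :
    coeff 0 (cocycle w v x) = 1 := by
  rw [cocycle, ← map_pow, coeff_C_mul, coeff_zero_squareSum]
  have := h.w_mul_v_zero x
  linear_combination (w.toOp 0 x * v.toOp 0 x + 1) * this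

theorem shift_mul_shift_inv (h : IsSymmetricDressing d w v A) (x : D.Pt) :
    T (w.toOp 0 x) * C (v.toOp 0 (D.shift 1 x)) *
      (C (w.toOp 0 (D.shift 1 x)) * T (v.toOp 0 x)) = 1 := by
  have h1 : T (w.toOp 0 x) * T (v.toOp 0 x) = 1 := by
    rw [← map_mul, h.w_mul_v_zero, map_one]
  have h2 : C (w.toOp 0 (D.shift 1 x)) * C (v.toOp 0 (D.shift 1 x)) = 1 := by
    rw [← map_mul, h.w_mul_v_zero, map_one]
  linear_combination C (w.toOp 0 (D.shift 1 x)) * C (v.toOp 0 (D.shift 1 x)) * h1 + h2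

variable [IsAddTorsionFree R]

/-- The diagonal y = z of `map_amplitude_eq`, where the left side vanishes. -/
theorem adjointAmplitude_mul_squareSum (hT : IsMiwaShift d (-1) T)
    (h : IsSymmetricDressing d w v A) (x : D.Pt) :
    zExtend T (adjointAmplitude v x) * squareSum w x =
      T (w.toOp 0 x) * C (v.toOp 0 (D.shift 1 x)) * amplitude w (D.shift 1 x) := by
  have h1 := congrArg diag (h.map_amplitude_eq hT x)
  simp only [map_mul, map_sub, diag_X, diag_C, diag_map_C, sub_self, zero_mul] at h1
  apply X_mul_cancel
  rw [squareSum]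
  linear_combination -h1

/-- Write e = w_0(x; t−[z]) v_0(x+η; t) and e' = e⁻¹. The two relations b̃F = eβ(x+η) and b̃β(x+η) =
e' − z²e give β(x+η)² + z²F(x) = e'²F(x), and the left side is F(x+η). -/
theorem squareSum_shift (hT : IsMiwaShift d (-1) T)
    (h : IsSymmetricDressing d w v A) (x : D.Pt) :
    squareSum w (D.shift 1 x) =
      (C (w.toOp 0 (D.shift 1 x)) * T (v.toOp 0 x)) ^ 2 * squareSum w x := by
  have h1 := h.adjointAmplitude_mul_squareSum hT x
  have h2 := h.adjointAmplitude_mul_amplitude hT x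
  have h3 := h.shift_mul_shift_inv (T := T) x
  have h4 := squareSum_eq w (D.shift 1 x)
  rw [D.shift_shift, neg_add_cancel, D.shift_zero] at h4
  rw [h4]
  set e := T (w.toOp 0 x) * C (v.toOp 0 (D.shift 1 x))
  set e' := C (w.toOp 0 (D.shift 1 x)) * T (v.toOp 0 x)
  linear_combination e' * squareSum w x * h2 - e' * amplitude w (D.shift 1 x) * h1 -
    amplitude w (D.shift 1 x) ^ 2 * h3 - X ^ 2 * squareSum w x * h3

/-- The same two relations, with β(x+η) eliminated in place of b̃. -/
theorem adjointAmplitude_sq_mul_squareSum (hT : IsMiwaShift d (-1) T)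
    (h : IsSymmetricDressing d w v A) (x : D.Pt) :
    zExtend T (adjointAmplitude v x) ^ 2 * squareSum w x =
      1 - X ^ 2 * (T (w.toOp 0 x) * C (v.toOp 0 (D.shift 1 x))) ^ 2 := by
  have h1 := h.adjointAmplitude_mul_squareSum hT x
  have h2 := h.adjointAmplitude_mul_amplitude hT x
  have h3 := h.shift_mul_shift_inv (T := T) x
  linear_combination zExtend T (adjointAmplitude v x) * h1 +
    T (w.toOp 0 x) * C (v.toOp 0 (D.shift 1 x)) * h2 + h3

/-- The Fay identity for the Miwa shifts by `-[z]` and `-[y]`. -/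
theorem fay (hT : IsMiwaShift d (-1) T) (h : IsSymmetricDressing d w v A) (x : D.Pt) :
    C (squareSum w (D.shift 1 x)) * (X - C X) ^ 2 * map T (squareSum w x) =
      map C (squareSum w (D.shift 1 x)) * C (squareSum w (D.shift 1 x)) -
        kernelSeries w (D.shift 1 x) ^ 2 := by
  -- The defect at x equals y²e'² times the defect at x − η, hence it vanishes to all orders in y.
  have hΓ : (fun x => map C (squareSum w (D.shift 1 x)) * C (squareSum w (D.shift 1 x)) -
        kernelSeries w (D.shift 1 x) ^ 2 -
        C (squareSum w (D.shift 1 x)) * (X - C X) ^ 2 * map T (squareSum w x)) = 0 := by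
    refine eq_zero_of_eq_X_mul (D.shift (-1)) (c := fun x => X *
      C ((C (w.toOp 0 (D.shift 1 x)) * T (v.toOp 0 x))) ^ 2) fun x => ?_
    have hu : IsUnit (C (squareSum w x)) := (h.isUnit_squareSum x).map C
    apply hu.mul_left_cancel
    have h4 := squareSum_eq w (D.shift 1 x)
    have h5 := kernelSeries_eq w (D.shift 1 x)
    rw [D.shift_shift, neg_add_cancel, D.shift_zero] at h4 h5
    have h6 : map C (squareSum w (D.shift 1 x)) = map C (amplitude w (D.shift 1 x)) ^ 2 +
        X ^ 2 * map C (squareSum w x) := by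
      rw [h4]
      simp
    have h7 := congrArg (map T) (squareSum_eq w x)
    simp only [map_add, map_mul, map_pow, map_X] at h7
    have h8 := congrArg C (h.adjointAmplitude_mul_squareSum hT x)
    simp only [D.shift_shift, add_neg_cancel, D.shift_zero]
    rw [h6, h5]
    refine fay_step (e := C (T (w.toOp 0 x) * C (v.toOp 0 (D.shift 1 x)))) ?_ ?_ ?_ ?_ h7
    · rw [h.map_amplitude_eq hT]
      rw [map_mul, map_mul C (T (w.toOp 0 x) * _)] at h8
      linear_combination X * kernelSeries w x * h8
    · rw [h4]
      simp
    · rw [h.squareSum_shift hT]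
      simp
    · rw [← map_mul, h.shift_mul_shift_inv, map_one]
  exact (sub_eq_zero.1 (congrFun hΓ x)).symm

/-- The ratio r(x+η)/r(x) is exactly the change of (τ(t−[z])/τ(t))² under τ(x+η) = v_0(x) τ(x). -/
theorem cocycle_shift (hT : IsMiwaShift d (-1) T) (h : IsSymmetricDressing d w v A) (x : D.Pt) :
    C (v.toOp 0 x) ^ 2 * cocycle w v (D.shift 1 x) = T (v.toOp 0 x) ^ 2 * cocycle w v x := by
  have h2 : C (w.toOp 0 (D.shift 1 x)) * C (v.toOp 0 (D.shift 1 x)) = 1 := by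
    rw [← map_mul, h.w_mul_v_zero, map_one]
  rw [cocycle, cocycle, h.squareSum_shift hT]
  linear_combination C (v.toOp 0 x) ^ 2 * T (v.toOp 0 x) ^ 2 * squareSum w x *
    (C (w.toOp 0 (D.shift 1 x)) * C (v.toOp 0 (D.shift 1 x)) + 1) * h2

/-- After multiplication by (y − z)² the Fay identity turns the product into an expression in F(x+η)
and K(x+η) that is visibly symmetric; then (y − z)² is cancelled. -/
theorem cocycle_symm (hT : IsMiwaShift d (-1) T) (h : IsSymmetricDressing d w v A) (x : D.Pt) :
    swap (C (cocycle w v x) * map T (cocycle w v x)) =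
      C (cocycle w v x) * map T (cocycle w v x) := by
  have h1 : (X - C X) ^ 2 * (C (cocycle w v x) * map T (cocycle w v x)) =
      C (C (v.toOp 0 x * v.toOp 0 (D.shift 1 x))) ^ 2 *
        (map C (squareSum w (D.shift 1 x)) * C (squareSum w (D.shift 1 x)) -
          kernelSeries w (D.shift 1 x) ^ 2) := by
    have h2 : C (w.toOp 0 (D.shift 1 x)) * C (v.toOp 0 (D.shift 1 x)) = 1 := by
      rw [← map_mul, h.w_mul_v_zero, map_one]
    have h3 : T (v.toOp 0 x) ^ 2 * squareSum w x =
        C (v.toOp 0 (D.shift 1 x)) ^ 2 * squareSum w (D.shift 1 x) := by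
      rw [h.squareSum_shift hT]
      linear_combination -T (v.toOp 0 x) ^ 2 * squareSum w x *
        (C (w.toOp 0 (D.shift 1 x)) * C (v.toOp 0 (D.shift 1 x)) + 1) * h2
    have h4 := congrArg C h3
    simp only [map_mul, map_pow] at h4
    rw [← h.fay hT]
    simp only [cocycle, map_mul, map_pow, map_C]
    linear_combination (X - C X) ^ 2 * C (C (v.toOp 0 x)) ^ 2 * map T (squareSum w x) * h4
  have h5 := congrArg swap h1
  simp only [map_mul swap, map_pow swap, map_sub swap, swap_C, swap_map_C, swap_X, map_X, map_C,
    swap_kernelSeries] at h5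
  rw [← sub_eq_zero]
  apply X_sub_C_X_mul_cancel
  apply X_sub_C_X_mul_cancel
  rw [map_mul, swap_C]
  linear_combination h5 - h1

end IsSymmetricDressing

end FayIdentity

end CToda

end

noncomputable section

namespace CToda

open MvPowerSeries

/-! ### Identities of power series in infinitely many variables, checked on polynomials. -/

section Local

variable {σ τ υ K : Type*} [CommRing K]

/-- A map of rings of formal power series is local if every coefficient of the image depends only
on finitely many coefficients of the argument. -/
def IsLocal (Φ : MvPowerSeries σ K → MvPowerSeries τ K) : Prop :=
  ∀ e, ∃ s : Finset (σ →₀ ℕ), ∀ f g, (∀ i ∈ s, coeff i f = coeff i g) →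
    coeff e (Φ f) = coeff e (Φ g)

namespace IsLocal

theorem comp {Φ : MvPowerSeries τ K → MvPowerSeries υ K} {Ψ : MvPowerSeries σ K → MvPowerSeries τ K}
    (hΦ : IsLocal Φ) (hΨ : IsLocal Ψ) : IsLocal fun f => Φ (Ψ f) := by
  classical
  intro e
  obtain ⟨s, hs⟩ := hΦ e
  choose t ht using hΨ
  exact ⟨s.biUnion t, fun f g h => hs _ _ fun i hi => ht i f g fun j hj =>
    h j (Finset.mem_biUnion.2 ⟨i, hi, hj⟩)⟩

theorem const (a : MvPowerSeries τ K) : IsLocal fun _ : MvPowerSeries σ K => a :=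
  fun _ => ⟨∅, fun _ _ _ => rfl⟩

theorem add {Φ Ψ : MvPowerSeries σ K → MvPowerSeries τ K} (hΦ : IsLocal Φ) (hΨ : IsLocal Ψ) :
    IsLocal fun f => Φ f + Ψ f := by
  classical
  intro e
  obtain ⟨s, hs⟩ := hΦ e
  obtain ⟨t, ht⟩ := hΨ e
  refine ⟨s ∪ t, fun f g h => ?_⟩
  rw [map_add, map_add, hs f g fun i hi => h i (Finset.mem_union_left _ hi),
    ht f g fun i hi => h i (Finset.mem_union_right _ hi)]

theorem mul {Φ Ψ : MvPowerSeries σ K → MvPowerSeries τ K} (hΦ : IsLocal Φ) (hΨ : IsLocal Ψ) :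
    IsLocal fun f => Φ f * Ψ f := by
  classical
  intro e
  choose s hs using hΦ
  choose t ht using hΨ
  refine ⟨(Finset.HasAntidiagonal.antidiagonal e).biUnion fun p => s p.1 ∪ t p.2, fun f g h => ?_⟩
  rw [coeff_mul, coeff_mul]
  refine Finset.sum_congr rfl fun p hp => ?_
  rw [hs p.1 f g fun i hi => h i (Finset.mem_biUnion.2 ⟨p, hp, Finset.mem_union_left _ hi⟩),
    ht p.2 f g fun i hi => h i (Finset.mem_biUnion.2 ⟨p, hp, Finset.mem_union_right _ hi⟩)]

theorem sum {ι : Type*} (s : Finset ι) {Φ : ι → MvPowerSeries σ K → MvPowerSeries τ K}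
    (h : ∀ i ∈ s, IsLocal (Φ i)) : IsLocal fun f => ∑ i ∈ s, Φ i f := by
  classical
  induction s using Finset.induction_on with
  | empty => simpa using const 0
  | insert a s ha ih =>
    simp only [Finset.sum_insert ha]
    exact (h a (Finset.mem_insert_self a s)).add
      (ih fun i hi => h i (Finset.mem_insert_of_mem hi))

theorem pderiv (i : σ) : IsLocal (MvPowerSeries.pderiv K i) := by
  intro e
  refine ⟨{e + Finsupp.single i 1}, fun f g h => ?_⟩
  rw [coeff_pderiv, coeff_pderiv, h _ (Finset.mem_singleton_self _)]

theorem subst {a : σ → MvPowerSeries τ K} (ha : HasSubst a) :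
    IsLocal (subst a : MvPowerSeries σ K → MvPowerSeries τ K) := by
  intro e
  obtain ⟨u, hu⟩ : ∃ u : MvPowerSeries σ K, ∀ d, coeff d u = 1 := ⟨fun _ => 1, fun _ => rfl⟩
  have h := coeff_subst_finite ha u e
  refine ⟨h.toFinset, fun f g hfg => ?_⟩
  rw [coeff_subst ha, coeff_subst ha]
  refine finsum_congr fun d => ?_
  by_cases hd : coeff e (d.prod fun s e => a s ^ e) = 0
  · simp [hd]
  · rw [hfg d]
    simpa [hu] using hd

/-- A given coefficient of both images sees only finitely many monomials of f, so f may be truncated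
to a polynomial. This takes the place of a density argument. -/
theorem ext {Φ Ψ : MvPowerSeries σ K → MvPowerSeries τ K} (hΦ : IsLocal Φ) (hΨ : IsLocal Ψ)
    (h : ∀ p : MvPolynomial σ K, Φ p = Ψ p) (f : MvPowerSeries σ K) : Φ f = Ψ f := by
  classical
  ext e
  obtain ⟨s, hs⟩ := hΦ e
  obtain ⟨t, ht⟩ := hΨ e
  set p : MvPolynomial σ K := ∑ i ∈ s ∪ t, MvPolynomial.monomial i (coeff i f) with hp
  have hc : ∀ i ∈ s ∪ t, coeff i f = coeff i (p : MvPowerSeries σ K) := by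
    intro i hi
    rw [MvPolynomial.coeff_coe, hp, MvPolynomial.coeff_sum]
    simp only [MvPolynomial.coeff_monomial]
    rw [Finset.sum_ite_eq', if_pos hi]
  rw [hs f p fun i hi => hc i (Finset.mem_union_left _ hi), h,
    ht f p fun i hi => hc i (Finset.mem_union_right _ hi)]

end IsLocal

/-- Two additive maps that satisfy the Leibniz rule along the same ring homomorphism agree on
polynomials if they agree on constants and on the variables. -/
theorem eq_on_polynomial_of_leibniz {A : Type*} [CommRing A] (h : MvPowerSeries σ K →+* A)
    {Φ Ψ : MvPowerSeries σ K → A}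
    (hΦ_add : ∀ f g, Φ (f + g) = Φ f + Φ g) (hΨ_add : ∀ f g, Ψ (f + g) = Ψ f + Ψ g)
    (hΦ : ∀ f g, Φ (f * g) = Φ f * h g + h f * Φ g)
    (hΨ : ∀ f g, Ψ (f * g) = Ψ f * h g + h f * Ψ g)
    (hC : ∀ c, Φ (C c) = Ψ (C c)) (hX : ∀ i, Φ (X i) = Ψ (X i)) (p : MvPolynomial σ K) :
    Φ p = Ψ p := by
  induction p using MvPolynomial.induction_on with
  | C c => simpa using hC c
  | add p q hp hq => rw [MvPolynomial.coe_add, hΦ_add, hΨ_add, hp, hq]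
  | mul_X p i hp => rw [MvPolynomial.coe_mul, MvPolynomial.coe_X, hΦ, hΨ, hp, hX]

theorem IsLocal.ext_of_leibniz (h : MvPowerSeries σ K →+* MvPowerSeries τ K)
    (Φ Ψ : MvPowerSeries σ K → MvPowerSeries τ K) (hΦ_local : IsLocal Φ) (hΨ_local : IsLocal Ψ)
    (hΦ_add : ∀ f g, Φ (f + g) = Φ f + Φ g) (hΨ_add : ∀ f g, Ψ (f + g) = Ψ f + Ψ g)
    (hΦ : ∀ f g, Φ (f * g) = Φ f * h g + h f * Φ g)
    (hΨ : ∀ f g, Ψ (f * g) = Ψ f * h g + h f * Ψ g)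
    (hC : ∀ c, Φ (C c) = Ψ (C c)) (hX : ∀ i, Φ (X i) = Ψ (X i)) (f : MvPowerSeries σ K) :
    Φ f = Ψ f :=
  hΦ_local.ext hΨ_local (eq_on_polynomial_of_leibniz h hΦ_add hΨ_add hΦ hΨ hC hX) f

theorem constantCoeff_subst_of_constantCoeff {a : σ → MvPowerSeries τ K} (ha : HasSubst a)
    (ha0 : ∀ i, constantCoeff (a i) = 0) (f : MvPowerSeries σ K) :
    constantCoeff (subst a f) = constantCoeff f := by
  have h : constantCoeff (subst a (f - C (constantCoeff f))) = 0 :=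
    constantCoeff_subst_eq_zero ha ha0 (by simp)
  rw [subst_sub ha, map_sub, subst_C, constantCoeff_C, sub_eq_zero] at h
  exact h

end Local

/-! ### Restriction to the slice, exponentials and the Poincaré lemma. -/

section Restrict

theorem hasSubst_restrict : HasSubst
    (Sum.elim (fun j => X j) (fun j => -X j) : ℕ+ ⊕ ℕ+ → TimeFun) := by
  classical
  refine ⟨fun s => ?_, fun d => ?_⟩
  · rcases s with j | j <;> simp
  · refine ((d.support.finite_toSet.image Sum.inl).union
      (d.support.finite_toSet.image Sum.inr)).subset fun s hs => ?_
    rcases s with j | j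
    · left
      have : d = Finsupp.single j 1 := by
        by_contra h
        simp [coeff_X, h] at hs
      simp [this]
    · right
      have : d = Finsupp.single j 1 := by
        by_contra h
        simp [coeff_X, h] at hs
      simp [this]

/-- Restriction to the slice as a ring homomorphism. -/
def restrictHom : TodaFun →+* TimeFun := (substAlgHom (R := ℂ) hasSubst_restrict : _ →ₐ[ℂ] _)

@[simp]
theorem restrictHom_apply (f : TodaFun) : restrictHom f = restrict f :=
  substAlgHom_apply hasSubst_restrict f

@[simp]
theorem restrict_C (c : ℂ) : restrict (C c) = C c := subst_C c

@[simp]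
theorem restrict_X_inl (j : ℕ+) : restrict (X (Sum.inl j)) = X j :=
  subst_X hasSubst_restrict _

@[simp]
theorem restrict_X_inr (j : ℕ+) : restrict (X (Sum.inr j)) = -X j :=
  subst_X hasSubst_restrict _

@[simp]
theorem restrict_zero : restrict 0 = 0 := by simpa using map_zero restrictHom

@[simp]
theorem restrict_one : restrict 1 = 1 := by simpa using map_one restrictHom

theorem restrict_add (f g : TodaFun) : restrict (f + g) = restrict f + restrict g := by
  simpa using map_add restrictHom f g

theorem restrict_neg (f : TodaFun) : restrict (-f) = -restrict f := by
  simpa using map_neg restrictHom f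

theorem restrict_mul (f g : TodaFun) : restrict (f * g) = restrict f * restrict g := by
  simpa using map_mul restrictHom f g

theorem restrict_smul (c : ℂ) (f : TodaFun) : restrict (c • f) = c • restrict f := by
  rw [smul_eq_C_mul, restrict_mul, restrict_C, ← smul_eq_C_mul]

theorem constantCoeff_restrict (f : TodaFun) :
    constantCoeff (restrict f) = constantCoeff f :=
  constantCoeff_subst_of_constantCoeff hasSubst_restrict (by rintro (j | j) <;> simp) f

/-- The chain rule for the restriction to the slice. -/
theorem pderiv_restrict (m : ℕ+) (f : TodaFun) :
    pderiv ℂ m (restrict f) =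
      restrict (pderiv ℂ (Sum.inl m) f) - restrict (pderiv ℂ (Sum.inr m) f) := by
  classical
  have hr : IsLocal restrict := IsLocal.subst hasSubst_restrict
  refine IsLocal.ext_of_leibniz restrictHom (fun f => pderiv ℂ m (restrict f))
    (fun f => restrict (pderiv ℂ (Sum.inl m) f) - restrict (pderiv ℂ (Sum.inr m) f))
    ((IsLocal.pderiv m).comp hr) ?_ ?_ ?_ ?_ ?_ ?_ ?_ f
  · simp only [sub_eq_add_neg, ← neg_one_mul (restrict (pderiv ℂ (Sum.inr m) _))]
    exact (hr.comp (IsLocal.pderiv _)).add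
      ((IsLocal.const _).mul (hr.comp (IsLocal.pderiv _)))
  · simp [restrict_add]
  · intro f g
    simp only [map_add, restrict_add]
    ring
  · intro f g
    simp only [restrict_mul, Derivation.leibniz, smul_eq_mul, restrictHom_apply]
    ring
  · intro f g
    simp only [restrict_mul, Derivation.leibniz, smul_eq_mul, restrictHom_apply, restrict_add]
    ring
  · simp
  · rintro (j | j)
    · simp [pderiv_X, Pi.single_apply, apply_ite restrict]
    · simp [pderiv_X, Pi.single_apply, apply_ite restrict]

end Restrict

section Exponential

variable {σ : Type}

theorem hasSubst_const {g : MvPowerSeries σ ℂ} (hg : constantCoeff g = 0) :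
    HasSubst (fun _ : Unit => g) :=
  (PowerSeries.HasSubst.of_constantCoeff_zero hg).const

theorem pderiv_subst_const {g : MvPowerSeries σ ℂ} (hg : constantCoeff g = 0) (i : σ)
    (f : MvPowerSeries Unit ℂ) :
    pderiv ℂ i (subst (fun _ => g) f) =
      pderiv ℂ i g * subst (fun _ => g) (pderiv ℂ () f) := by
  have ha := hasSubst_const hg
  refine IsLocal.ext_of_leibniz (substAlgHom (R := ℂ) ha : _ →ₐ[ℂ] _)
    (fun f => pderiv ℂ i (subst (fun _ => g) f))
    (fun f => pderiv ℂ i g * subst (fun _ => g) (pderiv ℂ () f))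
    ((IsLocal.pderiv i).comp (IsLocal.subst ha))
    ((IsLocal.const _).mul ((IsLocal.subst ha).comp (IsLocal.pderiv ()))) ?_ ?_ ?_ ?_ ?_ ?_ f
  · simp [subst_add ha]
  · simp [subst_add ha, mul_add]
  · intro f g
    simp only [subst_mul ha, Derivation.leibniz, smul_eq_mul, RingHom.coe_coe, substAlgHom_apply]
    ring
  · intro f g
    simp only [subst_mul ha, subst_add ha, Derivation.leibniz, smul_eq_mul, RingHom.coe_coe,
      substAlgHom_apply]
    ring
  · intro c
    rw [subst_C, pderiv_C, pderiv_C, ← coe_substAlgHom ha, map_zero, mul_zero]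
  · rintro ⟨⟩
    rw [subst_X ha, pderiv_X_self, ← coe_substAlgHom ha, map_one, mul_one]

theorem pderiv_exp : pderiv ℂ () (PowerSeries.exp ℂ : MvPowerSeries Unit ℂ) = PowerSeries.exp ℂ := by
  refine MvPowerSeries.ext fun n => ?_
  have hn : n = Finsupp.single () (n ()) := by ext; simp
  have h1 : ∀ k, coeff (Finsupp.single () k) (PowerSeries.exp ℂ : MvPowerSeries Unit ℂ) =
      1 / (Nat.factorial k : ℂ) := fun k => by
    have := PowerSeries.coeff_exp (A := ℂ) k
    simpa [PowerSeries.coeff] using this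
  rw [coeff_pderiv, hn, ← Finsupp.single_add, h1, h1, Finsupp.single_eq_same, Nat.factorial_succ]
  have h2 : (n () + 1 : ℂ) ≠ 0 := by exact_mod_cast Nat.succ_ne_zero (n ())
  have h3 : (Nat.factorial (n ()) : ℂ) ≠ 0 := by exact_mod_cast Nat.factorial_ne_zero _
  push_cast
  field_simp

theorem pderiv_expSeries (i : σ) (f : MvPowerSeries σ ℂ) :
    pderiv ℂ i (expSeries f) = pderiv ℂ i f * expSeries f := by
  have h := pderiv_subst_const (g := f - C (constantCoeff f)) (by simp) i (PowerSeries.exp ℂ)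
  rw [pderiv_exp, map_sub, pderiv_C, sub_zero] at h
  rw [expSeries, Derivation.leibniz, pderiv_C, smul_zero, add_zero, smul_eq_mul, PowerSeries.subst,
    h]
  ring

@[simp]
theorem constantCoeff_expSeries (f : MvPowerSeries σ ℂ) :
    constantCoeff (expSeries f) = Complex.exp (constantCoeff f) := by
  have h0 : constantCoeff (f - C (constantCoeff f)) = 0 := by simp
  have h1 := constantCoeff_subst_of_constantCoeff (hasSubst_const h0) (fun _ => h0)
    (PowerSeries.exp ℂ)
  have h2 : constantCoeff (PowerSeries.exp ℂ : MvPowerSeries Unit ℂ) = 1 :=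
    PowerSeries.constantCoeff_exp
  rw [expSeries, map_mul, constantCoeff_C, PowerSeries.subst, h1, h2, mul_one]

/-- The quotient u/v has zero derivatives and constant term 1. The properties of `expSeries` are all
derived from this uniqueness. -/
theorem eq_of_pderiv_eq_mul {u v : MvPowerSeries σ ℂ} {p : σ → MvPowerSeries σ ℂ}
    (hu : ∀ i, pderiv ℂ i u = p i * u) (hv : ∀ i, pderiv ℂ i v = p i * v)
    (h0 : constantCoeff u = constantCoeff v) (hv0 : constantCoeff v ≠ 0) : u = v := by
  have h : u * v⁻¹ = 1 := by
    refine pderiv.ext (fun i => ?_) ?_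
    · rw [Derivation.leibniz, pderiv_inv', hu, hv, pderiv_one, smul_eq_mul, smul_eq_mul]
      linear_combination -u * v⁻¹ * p i * MvPowerSeries.mul_inv_cancel v hv0
    · rw [map_mul, h0, ← map_mul, MvPowerSeries.mul_inv_cancel v hv0]
  calc u = u * (v⁻¹ * v) := by rw [MvPowerSeries.inv_mul_cancel v hv0, mul_one]
    _ = v := by rw [← mul_assoc, h, one_mul]

theorem expSeries_add (f g : MvPowerSeries σ ℂ) :
    expSeries (f + g) = expSeries f * expSeries g := by
  refine eq_of_pderiv_eq_mul (p := fun i => pderiv ℂ i f + pderiv ℂ i g) (fun i => ?_)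
    (fun i => ?_) ?_ ?_
  · rw [pderiv_expSeries, map_add]
  · rw [Derivation.leibniz, pderiv_expSeries, pderiv_expSeries, smul_eq_mul, smul_eq_mul]
    ring
  · simp [Complex.exp_add]
  · simp

@[simp]
theorem expSeries_zero : expSeries (0 : MvPowerSeries σ ℂ) = 1 := by
  refine eq_of_pderiv_eq_mul (p := fun i => 0) (fun i => ?_) (fun i => ?_) ?_ ?_
  · simp [pderiv_expSeries]
  · simp
  · simp
  · simp

theorem expSeries_mul_expSeries_neg (f : MvPowerSeries σ ℂ) :
    expSeries f * expSeries (-f) = 1 := by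
  rw [← expSeries_add, add_neg_cancel, expSeries_zero]

theorem expSeries_half_sq (f : MvPowerSeries σ ℂ) :
    expSeries ((1 / 2 : ℂ) • f) ^ 2 = expSeries f := by
  rw [pow_two, ← expSeries_add, ← add_smul]
  norm_num

theorem restrict_expSeries (f : TodaFun) : restrict (expSeries f) = expSeries (restrict f) := by
  refine eq_of_pderiv_eq_mul (p := fun i => pderiv ℂ i (restrict f)) (fun i => ?_)
    (fun i => ?_) ?_ ?_
  · simp only [pderiv_restrict, pderiv_expSeries, restrict_mul]
    ring
  · rw [pderiv_expSeries]
  · simp [constantCoeff_restrict]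
  · simp

end Exponential

section Poincare

variable {σ : Type*}

/-- A potential must have at t^m the coefficient of f_j at t^m/t_j, divided by m_j. Closedness shows
that the result is the same for every j that occurs in m. -/
theorem coeff_div_mul_eq {f : σ → MvPowerSeries σ ℂ}
    (hf : ∀ i j, pderiv ℂ i (f j) = pderiv ℂ j (f i)) {i j : σ} {m n : σ →₀ ℕ}
    (hm : m = n + Finsupp.single i 1) (hj : m j ≠ 0) :
    coeff (m - Finsupp.single j 1) (f j) / (m j : ℂ) * (n i + 1) = coeff n (f i) := by
  classical
  by_cases hji : j = i
  · subst hji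
    have h1 : (m j : ℂ) = n j + 1 := by simp [hm]
    have h2 : m - Finsupp.single j 1 = n := by rw [hm, add_tsub_cancel_right]
    rw [h2, ← h1, div_mul_cancel₀ _ (Nat.cast_ne_zero.2 hj)]
  · have hmj : m j = n j := by simp [hm, Ne.symm hji]
    have hle : Finsupp.single j 1 ≤ n := by
      rw [Finsupp.single_le_iff, ← hmj]
      exact Nat.one_le_iff_ne_zero.2 hj
    obtain ⟨q, hq⟩ := exists_add_of_le hle
    have h1 := congrArg (coeff q) (hf i j)
    rw [coeff_pderiv, coeff_pderiv, add_comm q (Finsupp.single j 1), ← hq] at h1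
    have h2 : m - Finsupp.single j 1 = q + Finsupp.single i 1 := by
      rw [hm, hq, add_assoc, add_tsub_cancel_left]
    have h3 : n i = q i := by simp [hq, hji]
    have h4 : m j = q j + 1 := by
      rw [hmj, hq]
      simp [add_comm]
    have h5 : ((q j + 1 : ℕ) : ℂ) ≠ 0 := Nat.cast_ne_zero.2 (Nat.succ_ne_zero _)
    rw [h2, h3, h4, div_mul_eq_mul_div, h1, ← Nat.cast_succ, mul_div_cancel_right₀ _ h5]

/-- The Poincaré lemma for formal power series. -/
theorem exists_pderiv_eq {f : σ → MvPowerSeries σ ℂ}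
    (hf : ∀ i j, pderiv ℂ i (f j) = pderiv ℂ j (f i)) : ∃ g, ∀ i, pderiv ℂ i g = f i := by
  classical
  rcases isEmpty_or_nonempty σ with h0 | h0
  · exact ⟨0, fun i => isEmptyElim i⟩
  have hex : ∀ n : σ →₀ ℕ, n ≠ 0 → ∃ i, n i ≠ 0 := fun n hn => Finsupp.ne_iff.1 hn
  choose! j hj using hex
  have hcoeff : ∀ c : (σ →₀ ℕ) → ℂ, ∃ g : MvPowerSeries σ ℂ, ∀ n, coeff n g = c n :=
    fun c => ⟨c, fun _ => rfl⟩
  -- Each monomial is integrated along one chosen variable that occurs in it. The constant term is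
  -- irrelevant.
  obtain ⟨g, hg⟩ := hcoeff fun n => coeff (n - Finsupp.single (j n) 1) (f (j n)) / (n (j n) : ℂ)
  refine ⟨g, fun i => MvPowerSeries.ext fun n => ?_⟩
  obtain ⟨m, hm⟩ : ∃ m, m = n + Finsupp.single i 1 := ⟨_, rfl⟩
  have hm0 : m ≠ 0 := fun h => by simpa [hm] using DFunLike.congr_fun h i
  rw [coeff_pderiv, hg, ← hm]
  exact coeff_div_mul_eq hf hm (hj m hm0)

end Poincare

end CToda

end

noncomputable section

namespace CToda

open MvPowerSeries

/-! ### The Miwa shift on functions of the times. -/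

section Miwa

/-- Derivations of a ring over the integers. -/
abbrev IntDerivation (R : Type*) [CommRing R] : Type _ := Derivation ℤ R R

/-- An additive map with the Leibniz rule as a derivation over the integers. -/
def intDerivation {R : Type*} [CommRing R] (d : R →+ R) (hd : ∀ f g, d (f * g) = f * d g + g * d f) :
    IntDerivation R :=
  Derivation.mk' d.toIntLinearMap hd

/-- The derivation with respect to the time `t_j`, and zero for `j = 0`. -/
def timeDer : ℕ → IntDerivation TimeFun
  | 0 => 0
  | j + 1 => intDerivation (pderiv ℂ j.succPNat : TimeFun →ₗ[ℂ] TimeFun).toAddMonoidHom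
      fun f g => (pderiv ℂ j.succPNat).leibniz f g

theorem timeDer_zero (f : TimeFun) : timeDer 0 f = 0 := rfl

theorem timeDer_succ (j : ℕ) (f : TimeFun) : timeDer (j + 1) f = pderiv ℂ j.succPNat f := rfl

instance (σ : Type*) : IsAddTorsionFree (MvPowerSeries σ ℂ) :=
  inferInstanceAs (IsAddTorsionFree ((σ →₀ ℕ) → ℂ))

theorem timeDer_coe (m : ℕ+) (f : TimeFun) : timeDer m f = pderiv ℂ m f := by
  obtain ⟨k, hk⟩ : ∃ k : ℕ, m = k.succPNat := ⟨m.natPred, by simp⟩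
  subst hk
  exact timeDer_succ k f

theorem timeDer_C (j : ℕ) (c : ℂ) : timeDer j (C c) = 0 := by
  rcases j with _ | j
  · exact timeDer_zero _
  · rw [timeDer_succ, pderiv_C]

theorem timeDer_comm (i j : ℕ) (f : TimeFun) :
    timeDer i (timeDer j f) = timeDer j (timeDer i f) := by
  classical
  rcases i with _ | i <;> rcases j with _ | j <;> simp only [timeDer_zero, timeDer_succ,
    map_zero]
  ext n
  simp only [coeff_pderiv, Finsupp.add_apply, Finsupp.single_apply]
  rcases eq_or_ne i j with rfl | h
  · rfl
  · have h1 : i.succPNat ≠ j.succPNat := fun h' => h (Nat.succPNat_injective h')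
    simp only [h1, h1.symm, if_false, add_zero]
    rw [add_right_comm]
    ring

/-- A fixed monomial is some t_j or some z^j for at most finitely many j, so infinitely many
substituted series cause no divergence. -/
theorem hasSubst_miwa (ε : ℂ) : HasSubst (fun j : ℕ+ => (X (some j) +
    C (ε / ((j : ℕ) : ℂ)) * X none ^ (j : ℕ) : MvPowerSeries (Option ℕ+) ℂ)) := by
  classical
  refine ⟨fun j => by simp, fun d => ?_⟩
  refine ((d.support.finite_toSet.preimage (Option.some_injective _).injOn).union
    ((Set.finite_singleton (d none)).preimage PNat.coe_injective.injOn)).subset fun j hj => ?_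
  by_contra h
  rw [Set.mem_union, not_or] at h
  have h1 : d ≠ Finsupp.single (some j) 1 := by
    rintro rfl
    simp at h
  have h2 : d ≠ Finsupp.single none (j : ℕ) := by
    rintro rfl
    simp at h
  rw [Set.mem_ofPred_eq, map_add, coeff_C_mul, coeff_X, coeff_X_pow, if_neg h1, if_neg h2] at hj
  simp at hj

/-- The Miwa shift as a ring homomorphism. -/
def miwaHom (ε : ℂ) : TimeFun →+* PowerSeries TimeFun :=
  (optionEquivLeft ℕ+ ℂ).toAlgHom.toRingHom.comp (substAlgHom (R := ℂ) (hasSubst_miwa ε)).toRingHom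

theorem coeff_coeff_miwaHom (ε : ℂ) (f : TimeFun) (k : ℕ) (μ : ℕ+ →₀ ℕ) :
    coeff μ (PowerSeries.coeff k (miwaHom ε f)) = coeff (μ.optionElim k) (miwaAux ε f) := by
  have h : miwaHom ε f = optionEquivLeft ℕ+ ℂ (miwaAux ε f) :=
    congrArg (optionEquivLeft ℕ+ ℂ) (substAlgHom_apply (hasSubst_miwa ε) f)
  rw [h, coeff_coeff_optionEquivLeft]

theorem miwaHom_apply (ε : ℂ) (f : TimeFun) : miwaHom ε f = miwa ε f := by
  classical
  ext k μ
  rw [coeff_coeff_miwaHom]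
  change _ = coeff _ (miwaAux ε f)
  congr 2
  ext (_ | j)
  · simp [Finsupp.mapDomain_of_notMem_range]
  · rw [Finsupp.optionElim_apply_some, Finsupp.add_apply,
      Finsupp.mapDomain_apply (Option.some_injective _)]
    simp

theorem miwaHom_C (ε : ℂ) (c : ℂ) : miwaHom ε (C c) = PowerSeries.C (C c) := by
  have h : miwaHom ε (C c) = optionEquivLeft ℕ+ ℂ (C c) :=
    congrArg (optionEquivLeft ℕ+ ℂ)
      ((substAlgHom_apply (hasSubst_miwa ε) _).trans (subst_C c))
  rw [h, optionEquivLeft_C]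

theorem miwaHom_X (ε : ℂ) (j : ℕ+) : miwaHom ε (X j) =
    PowerSeries.C (X j) + PowerSeries.C (C (ε / ((j : ℕ) : ℂ))) * PowerSeries.X ^ (j : ℕ) := by
  have h : miwaHom ε (X j) = optionEquivLeft ℕ+ ℂ (X (some j) +
      C (ε / ((j : ℕ) : ℂ)) * X none ^ (j : ℕ)) :=
    congrArg (optionEquivLeft ℕ+ ℂ)
      ((substAlgHom_apply (hasSubst_miwa ε) _).trans (subst_X (hasSubst_miwa ε) j))
  rw [h, map_add, map_mul, map_pow, optionEquivLeft_X_some, optionEquivLeft_X_none,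
    optionEquivLeft_C]

theorem isLocal_coeff_miwaHom (ε : ℂ) (k : ℕ) :
    IsLocal fun f => PowerSeries.coeff k (miwaHom ε f) := by
  intro e
  obtain ⟨s, hs⟩ := IsLocal.subst (hasSubst_miwa ε) (e.optionElim k)
  exact ⟨s, fun f g h => by
    rw [coeff_coeff_miwaHom, coeff_coeff_miwaHom]
    exact hs f g h⟩

theorem isLocal_timeDer (j : ℕ) : IsLocal (timeDer j) := by
  rcases j with _ | j
  · exact IsLocal.const 0
  · exact IsLocal.pderiv j.succPNat

theorem isLocal_smul (c : ℤ) {σ τ K : Type*} [CommRing K]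
    {Φ : MvPowerSeries σ K → MvPowerSeries τ K} (h : IsLocal Φ) : IsLocal fun f => c • Φ f := by
  simp only [zsmul_eq_mul]
  exact (IsLocal.const _).mul h

/-- Both sides satisfy the Leibniz rule along the shift, and on t_i both are εz^i, which is z d/dz
of εz^i/i. -/
theorem euler_miwaHom (ε : ℤ) (p : MvPolynomial ℕ+ ℂ) :
    euler (miwaHom ε p) = ε • zExtend (miwaHom ε) (PowerSeries.mk fun j => timeDer j p) := by
  classical
  refine eq_on_polynomial_of_leibniz (miwaHom ε) (Φ := fun f => euler (miwaHom ε f))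
    (Ψ := fun f => ε • zExtend (miwaHom ε) (PowerSeries.mk fun j => timeDer j f))
    ?_ ?_ ?_ ?_ ?_ ?_ p
  · simp
  · intro f g
    rw [← smul_add, ← map_add]
    congr 2
    ext1 j
    simp
  · intro f g
    rw [map_mul, euler_mul]
  · intro f g
    have h : (PowerSeries.mk fun j => timeDer j (f * g)) =
        (PowerSeries.mk fun j => timeDer j f) * PowerSeries.C g +
          PowerSeries.C f * PowerSeries.mk fun j => timeDer j g := by
      ext1 j
      simp [PowerSeries.coeff_mul_C, add_comm, mul_comm]
    rw [h, map_add, map_mul, map_mul, zExtend_C, zExtend_C, smul_add, smul_mul_assoc,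
      mul_smul_comm]
  · intro c
    have h : (PowerSeries.mk fun j => timeDer j (C c : TimeFun)) = 0 := by
      ext1 j
      simp [timeDer_C]
    rw [miwaHom_C, euler_C, h, map_zero, smul_zero]
  · intro i
    have h : (PowerSeries.mk fun j => timeDer j (X i : TimeFun)) =
        PowerSeries.X ^ (i : ℕ) := by
      ext1 j
      rw [PowerSeries.coeff_mk, PowerSeries.coeff_X_pow]
      rcases j with _ | j
      · rw [if_neg i.pos.ne]
        rfl
      · simp only [timeDer_succ, pderiv_X, Pi.single_apply]
        congr 1
        rw [eq_iff_iff, eq_comm, ← PNat.coe_inj]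
        simp
    have hi : ((i : ℕ) : ℂ) ≠ 0 := Nat.cast_ne_zero.2 i.ne_zero
    rw [h, map_pow, zExtend_X, miwaHom_X, map_add, euler_C, zero_add, euler_mul, euler_C]
    ext1 k
    rw [zero_mul, zero_add, PowerSeries.coeff_C_mul, coeff_euler, map_zsmul,
      PowerSeries.coeff_X_pow]
    split_ifs with hk
    · subst hk
      rw [zsmul_one, nsmul_one, ← map_natCast C, ← map_mul, div_mul_cancel₀ _ hi, map_intCast]
    · simp

theorem isMiwaShift_miwaHom (ε : ℤ) : IsMiwaShift timeDer ε (miwaHom ε) where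
  D_zero := rfl
  D_comm := timeDer_comm
  coeff_zero f := by
    refine IsLocal.ext (isLocal_coeff_miwaHom _ 0) (Ψ := fun f => f)
      (fun e => ⟨{e}, fun f g h => h e (Finset.mem_singleton_self e)⟩) (fun p => ?_) f
    induction p using MvPolynomial.induction_on with
    | C c => simp [miwaHom_C]
    | add p q hp hq => simp_all
    | mul_X p i hp =>
      rw [PowerSeries.coeff_zero_eq_constantCoeff_apply] at hp ⊢
      rw [MvPolynomial.coe_mul, map_mul, map_mul, hp]
      simp [miwaHom_X]
  euler_eq k f := by
    have h1 : IsLocal fun f : TimeFun => k • PowerSeries.coeff k (miwaHom ε f) := by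
      simpa using isLocal_smul k (isLocal_coeff_miwaHom ε k)
    refine IsLocal.ext h1 (isLocal_smul ε (IsLocal.sum _ fun (p : ℕ × ℕ) _ =>
      (isLocal_coeff_miwaHom ε p.1).comp (isLocal_timeDer p.2))) (fun p => ?_) f
    have h := congrArg (PowerSeries.coeff k) (euler_miwaHom ε p)
    rw [coeff_euler, map_zsmul, coeff_zExtend] at h
    simpa using h

/-- A tau-function of a multiplicative cocycle of the Miwa shifts. -/
theorem exists_miwa_sq_eq {r : PowerSeries TimeFun} (hr0 : PowerSeries.coeff 0 r = 1)
    (hsymm : swap (PowerSeries.C r * PowerSeries.map (miwaHom (-1)) r) =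
      PowerSeries.C r * PowerSeries.map (miwaHom (-1)) r) :
    ∃ τ : TimeFun, IsUnit τ ∧ miwaHom (-1) τ ^ 2 = PowerSeries.C τ ^ 2 * r := by
  have hT : IsMiwaShift timeDer (-1) (miwaHom (-1)) := by simpa using isMiwaShift_miwaHom (-1)
  have hT' : IsMiwaShift timeDer 1 (miwaHom 1) := by simpa using isMiwaShift_miwaHom 1
  have hr : IsUnit r := by
    rw [PowerSeries.isUnit_iff_constantCoeff, ← PowerSeries.coeff_zero_eq_constantCoeff_apply, hr0]
    exact isUnit_one
  obtain ⟨f, hf, hrf⟩ := exists_closed_of_cocycle hT hT' hr hsymm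
  have hf0 : PowerSeries.coeff 0 f = 0 := by
    have h := congrArg (PowerSeries.coeff 0) hrf
    simp only [PowerSeries.coeff_zero_eq_constantCoeff_apply] at h hr0 ⊢
    rw [map_neg, map_mul, hr0, mul_one, ← PowerSeries.coeff_zero_eq_constantCoeff_apply,
      ← PowerSeries.coeff_zero_eq_constantCoeff_apply, coeff_euler, coeff_zExtend] at h
    simpa [hT.coeff_zero, eq_comm] using h
  -- The factor 1/2 appears because r is the square of the ratio of tau-functions, and f is the
  -- differential of log τ².
  obtain ⟨g, hg⟩ := exists_pderiv_eq
    (f := fun j : ℕ+ => (C (1 / 2 : ℂ) : TimeFun) * PowerSeries.coeff j f) fun i j => by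
      simp only [Derivation.leibniz, pderiv_C, smul_zero, add_zero, ← timeDer_coe, hf (i : ℕ) j]
  refine ⟨expSeries g, ?_, miwa_sq_of_log_deriv hT hr0 hf0 hrf fun j => ?_⟩
  · exact IsUnit.of_mul_eq_one _ (expSeries_mul_expSeries_neg g)
  · rcases j with _ | j
    · rw [hf0, hT.D_zero]
      simp
    · have h := timeDer_coe j.succPNat (expSeries g)
      rw [pderiv_expSeries, hg, Nat.succPNat_coe] at h
      rw [Nat.succ_eq_add_one] at h
      rw [h]
      have h2 : (2 : TimeFun) * C (1 / 2 : ℂ) = 1 := by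
        rw [← map_ofNat (C : ℂ →+* TimeFun) 2, ← map_mul]
        norm_num
      linear_combination PowerSeries.coeff (j + 1) f * expSeries g * h2

end Miwa

end CToda

end

noncomputable section

namespace CToda

/-! ### Solving the recursion in x along orbits of the shift. -/

section Orbits

variable {η : ℂ} {D : ShiftDomain η}

theorem ShiftDomain.shift_injective_left (hη : η ≠ 0) (x : D.Pt) :
    Function.Injective fun n : ℤ => D.shift n x := by
  intro m n h
  have h1 : (x : ℂ) + m * η = x + n * η := congrArg Subtype.val h
  exact_mod_cast mul_right_cancel₀ hη (add_left_cancel h1)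

/-- A property of group-valued functions that is compatible with the recursion
`τ(x + η) = u(x) τ(x)` can be satisfied together with the recursion. -/
theorem exists_solution_of_recursion (hη : η ≠ 0) {G : Type*} [Group G] (u : D.Pt → G)
    (Q : D.Pt → G → Prop) (hQ : ∀ x g, Q (D.shift 1 x) (u x * g) ↔ Q x g)
    (hex : ∀ x, ∃ g, Q x g) :
    ∃ τ : D.Pt → G, (∀ x, Q x (τ x)) ∧ ∀ x, τ (D.shift 1 x) = u x * τ x := by
  -- As a permutation of pairs (point, value) the recursion can be iterated in both directions.
  let F : Equiv.Perm (D.Pt × G) :=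
    { toFun := fun p => (D.shift 1 p.1, u p.1 * p.2)
      invFun := fun p => (D.shift (-1) p.1, (u (D.shift (-1) p.1))⁻¹ * p.2)
      left_inv := fun p => by simp
      right_inv := fun p => by simp }
  have hF : ∀ p, F p = (D.shift 1 p.1, u p.1 * p.2) := fun _ => rfl
  have hF' : ∀ p, F⁻¹ p = (D.shift (-1) p.1, (u (D.shift (-1) p.1))⁻¹ * p.2) := fun _ => rfl
  have hFn : ∀ (n : ℤ) p, ((F ^ n) p).1 = D.shift n p.1 ∧
      (Q ((F ^ n) p).1 ((F ^ n) p).2 ↔ Q p.1 p.2) := by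
    intro n p
    induction n with
    | zero => simp
    | succ n ih =>
      rw [add_comm, zpow_add, zpow_one, Equiv.Perm.mul_apply, hF]
      refine ⟨?_, (hQ _ _).trans ih.2⟩
      rw [ih.1, D.shift_shift, add_comm]
    | pred n ih =>
      rw [sub_eq_neg_add, zpow_add, zpow_neg_one, Equiv.Perm.mul_apply, hF']
      refine ⟨?_, ?_⟩
      · rw [ih.1, D.shift_shift, add_comm]
      · rw [← ih.2, ← hQ]
        simp
  let S : Setoid D.Pt :=
    { r := fun x y => ∃ n : ℤ, D.shift n x = y
      iseqv :=
        { refl := fun x => ⟨0, D.shift_zero x⟩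
          symm := by
            rintro x _ ⟨n, rfl⟩
            exact ⟨-n, by simp⟩
          trans := by
            rintro x _ _ ⟨n, rfl⟩ ⟨m, rfl⟩
            exact ⟨n + m, by simp [add_comm]⟩ } }
  have hout : ∀ x : D.Pt, ∃ n : ℤ, D.shift n (Quotient.mk S x).out = x := fun x =>
    Quotient.mk_out (s := S) x
  choose n hn using hout
  choose g hg using hex
  -- `b x` is the base point of the orbit of x. The number n x of steps from it is unique because η
  -- ≠ 0.
  let b : D.Pt → D.Pt := fun x => (Quotient.mk S x).out
  have hb : ∀ x, b (D.shift 1 x) = b x := fun x =>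
    congrArg Quotient.out (Quotient.sound (s := S) (S.symm ⟨1, rfl⟩))
  have hn1 : ∀ x, n (D.shift 1 x) = 1 + n x := fun x => by
    apply D.shift_injective_left hη (b x)
    calc D.shift (n (D.shift 1 x)) (b x) = D.shift (n (D.shift 1 x)) (b (D.shift 1 x)) := by
          rw [hb]
      _ = D.shift 1 x := hn _
      _ = D.shift 1 (D.shift (n x) (b x)) := by rw [hn x]
      _ = D.shift (1 + n x) (b x) := by rw [D.shift_shift, add_comm]
  have hfst : ∀ x, ((F ^ n x) (b x, g (b x))).1 = x := fun x =>
    ((hFn (n x) _).1).trans (hn x)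
  refine ⟨fun x => ((F ^ n x) (b x, g (b x))).2, fun x => ?_, fun x => ?_⟩
  · have h := ((hFn (n x) (b x, g (b x))).2).2 (hg (b x))
    rwa [hfst] at h
  · dsimp only
    rw [hb, hn1, zpow_add, zpow_one, Equiv.Perm.mul_apply, hF, hfst]

end Orbits

/-! ### Formal wave functions and the tau-function. -/

section WaveFunctions

open MvPowerSeries

theorem coeff_ofSeries (f : PowerSeries TimeFun) (μ : ℕ+ →₀ ℕ) :
    coeff μ (ofSeries f) = HahnSeries.ofPowerSeries ℂ ℂ
      (PowerSeries.mk fun s => coeff μ (PowerSeries.coeff s f)) := rfl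

theorem coeff_ofTime (f : TimeFun) (μ : ℕ+ →₀ ℕ) :
    coeff μ (ofTime f) = HahnSeries.C (coeff μ f) := by
  rw [ofTime, coeff_map]

theorem ofSeries_C (f : TimeFun) : ofSeries (PowerSeries.C f) = ofTime f := by
  classical
  ext1 μ
  rw [coeff_ofSeries, coeff_ofTime, ← HahnSeries.ofPowerSeries_C]
  congr 1
  ext1 s
  rw [PowerSeries.coeff_mk, PowerSeries.coeff_C, PowerSeries.coeff_C]
  split_ifs <;> simp

theorem ofSeries_X : ofSeries PowerSeries.X = kPow (-1) := by
  classical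
  ext1 μ
  rw [coeff_ofSeries, kPow, coeff_C]
  split_ifs with h
  · rw [neg_neg, ← HahnSeries.ofPowerSeries_X]
    congr 1
    ext1 s
    rw [PowerSeries.coeff_mk, PowerSeries.coeff_X, PowerSeries.coeff_X]
    split_ifs <;> simp [h]
  · rw [← map_zero (HahnSeries.ofPowerSeries ℂ ℂ)]
    congr 1
    ext1 s
    rw [PowerSeries.coeff_mk, PowerSeries.coeff_X]
    split_ifs <;> simp [h, coeff_one]

/-- The map `ofSeries` as a ring homomorphism. -/
def ofSeriesHom : PowerSeries TimeFun →+* WaveFun where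
  toFun := ofSeries
  map_one' := by
    rw [← map_one PowerSeries.C, ofSeries_C, ofTime, map_one]
  map_zero' := by
    rw [← map_zero PowerSeries.C, ofSeries_C, ofTime, map_zero]
  map_add' f g := by
    ext1 μ
    rw [map_add, coeff_ofSeries, coeff_ofSeries, coeff_ofSeries, ← map_add]
    rfl
  map_mul' f g := by
    classical
    ext1 μ
    rw [coeff_mul]
    simp only [coeff_ofSeries]
    rw [← Finset.sum_congr rfl fun p _ => map_mul _ _ _, ← map_sum]
    congr 1
    ext1 s
    simp only [PowerSeries.coeff_mk, map_sum, PowerSeries.coeff_mul, coeff_mul]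
    rw [Finset.sum_comm]

@[simp]
theorem ofSeriesHom_apply (f : PowerSeries TimeFun) : ofSeriesHom f = ofSeries f := rfl

theorem kPow_add (α β : ℂ) : kPow (α + β) = kPow α * kPow β := by
  rw [kPow, kPow, kPow, ← map_mul, HahnSeries.single_mul_single, neg_add, mul_one]

/-- The branch is fixed by the series b/p, which has constant term 1. -/
theorem isSqrtWithLeading_of_sq {e : WaveFun} {b p d : PowerSeries TimeFun}
    (h : b ^ 2 = d) (hp : IsUnit p)
    (h0 : PowerSeries.constantCoeff b = PowerSeries.constantCoeff p) :
    IsSqrtWithLeading (e * ofSeriesHom b) (e ^ 2 * ofSeriesHom d) (e * ofSeriesHom p) := by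
  obtain ⟨q, hq⟩ := hp.exists_right_inv
  refine ⟨by rw [mul_pow, ← map_pow, h], b * q, ?_, ?_⟩
  · rw [map_mul, h0, ← map_mul, hq, map_one]
  · rw [mul_assoc, ← ofSeriesHom_apply, ← map_mul]
    congr 2
    linear_combination -b * hq

end WaveFunctions

section TauFunction

open PowerSeries

variable {η : ℂ} {D : ShiftDomain η} {w v : LowerOp D TimeFun} {A : ℕ → LowerOp D TimeFun}

theorem isMiwaShift_miwaHom_one : IsMiwaShift timeDer 1 (miwaHom 1) := by
  simpa using isMiwaShift_miwaHom 1

theorem isMiwaShift_miwaHom_neg_one : IsMiwaShift timeDer (-1) (miwaHom (-1)) := by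
  simpa using isMiwaShift_miwaHom (-1)

theorem mul_inv_of_isUnit {ι : Type*} {τ : ι → TimeFun} (hτ : ∀ x, IsUnit (τ x)) (x : ι) :
    τ x * (τ x)⁻¹ = 1 :=
  MvPowerSeries.mul_inv_cancel _ ((hτ x).map MvPowerSeries.constantCoeff).ne_zero

theorem constantCoeff_miwaHom (ε : ℤ) (f : TimeFun) :
    constantCoeff (miwaHom ε f) = f := by
  rw [← coeff_zero_eq_constantCoeff_apply]
  exact (isMiwaShift_miwaHom ε).coeff_zero f

namespace IsSymmetricDressing

/-- The cocycle gives some τ at each point separately. By `cocycle_shift` its defining equation is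
carried along by τ(x+η) = v_0(x) τ(x), so both can be imposed at once. -/
theorem exists_tau (hη : η ≠ 0) (h : IsSymmetricDressing timeDer w v A) :
    ∃ τ : D.Pt → TimeFun, (∀ x, IsUnit (τ x)) ∧ (∀ x, τ (D.shift 1 x) = v.toOp 0 x * τ x) ∧
      ∀ x, miwaHom (-1) (τ x) ^ 2 = C (τ x) ^ 2 * cocycle w v x := by
  let u : D.Pt → TimeFunˣ := fun x =>
    ⟨v.toOp 0 x, w.toOp 0 x, by rw [mul_comm]; exact h.w_mul_v_zero x, h.w_mul_v_zero x⟩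
  have hQ : ∀ x (g : TimeFunˣ), miwaHom (-1) ((u x * g : TimeFunˣ) : TimeFun) ^ 2 =
      C ((u x * g : TimeFunˣ) : TimeFun) ^ 2 * cocycle w v (D.shift 1 x) ↔
      miwaHom (-1) (g : TimeFun) ^ 2 = C (g : TimeFun) ^ 2 * cocycle w v x := by
    intro x g
    have h1 := h.cocycle_shift isMiwaShift_miwaHom_neg_one x
    have h2 : IsUnit (miwaHom (-1) (v.toOp 0 x) ^ 2) := ((u x).isUnit.map (miwaHom (-1))).pow 2
    rw [Units.val_mul, map_mul, map_mul]
    change (miwaHom (-1) (v.toOp 0 x) * _) ^ 2 = (C (v.toOp 0 x) * _) ^ 2 * _ ↔ _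
    rw [← h2.mul_right_inj (b := miwaHom (-1) (g : TimeFun) ^ 2)]
    constructor <;> intro h3
    · linear_combination h3 + C (g : TimeFun) ^ 2 * h1
    · linear_combination h3 - C (g : TimeFun) ^ 2 * h1
  have hex : ∀ x, ∃ g : TimeFunˣ,
      miwaHom (-1) (g : TimeFun) ^ 2 = C (g : TimeFun) ^ 2 * cocycle w v x := by
    intro x
    obtain ⟨t, ht, ht'⟩ := exists_miwa_sq_eq (h.coeff_zero_cocycle x)
      (h.cocycle_symm isMiwaShift_miwaHom_neg_one x)
    exact ⟨ht.unit, ht'⟩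
  obtain ⟨τ, hτ, hτ'⟩ := exists_solution_of_recursion hη u _ hQ hex
  exact ⟨fun x => τ x, fun x => (τ x).isUnit, fun x => congrArg Units.val (hτ' x), hτ⟩

theorem squareSum_eq_of_tau (h : IsSymmetricDressing timeDer w v A) {τ : D.Pt → TimeFun}
    (hτu : ∀ x, IsUnit (τ x)) (hτ' : ∀ x, miwaHom (-1) (τ x) ^ 2 = C (τ x) ^ 2 * cocycle w v x)
    (x : D.Pt) :
    squareSum w x = (C (w.toOp 0 x) * (miwaHom (-1) (τ x) * C (τ x)⁻¹)) ^ 2 := by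
  have h1 := hτ' x
  have h2 : C (τ x) * C (τ x)⁻¹ = 1 := by rw [← map_mul, mul_inv_of_isUnit hτu, map_one]
  have h3 : C (w.toOp 0 x) * C (v.toOp 0 x) = 1 := by rw [← map_mul, h.w_mul_v_zero, map_one]
  have h4 : C (τ x) * C (τ x)⁻¹ * (C (w.toOp 0 x) * C (v.toOp 0 x)) = 1 := by
    rw [h2, h3, mul_one]
  rw [cocycle] at h1
  linear_combination -(C (w.toOp 0 x) * C (τ x)⁻¹) ^ 2 * h1 -
    squareSum w x * (C (τ x) * C (τ x)⁻¹ * (C (w.toOp 0 x) * C (v.toOp 0 x)) + 1) * h4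

/-- This is the telescoping β(x)² = F(x) − z²F(x−η) with F expressed through τ. -/
theorem amplitude_sq (h : IsSymmetricDressing timeDer w v A) {τ : D.Pt → TimeFun}
    (hτu : ∀ x, IsUnit (τ x)) (hτ' : ∀ x, miwaHom (-1) (τ x) ^ 2 = C (τ x) ^ 2 * cocycle w v x)
    (x : D.Pt) :
    amplitude w x ^ 2 = (C (w.toOp 0 x) * (miwaHom (-1) (τ x) * C (τ x)⁻¹)) ^ 2 -
      X ^ 2 * (C (w.toOp 0 (D.shift (-1) x)) *
        (miwaHom (-1) (τ (D.shift (-1) x)) * C (τ (D.shift (-1) x))⁻¹)) ^ 2 := by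
  rw [← h.squareSum_eq_of_tau hτu hτ', ← h.squareSum_eq_of_tau hτu hτ', squareSum_eq w x]
  ring

/-- In b̃²F = 1 − z²e² the amplitude is taken at t − [z]. The opposite shift brings it back to t and
turns τ(t−[z])/τ(t) into τ(t)/τ(t+[z]); division by F then gives the claim. -/
theorem adjointAmplitude_sq (h : IsSymmetricDressing timeDer w v A) {τ : D.Pt → TimeFun}
    (hτu : ∀ x, IsUnit (τ x)) (hτ : ∀ x, τ (D.shift 1 x) = v.toOp 0 x * τ x)
    (hτ' : ∀ x, miwaHom (-1) (τ x) ^ 2 = C (τ x) ^ 2 * cocycle w v x) (x : D.Pt) :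
    adjointAmplitude v x ^ 2 = (miwaHom 1 (τ (D.shift 1 x)) * C (τ x)⁻¹) ^ 2 -
      X ^ 2 * (miwaHom 1 (τ (D.shift 1 (D.shift 1 x))) * C (τ (D.shift 1 x))⁻¹) ^ 2 := by
  have hinv := mul_inv_of_isUnit hτu
  have hw : ∀ y, w.toOp 0 y * v.toOp 0 y = 1 := h.w_mul_v_zero
  have hj : (τ (D.shift 1 x))⁻¹ = w.toOp 0 x * (τ x)⁻¹ := by
    have h1 := hinv (D.shift 1 x)
    rw [hτ x] at h1 ⊢
    linear_combination w.toOp 0 x * (τ x)⁻¹ * h1 -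
      (v.toOp 0 x * τ x)⁻¹ * (hw x + w.toOp 0 x * v.toOp 0 x * hinv x)
  have hZ : ∀ f : PowerSeries TimeFun, zExtend (miwaHom 1) (zExtend (miwaHom (-1)) f) = f :=
    isMiwaShift_miwaHom_neg_one.zExtend_zExtend (by simpa using isMiwaShift_miwaHom_one)
  have hZT : ∀ f : TimeFun, zExtend (miwaHom 1) (miwaHom (-1) f) = C f := fun f => by
    rw [← zExtend_C (miwaHom (-1)), hZ]
  have h1 := congrArg (zExtend (miwaHom 1))
    (h.adjointAmplitude_sq_mul_squareSum isMiwaShift_miwaHom_neg_one x)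
  rw [h.squareSum_eq_of_tau hτu hτ'] at h1
  simp only [map_sub, map_mul, map_pow, map_one, hZ, hZT, zExtend_C, zExtend_X] at h1
  have h2 : miwaHom 1 (w.toOp 0 x) * miwaHom 1 (v.toOp 0 x) = 1 := by rw [← map_mul, hw, map_one]
  have h3 : miwaHom 1 (τ x) * miwaHom 1 (τ x)⁻¹ = 1 := by rw [← map_mul, hinv, map_one]
  have h4 : C (τ x) * C (τ x)⁻¹ = 1 := by rw [← map_mul, hinv, map_one]
  rw [hj, hτ (D.shift 1 x), hτ x, map_mul, map_mul, map_mul, map_mul]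
  set B := adjointAmplitude v x
  set W := miwaHom 1 (w.toOp 0 x)
  set V := miwaHom 1 (v.toOp 0 x)
  set t := miwaHom 1 (τ x)
  set i := miwaHom 1 (τ x)⁻¹
  have h5 : W * (C (τ x) * i) * (V * t * C (τ x)⁻¹) = 1 := by
    linear_combination C (τ x) * i * t * C (τ x)⁻¹ * h2 + t * i * h4 + h3
  linear_combination (V * t * C (τ x)⁻¹) ^ 2 * h1 -
    B ^ 2 * (W * (C (τ x) * i) * (V * t * C (τ x)⁻¹) + 1) * h5

/-- By `hW` and `hWb`, β and b are e^{−φ/2} times the amplitudes of ψ at infinity and at zero. -/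
theorem exists_isCTodaTau (hη : η ≠ 0) (h : IsSymmetricDressing timeDer w v A)
    {φ : D.Pt → TodaFun} {W Wb : DiffOp D TodaFun}
    (hv : ∀ x, v.toOp 0 x = expSeries ((1 / 2 : ℂ) • restrict (φ x)))
    (hW : ∀ (s : ℕ) x, restrict (W (-(s : ℤ)) x) = v.toOp 0 x * w.toOp (-(s : ℤ)) x)
    (hWb : ∀ (s : ℕ) x, restrict (Wb s x) = v.toOp 0 x * v.toOp (-(s : ℤ)) (D.shift s x)) :
    ∃ τ, IsCTodaTau φ W Wb τ := by
  obtain ⟨τ, hτu, hτ, hτ'⟩ := h.exists_tau hη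
  have hinv := mul_inv_of_isUnit hτu
  have hinvu : ∀ x, IsUnit (C (τ x)⁻¹) := fun x =>
    (IsUnit.of_mul_eq_one _ ((mul_comm _ _).trans (hinv x))).map C
  have hw : ∀ x, w.toOp 0 x = expSeries (-((1 / 2 : ℂ) • restrict (φ x))) := fun x => by
    have h1 := h.w_mul_v_zero x
    have h2 := expSeries_mul_expSeries_neg ((1 / 2 : ℂ) • restrict (φ x))
    rw [← hv] at h2
    linear_combination expSeries (-((1 / 2 : ℂ) • restrict (φ x))) * h1 - w.toOp 0 x * h2
  refine ⟨τ, hτu, fun x => ?_, fun x => ?_, fun x => ?_⟩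
  · rw [hτ, ← expSeries_half_sq, ← hv]
    linear_combination -v.toOp 0 x ^ 2 * (τ x * (τ x)⁻¹ + 1) * hinv x
  · have hp : IsUnit (C (w.toOp 0 x) * (miwaHom (-1) (τ x) * C (τ x)⁻¹)) :=
      ((IsUnit.of_mul_eq_one _ (h.w_mul_v_zero x)).map C).mul
        (((hτu x).map (miwaHom (-1))).mul (hinvu x))
    have hchi : ∀ y, chi (fun z => restrict (φ z)) τ y = kPow ((y : ℂ) / η) * expXi 1 *
        ofSeriesHom (C (w.toOp 0 y) * (miwaHom (-1) (τ y) * C (τ y)⁻¹)) := fun y => by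
      rw [chi, map_mul, map_mul, ofSeriesHom_apply, ofSeriesHom_apply, ofSeriesHom_apply,
        ofSeries_C, ofSeries_C, miwaHom_apply, hw]
      ring
    refine ⟨kPow ((x : ℂ) / η) * expXi 1 * ofSeriesHom (amplitude w x), ?_, ?_⟩
    · have h1 := isSqrtWithLeading_of_sq (e := kPow ((x : ℂ) / η) * expXi 1)
        (h.amplitude_sq hτu hτ' x) hp ?_
      · rw [map_sub, map_mul, map_pow, map_pow, map_pow] at h1
        rw [hchi, hchi]
        convert h1 using 1
        -- The shift of x in k^{x/η} produces k⁻¹ = z, hence the factor z² in front of the second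
        -- square.
        have h2 : kPow (((D.shift (-1) x : D.Pt) : ℂ) / η) = kPow ((x : ℂ) / η) * kPow (-1) := by
          rw [← kPow_add]
          congr 1
          simp only [ShiftDomain.shift]
          field_simp
          push_cast
          ring
        rw [h2, ofSeriesHom_apply X, ofSeries_X]
        ring
      · have h2 := constantCoeff_miwaHom (-1) (τ x)
        rw [Int.cast_neg, Int.cast_one] at h2
        rw [map_mul, map_mul, constantCoeff_C, constantCoeff_C, h2, hinv, mul_one,
          ← coeff_zero_eq_constantCoeff_apply, amplitude, coeff_mk]
        rfl
    · rw [psi, ← hv, ← ofSeries_C, ← ofSeriesHom_apply, ← ofSeriesHom_apply, mul_left_comm,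
        ← map_mul]
      congr 2
      ext1 s
      rw [coeff_mk, coeff_C_mul, hW, amplitude, coeff_mk]
  · have hp : IsUnit (miwaHom 1 (τ (D.shift 1 x)) * C (τ x)⁻¹) :=
      ((hτu _).map (miwaHom 1)).mul (hinvu x)
    have hchi : ∀ y, chiBar τ y = kPow (-((y : ℂ) / η)) * expXi (-1) *
        ofSeriesHom (miwaHom 1 (τ (D.shift 1 y)) * C (τ y)⁻¹) := fun y => by
      rw [chiBar, map_mul, ofSeriesHom_apply, ofSeriesHom_apply, ofSeries_C, miwaHom_apply]
    refine ⟨kPow (-((x : ℂ) / η)) * expXi (-1) * ofSeriesHom (adjointAmplitude v x), ?_, ?_⟩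
    · have h1 := isSqrtWithLeading_of_sq (e := kPow (-((x : ℂ) / η)) * expXi (-1))
        (h.adjointAmplitude_sq hτu hτ hτ' x) hp ?_
      · rw [map_sub, map_mul, map_pow, map_pow, map_pow] at h1
        rw [hchi, hchi]
        convert h1 using 1
        have h2 : kPow (-(((D.shift 1 x : D.Pt) : ℂ) / η)) =
            kPow (-((x : ℂ) / η)) * kPow (-1) := by
          rw [← kPow_add]
          congr 1
          simp only [ShiftDomain.shift]
          field_simp
          push_cast
          ring
        rw [h2, ofSeriesHom_apply X, ofSeries_X]
        ring
      · have h2 := constantCoeff_miwaHom 1 (τ (D.shift 1 x))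
        rw [Int.cast_one] at h2
        rw [map_mul, constantCoeff_C, h2, hτ, mul_assoc, hinv, mul_one,
          ← coeff_zero_eq_constantCoeff_apply, adjointAmplitude, coeff_mk]
        simp
    · rw [psiInv, ← hv, ← ofSeries_C, ← ofSeriesHom_apply, ← ofSeriesHom_apply, mul_left_comm,
        ← map_mul]
      congr 2
      ext1 s
      rw [coeff_mk, coeff_C_mul, hWb, adjointAmplitude, coeff_mk]

end IsSymmetricDressing

end TauFunction

end CToda

end

noncomputable section

namespace CToda

/-! ### Toda operators on the slice and the symmetric gauge. -/

section Slice

variable {η : ℂ} {D : ShiftDomain η}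

/-- The derivation with respect to one of the times of the 2D Toda lattice hierarchy. -/
def todaDer (i : ℕ+ ⊕ ℕ+) : IntDerivation TodaFun :=
  intDerivation (MvPowerSeries.pderiv ℂ i : TodaFun →ₗ[ℂ] TodaFun).toAddMonoidHom
    fun f g => (MvPowerSeries.pderiv ℂ i).leibniz f g

theorem todaDer_apply (i : ℕ+ ⊕ ℕ+) (f : TodaFun) :
    todaDer i f = MvPowerSeries.pderiv ℂ i f := rfl

/-- Restriction to the slice as a ring homomorphism of operators. -/
def sliceHom : LowerOp D TodaFun →+* LowerOp D TimeFun := LowerOp.mapHom restrictHom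

theorem sliceHom_apply (A : LowerOp D TodaFun) (n : ℤ) (x : D.Pt) :
    (sliceHom A).toOp n x = restrict (A.toOp n x) := by
  rw [sliceHom, LowerOp.mapHom_apply, restrictHom_apply]

theorem der_sliceHom (m : ℕ+) (A : LowerOp D TodaFun) :
    LowerOp.der (timeDer m) (sliceHom A) =
      sliceHom (LowerOp.der (todaDer (Sum.inl m)) A) -
        sliceHom (LowerOp.der (todaDer (Sum.inr m)) A) := by
  refine LowerOp.ext fun n x => ?_
  rw [LowerOp.der_apply, LowerOp.toOp_sub, Pi.sub_apply, Pi.sub_apply, sliceHom_apply,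
    sliceHom_apply, sliceHom_apply, timeDer_coe, pderiv_restrict]
  rfl

/-- L̄ is bounded below and lies outside `LowerOp` in general, so its powers are treated through the
adjoint. -/
theorem DiffOp.adjoint_pow {R : Type} [CommRing R] (A : DiffOp D R) {M : LowerOp D R}
    (hM : M.toOp = A.adjoint) (m : ℕ) : (A.pow m).adjoint = (M ^ m).toOp := by
  induction m with
  | zero =>
    rw [DiffOp.pow, DiffOp.adjoint_shiftOp, neg_zero, pow_zero, LowerOp.toOp_one]
  | succ m ih =>
    rw [DiffOp.pow, DiffOp.adjoint_comp, ih, ← hM, pow_succ', LowerOp.toOp_mul]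

theorem LowerOp.mul_apply_zero {R : Type} [CommRing R] {A B : LowerOp D R}
    (hA : A.toOp.OrderLE 0) (hB : B.toOp.OrderLE 0) (x : D.Pt) :
    (A * B).toOp 0 x = A.toOp 0 x * B.toOp 0 x := by
  rw [LowerOp.mul_apply A B hA hB 0 x (l := 0) (by omega) le_rfl]
  simp

variable {L Lb W Wb : DiffOp D TodaFun} {φ : D.Pt → TodaFun}

theorem IsTodaSolution.orderLE_L (h : IsTodaSolution L Lb φ) : L.OrderLE 1 := h.L_top

theorem IsTodaSolution.orderLE_adjoint (h : IsTodaSolution L Lb φ) : Lb.adjoint.OrderLE 1 :=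
  fun n hn x => h.Lb_bot (-n) (by omega) _

theorem IsWavePair.orderLE_W (h : IsWavePair L Lb φ W Wb) : W.OrderLE 0 := h.W_top

theorem IsWavePair.orderLE_adjoint (h : IsWavePair L Lb φ W Wb) : Wb.adjoint.OrderLE 0 :=
  fun n hn x => h.Wb_bot (-n) (by omega) _

theorem orderLE_genB (h : IsTodaSolution L Lb φ) (m : ℕ+) : (genB L m).OrderLE m := by
  intro n hn x
  have h1 : ∀ k : ℕ, (L.pow k).OrderLE k := fun k => by
    induction k with
    | zero => exact fun n hn x => if_neg (by omega)
    | succ k ih => exact (ih.comp h.orderLE_L).mono (by push_cast; rfl)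
  simp only [genB, DiffOp.nonnegPart]
  rw [h1 m n hn]
  simp

theorem orderLE_adjoint_genB (m : ℕ+) : (genB L m).adjoint.OrderLE 0 := by
  intro n hn x
  simp only [genB, DiffOp.nonnegPart, DiffOp.adjoint]
  rw [if_neg (by omega)]

theorem orderLE_genBbar (m : ℕ+) : (genBbar Lb m).OrderLE 0 := by
  intro n hn x
  simp only [genBbar, DiffOp.negPart]
  rw [if_neg (by omega)]

theorem orderLE_adjoint_genBbar (h : IsTodaSolution L Lb φ) (m : ℕ+) :
    (genBbar Lb m).adjoint.OrderLE m := by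
  intro n hn x
  have h1 : ∀ k : ℕ, ((LowerOp.of _ h.orderLE_adjoint) ^ k).toOp.OrderLE k := fun k => by
    induction k with
    | zero => exact fun n hn x => if_neg (by omega)
    | succ k ih =>
      rw [pow_succ]
      exact (ih.comp h.orderLE_adjoint).mono (by push_cast; rfl)
  have h2 := h1 m n hn x
  rw [← DiffOp.adjoint_pow Lb rfl] at h2
  simp only [genBbar, DiffOp.negPart, DiffOp.adjoint] at h2 ⊢
  rw [h2, ite_self]

end Slice

/-- The function `e^{φ/2}` on the slice. -/
def gauge {X : Type*} (φ : X → TodaFun) (x : X) : TimeFun :=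
  expSeries ((1 / 2 : ℂ) • restrict (φ x))

/-- The function `e^{-φ/2}` on the slice. -/
def gaugeInv {X : Type*} (φ : X → TodaFun) (x : X) : TimeFun :=
  expSeries (-((1 / 2 : ℂ) • restrict (φ x)))

section Gauge

variable {η : ℂ} {D : ShiftDomain η} {L Lb W Wb : DiffOp D TodaFun} {φ : D.Pt → TodaFun}

theorem gauge_mul_gaugeInv (x : D.Pt) : gauge φ x * gaugeInv φ x = 1 :=
  expSeries_mul_expSeries_neg _

theorem restrict_gauge (x : D.Pt) :
    restrict (expSeries ((1 / 2 : ℂ) • φ x)) = gauge φ x := by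
  rw [restrict_expSeries, restrict_smul, gauge]

theorem restrict_gaugeInv (x : D.Pt) :
    restrict (expSeries (-((1 / 2 : ℂ) • φ x))) = gaugeInv φ x := by
  rw [restrict_expSeries, restrict_neg, restrict_smul, gaugeInv]

theorem fn_gauge_mul_gaugeInv :
    LowerOp.fn (gauge φ) * LowerOp.fn (gaugeInv φ) = (1 : LowerOp D TimeFun) := by
  rw [LowerOp.fn_mul_fn, ← LowerOp.fn_one]
  congr 1
  funext x
  exact gauge_mul_gaugeInv x

theorem fn_gaugeInv_mul_gauge :
    LowerOp.fn (gaugeInv φ) * LowerOp.fn (gauge φ) = (1 : LowerOp D TimeFun) := by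
  rw [LowerOp.fn_mul_fn, mul_comm, ← LowerOp.fn_mul_fn, fn_gauge_mul_gaugeInv]

theorem eq_conj_of_gauge {R : Type*} [CommRing R] {a b a' b' l m : R}
    (h : b' * l * a = b * m * a') (hab : a * b = 1) (hab' : a' * b' = 1) :
    l = b * (b * m) * a' * a' := by
  linear_combination a' * b * h - l * (a * b * hab' + hab)

/-- The wave operator `W^s` on the slice. -/
theorem restrictOp_symWave (h : W.OrderLE 0) : restrictOp (symWave φ W) =
    (LowerOp.fn (gaugeInv φ) * sliceHom (LowerOp.of W h)).toOp := by
  funext n x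
  rw [LowerOp.fn_mul_apply, sliceHom_apply, restrictOp, symWave, DiffOp.leftMul, restrict_mul,
    restrict_gaugeInv]
  rfl

/-- The adjoint of the wave operator `W̄^s` on the slice. -/
theorem adjoint_restrictOp_symWave (h : Wb.adjoint.OrderLE 0) :
    (restrictOp (symWave φ Wb)).adjoint =
    (sliceHom (LowerOp.of Wb.adjoint h) * LowerOp.fn (gaugeInv φ)).toOp := by
  funext n x
  rw [LowerOp.mul_fn_apply, sliceHom_apply, DiffOp.adjoint, restrictOp, symWave, DiffOp.leftMul,
    restrict_mul, restrict_gaugeInv, mul_comm]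
  rfl

/-- The C-Toda constraint on the slice. -/
theorem IsCToda.sliceHom_adjoint (hC : IsCToda L Lb φ) (hL : L.OrderLE 1)
    (hLb : Lb.adjoint.OrderLE 1) :
    sliceHom (LowerOp.of Lb.adjoint hLb) =
      LowerOp.fn (gaugeInv φ) * LowerOp.fn (gaugeInv φ) * sliceHom (LowerOp.of L hL) *
        (LowerOp.fn (gauge φ) * LowerOp.fn (gauge φ)) := by
  refine LowerOp.ext fun n x => ?_
  have h1 := congrFun (congrFun hC (-n)) (D.shift n x)
  simp only [restrictOp, symLax, DiffOp.adjoint, DiffOp.leftMul, DiffOp.rightMul, restrict_mul,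
    restrict_gauge, restrict_gaugeInv, D.shift_shift, neg_add_cancel, D.shift_zero, neg_neg] at h1
  rw [← mul_assoc, LowerOp.mul_fn_apply, LowerOp.mul_fn_apply, mul_assoc (LowerOp.fn (gaugeInv φ)),
    LowerOp.fn_mul_apply, LowerOp.fn_mul_apply, sliceHom_apply, sliceHom_apply, LowerOp.toOp_of,
    LowerOp.toOp_of, DiffOp.adjoint]
  exact eq_conj_of_gauge h1 (gauge_mul_gaugeInv x) (gauge_mul_gaugeInv _)

end Gauge

end CToda

end

noncomputable section

namespace CToda

/-! ### Antisymmetry of the generators. -/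

section GaugeAlgebra

variable {R : Type*} [CommRing R] {a b a' b' l m c : R}

theorem eq_conj_sq_of_gauge (h : a * a * l = m * (a' * a')) (hab : a * b = 1) :
    l = b ^ 2 * m * a' ^ 2 := by
  linear_combination b ^ 2 * h - l * (a * b + 1) * hab

theorem gauge_cancel_left (h1 : a * b = 1) (h2 : a' * b' = 1) :
    b * (0 - b' ^ 2 * l * a ^ 2) * a' + a * (l - 0) * b' = 0 + 0 := by
  linear_combination -a * b' * l * (a * b * h2 + h1)

theorem gauge_cancel_right (h1 : a * b = 1) (h2 : a' * b' = 1) :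
    b * (l - 0) * a' + a * (0 - b ^ 2 * l * a' ^ 2) * b' = 0 + 0 := by
  linear_combination -b * a' * l * (a * b * h2 + h1)

theorem eq_mul_of_sq_derivation [IsAddTorsionFree R] (δ : Derivation ℤ R R)
    (h : δ (a ^ 2) = a ^ 2 * c - -(a ^ 2 * (b ^ 2 * c * a ^ 2))) (hab : a * b = 1) :
    δ a = c * a := by
  have h1 : 2 • δ a = 2 • (c * a) := by
    rw [pow_two, Derivation.leibniz] at h
    simp only [smul_eq_mul, nsmul_eq_mul, Nat.cast_ofNat] at h ⊢
    linear_combination b * h - 2 * δ a * hab + c * a * hab +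
      (a ^ 3 * b ^ 2 * c + a ^ 2 * b * c + c * a) * hab
  exact nsmul_right_injective two_ne_zero h1

end GaugeAlgebra

section Generators

variable {η : ℂ} {D : ShiftDomain η} {L Lb W Wb : DiffOp D TodaFun} {φ : D.Pt → TodaFun}

/-- The operator `B_m - B̄_m` on the slice. -/
def sliceGen (hT : IsTodaSolution L Lb φ) (m : ℕ+) : LowerOp D TimeFun :=
  sliceHom (LowerOp.of _ (orderLE_genB hT m)) - sliceHom (LowerOp.of _ (orderLE_genBbar (Lb := Lb) m))

/-- The adjoint of the operator `B_m - B̄_m` on the slice. -/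
def sliceGenAdjoint (hT : IsTodaSolution L Lb φ) (m : ℕ+) : LowerOp D TimeFun :=
  sliceHom (LowerOp.of _ (orderLE_adjoint_genB (L := L) m)) -
    sliceHom (LowerOp.of _ (orderLE_adjoint_genBbar hT m))

/-- The antisymmetric generator in the symmetric gauge. -/
def symGen (hT : IsTodaSolution L Lb φ) (m : ℕ+) : LowerOp D TimeFun :=
  LowerOp.fn (gaugeInv φ) * sliceGen hT m * LowerOp.fn (gauge φ) -
    LowerOp.fn fun x => gaugeInv φ x * timeDer m (gauge φ x)

theorem IsWavePair.der_slice_W (hW : IsWavePair L Lb φ W Wb) (hT : IsTodaSolution L Lb φ) (m : ℕ+) :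
    LowerOp.der (timeDer m) (sliceHom (LowerOp.of W hW.orderLE_W)) =
      sliceGen hT m * sliceHom (LowerOp.of W hW.orderLE_W) -
        sliceHom (LowerOp.of W hW.orderLE_W) * LowerOp.shiftBy (m : ℤ) := by
  have h1 : LowerOp.der (todaDer (Sum.inl m)) (LowerOp.of W hW.orderLE_W) +
      LowerOp.of W hW.orderLE_W * LowerOp.shiftBy (m : ℤ) =
      LowerOp.of _ (orderLE_genB hT m) * LowerOp.of W hW.orderLE_W :=
    LowerOp.toOp_injective (hW.lin_t_W m)
  have h2 : LowerOp.der (todaDer (Sum.inr m)) (LowerOp.of W hW.orderLE_W) =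
      LowerOp.of _ (orderLE_genBbar (Lb := Lb) m) * LowerOp.of W hW.orderLE_W :=
    LowerOp.toOp_injective (hW.lin_tb_W m)
  rw [der_sliceHom, h2, eq_sub_of_add_eq h1, map_sub, map_mul, map_mul, map_mul, sliceGen, sub_mul,
    sliceHom, LowerOp.mapHom_shiftBy]
  abel

theorem IsWavePair.der_t_adjoint (hW : IsWavePair L Lb φ W Wb) (m : ℕ+) :
    LowerOp.der (todaDer (Sum.inl m)) (LowerOp.of _ hW.orderLE_adjoint) =
      LowerOp.of _ hW.orderLE_adjoint * LowerOp.of _ (orderLE_adjoint_genB (L := L) m) := by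
  apply LowerOp.toOp_injective
  rw [LowerOp.toOp_mul, LowerOp.toOp_of, LowerOp.toOp_of, ← DiffOp.adjoint_comp, ← hW.lin_t_Wb]
  rfl

theorem IsWavePair.der_tb_adjoint (hW : IsWavePair L Lb φ W Wb) (hT : IsTodaSolution L Lb φ)
    (m : ℕ+) : LowerOp.der (todaDer (Sum.inr m)) (LowerOp.of _ hW.orderLE_adjoint) +
        LowerOp.shiftBy (m : ℤ) * LowerOp.of _ hW.orderLE_adjoint =
      LowerOp.of _ hW.orderLE_adjoint * LowerOp.of _ (orderLE_adjoint_genBbar hT m) := by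
  apply LowerOp.toOp_injective
  rw [LowerOp.toOp_mul, LowerOp.toOp_of, LowerOp.toOp_of, ← DiffOp.adjoint_comp, ← hW.lin_tb_Wb,
    LowerOp.toOp_add, LowerOp.toOp_mul, LowerOp.toOp_shiftBy, LowerOp.toOp_of,
    ← neg_neg (m : ℤ), ← DiffOp.adjoint_shiftOp, ← DiffOp.adjoint_comp, neg_neg]
  rfl

theorem IsWavePair.der_slice_adjoint (hW : IsWavePair L Lb φ W Wb) (hT : IsTodaSolution L Lb φ)
    (m : ℕ+) : LowerOp.der (timeDer m) (sliceHom (LowerOp.of _ hW.orderLE_adjoint)) =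
      sliceHom (LowerOp.of _ hW.orderLE_adjoint) * sliceGenAdjoint hT m +
        LowerOp.shiftBy (m : ℤ) * sliceHom (LowerOp.of _ hW.orderLE_adjoint) := by
  rw [der_sliceHom, hW.der_t_adjoint, eq_sub_of_add_eq (hW.der_tb_adjoint hT m), map_sub, map_mul,
    map_mul, map_mul, sliceGenAdjoint, mul_sub, sliceHom, LowerOp.mapHom_shiftBy]
  abel

theorem IsWavePair.adjoint_mul_adjoint (hW : IsWavePair L Lb φ W Wb) (hT : IsTodaSolution L Lb φ) :
    LowerOp.of _ hW.orderLE_adjoint * LowerOp.of _ hT.orderLE_adjoint =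
      LowerOp.shiftBy 1 * LowerOp.of _ hW.orderLE_adjoint := by
  apply LowerOp.toOp_injective
  rw [LowerOp.toOp_mul, LowerOp.toOp_of, LowerOp.toOp_of, ← DiffOp.adjoint_comp, hW.dress_Lb,
    DiffOp.adjoint_comp, DiffOp.adjoint_shiftOp]
  rfl

theorem IsWavePair.adjoint_mul_adjoint_pow (hW : IsWavePair L Lb φ W Wb)
    (hT : IsTodaSolution L Lb φ) (m : ℕ) :
    LowerOp.of _ hW.orderLE_adjoint * LowerOp.of _ hT.orderLE_adjoint ^ m =
      LowerOp.shiftBy m * LowerOp.of _ hW.orderLE_adjoint := by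
  rw [← LowerOp.shiftBy_one_pow]
  exact (SemiconjBy.pow_right (a := LowerOp.of _ hW.orderLE_adjoint)
    (hW.adjoint_mul_adjoint hT) m)

/-- The constraint says that e^φ intertwines L̄† with L on the slice, and so it intertwines their
powers. -/
theorem IsCToda.sliceHom_adjoint_pow_apply (hC : IsCToda L Lb φ) (hT : IsTodaSolution L Lb φ)
    (m : ℕ) (n : ℤ) (x : D.Pt) :
    (sliceHom (LowerOp.of _ hT.orderLE_adjoint ^ m)).toOp n x =
      gaugeInv φ x ^ 2 * (sliceHom (LowerOp.of L hT.orderLE_L ^ m)).toOp n x *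
        gauge φ (D.shift n x) ^ 2 := by
  have h1 : SemiconjBy (LowerOp.fn (gauge φ) * LowerOp.fn (gauge φ) : LowerOp D TimeFun)
      (sliceHom (LowerOp.of _ hT.orderLE_adjoint)) (sliceHom (LowerOp.of L hT.orderLE_L)) := by
    rw [hC.sliceHom_adjoint hT.orderLE_L hT.orderLE_adjoint, SemiconjBy]
    simp only [mul_assoc]
    rw [← mul_assoc (LowerOp.fn (gauge φ)) (LowerOp.fn (gaugeInv φ)), fn_gauge_mul_gaugeInv,
      one_mul, ← mul_assoc (LowerOp.fn (gauge φ)) (LowerOp.fn (gaugeInv φ)), fn_gauge_mul_gaugeInv,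
      one_mul]
  have h2 := congrArg (fun A => A.toOp n x) (h1.pow_right m).eq
  simp only [LowerOp.fn_mul_fn, LowerOp.fn_mul_apply, LowerOp.mul_fn_apply, Pi.mul_apply,
    ← map_pow] at h2
  exact eq_conj_sq_of_gauge h2 (gauge_mul_gaugeInv x)

theorem IsTodaSolution.adjoint_genBbar_apply (hT : IsTodaSolution L Lb φ) (m : ℕ+) (n : ℤ)
    (x : D.Pt) : (genBbar Lb m).adjoint n x =
      if 0 < n then (LowerOp.of _ hT.orderLE_adjoint ^ (m : ℕ)).toOp n x else 0 := by
  rw [← DiffOp.adjoint_pow Lb rfl]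
  simp only [DiffOp.adjoint, genBbar, DiffOp.negPart, neg_lt_zero]

/-- The diagonal part of the linear problems. -/
theorem IsWavePair.timeDer_gauge (hW : IsWavePair L Lb φ W Wb) (hT : IsTodaSolution L Lb φ)
    (hC : IsCToda L Lb φ) (m : ℕ+) (x : D.Pt) :
    timeDer m (gauge φ x) =
      (sliceHom (LowerOp.of L hT.orderLE_L ^ (m : ℕ))).toOp 0 x * gauge φ x := by
  have hV : Wb.adjoint 0 x = expSeries (φ x) := by
    rw [DiffOp.adjoint, neg_zero, D.shift_zero, hW.Wb_lead]
  have hV' : (LowerOp.of _ hW.orderLE_adjoint).toOp.OrderLE 0 := hW.orderLE_adjoint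
  have hB' : (LowerOp.of _ (orderLE_adjoint_genB (L := L) m)).toOp.OrderLE 0 :=
    orderLE_adjoint_genB m
  have h1 : MvPowerSeries.pderiv ℂ (Sum.inl m) (expSeries (φ x)) =
      expSeries (φ x) * (LowerOp.of L hT.orderLE_L ^ (m : ℕ)).toOp 0 x := by
    have h := congrArg (fun A => A.toOp 0 x) (hW.der_t_adjoint m)
    rw [LowerOp.mul_apply_zero hV' hB', LowerOp.der_apply,
      LowerOp.toOp_of, LowerOp.toOp_of, hV, todaDer_apply] at h
    rw [h, LowerOp.toOp_pow]
    simp [DiffOp.adjoint, genB, DiffOp.nonnegPart]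
  -- By W̄†(L̄†)^m = Λ^m W̄† the linear problem reads ∂W̄† = W̄†(B̄_m† − (L̄†)^m). The last factor
  -- has order at most 0, so leading coefficients multiply.
  have h2 : MvPowerSeries.pderiv ℂ (Sum.inr m) (expSeries (φ x)) =
      -(expSeries (φ x) * (LowerOp.of _ hT.orderLE_adjoint ^ (m : ℕ)).toOp 0 x) := by
    have h := hW.der_tb_adjoint hT m
    rw [← hW.adjoint_mul_adjoint_pow hT, ← eq_sub_iff_add_eq, ← mul_sub] at h
    have hle : (LowerOp.of _ (orderLE_adjoint_genBbar hT m) -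
        LowerOp.of _ hT.orderLE_adjoint ^ (m : ℕ)).toOp.OrderLE 0 := fun n hn y => by
      rw [LowerOp.toOp_sub, Pi.sub_apply, Pi.sub_apply, LowerOp.toOp_of, hT.adjoint_genBbar_apply,
        if_pos hn, sub_self]
    have h3 := congrArg (fun A => A.toOp 0 x) h
    rw [LowerOp.mul_apply_zero hV' hle, LowerOp.der_apply, LowerOp.toOp_of, hV,
      todaDer_apply, LowerOp.toOp_sub, Pi.sub_apply, Pi.sub_apply, LowerOp.toOp_of,
      hT.adjoint_genBbar_apply, if_neg (lt_irrefl 0), zero_sub, mul_neg] at h3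
    exact h3
  -- On the slice L^m and (L̄†)^m have the same diagonal part. The signs in `h2` and in the chain
  -- rule make the two contributions add up: ∂_m e^φ = 2 (L^m)_0 e^φ.
  have h3 := pderiv_restrict m (expSeries (φ x))
  rw [h1, h2, restrict_neg, restrict_mul, restrict_mul, ← sliceHom_apply, ← sliceHom_apply,
    hC.sliceHom_adjoint_pow_apply hT, D.shift_zero, restrict_expSeries, ← expSeries_half_sq,
    ← timeDer_coe] at h3
  change timeDer m (gauge φ x ^ 2) = gauge φ x ^ 2 * _ - -(gauge φ x ^ 2 * _) at h3
  exact eq_mul_of_sq_derivation _ h3 (gauge_mul_gaugeInv x)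

theorem fn_conj_apply (f g : D.Pt → TimeFun) (A : LowerOp D TimeFun) (n : ℤ) (x : D.Pt) :
    (LowerOp.fn f * A * LowerOp.fn g).toOp n x = f x * A.toOp n x * g (D.shift n x) := by
  rw [LowerOp.mul_fn_apply, LowerOp.fn_mul_apply]

/-- In the symmetric gauge L̄^m is adjoint to L^m. At positive order B_m cancels against the adjoint
of B̄_m, at negative order B̄_m against the adjoint of B_m, and the diagonal leaves 2 (L^m)_0, which
`timeDer_gauge` identifies. -/
theorem conj_sliceGen_add_conj_adjoint (hW : IsWavePair L Lb φ W Wb) (hT : IsTodaSolution L Lb φ)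
    (hC : IsCToda L Lb φ) (m : ℕ+) :
    LowerOp.fn (gaugeInv φ) * sliceGen hT m * LowerOp.fn (gauge φ) +
      LowerOp.fn (gauge φ) * sliceGenAdjoint hT m * LowerOp.fn (gaugeInv φ) =
    (LowerOp.fn fun x => gaugeInv φ x * timeDer m (gauge φ x)) +
      LowerOp.fn fun x => gaugeInv φ x * timeDer m (gauge φ x) := by
  refine LowerOp.ext fun n x => ?_
  have hB : ∀ n x, genB L m n x =
      if 0 ≤ n then (LowerOp.of L hT.orderLE_L ^ (m : ℕ)).toOp n x else 0 := fun n x => by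
    rw [LowerOp.toOp_pow]
    rfl
  have hBa : (genB L m).adjoint n x =
      if 0 ≤ -n then (LowerOp.of L hT.orderLE_L ^ (m : ℕ)).toOp (-n) (D.shift n x) else 0 := hB _ _
  have hBb : genBbar Lb m n x = (genBbar Lb m).adjoint (-n) (D.shift n x) := by
    simp [DiffOp.adjoint]
  have hx : D.shift (-n) (D.shift n x) = x := by simp
  have hD := hW.timeDer_gauge hT hC m x
  have h1 := gauge_mul_gaugeInv (φ := φ) x
  have h2 := gauge_mul_gaugeInv (φ := φ) (D.shift n x)
  have hμ := hC.sliceHom_adjoint_pow_apply hT (m : ℕ) n x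
  have hμ' := hC.sliceHom_adjoint_pow_apply hT (m : ℕ) (-n) (D.shift n x)
  rw [sliceHom_apply, sliceHom_apply] at hμ hμ'
  rw [sliceHom_apply] at hD
  rw [hx] at hμ'
  simp only [LowerOp.toOp_add, Pi.add_apply, fn_conj_apply, sliceGen, sliceGenAdjoint,
    LowerOp.toOp_sub, Pi.sub_apply, sliceHom_apply, LowerOp.toOp_of, LowerOp.fn_apply]
  rw [hBb, hB, hBa, hT.adjoint_genBbar_apply, hT.adjoint_genBbar_apply]
  rcases lt_trichotomy n 0 with hn | rfl | hn
  · rw [if_neg (by omega), if_pos (by omega), if_pos (by omega), if_neg (by omega),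
      if_neg (by omega), hμ', restrict_zero]
    exact gauge_cancel_left h1 h2
  · simp only [neg_zero, D.shift_zero, le_refl, lt_irrefl, if_true, if_false, restrict_zero,
      sub_zero] at h2 ⊢
    rw [hD]
    ring
  · rw [if_pos (by omega), if_neg (by omega), if_neg (by omega), if_pos (by omega),
      if_neg (by omega), hμ, restrict_zero]
    exact gauge_cancel_right h1 h2

end Generators

end CToda

end

noncomputable section

namespace CToda

/-! ### From wave operators to a symmetric dressing. -/

section SymmetricGauge

variable {η : ℂ} {D : ShiftDomain η}

namespace LowerOp

variable {R : Type} [CommRing R]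

theorem der_fn (d : Derivation ℤ R R) (f : D.Pt → R) :
    der d (fn f) = fn fun x => d (f x) := by
  refine LowerOp.ext fun n x => ?_
  rw [der_apply, fn_apply, fn_apply]
  split_ifs <;> simp

theorem fn_mul_comm (f g : D.Pt → R) : (fn f * fn g : LowerOp D R) = fn g * fn f := by
  rw [fn_mul_fn, fn_mul_fn, mul_comm]

end LowerOp

theorem adjoint_sliceHom (A : DiffOp D TodaFun) {M N : ℤ} (hA : A.OrderLE M)
    (hA' : A.adjoint.OrderLE N) :
    (sliceHom (LowerOp.of A hA)).toOp.adjoint = (sliceHom (LowerOp.of A.adjoint hA')).toOp := by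
  funext n x
  rw [DiffOp.adjoint, sliceHom_apply, sliceHom_apply]
  rfl

variable {L Lb W Wb : DiffOp D TodaFun} {φ : D.Pt → TodaFun}

theorem adjoint_sliceGen (hT : IsTodaSolution L Lb φ) (m : ℕ+) :
    (sliceGen hT m).toOp.adjoint = (sliceGenAdjoint hT m).toOp := by
  rw [sliceGen, LowerOp.toOp_sub, ← adjointHom_apply, map_sub, adjointHom_apply, adjointHom_apply,
    adjoint_sliceHom _ _ (orderLE_adjoint_genB m),
    adjoint_sliceHom _ _ (orderLE_adjoint_genBbar hT m)]
  rfl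

theorem neg_symGen (hW : IsWavePair L Lb φ W Wb) (hT : IsTodaSolution L Lb φ)
    (hC : IsCToda L Lb φ) (m : ℕ+) :
    -symGen hT m = LowerOp.fn (gauge φ) * sliceGenAdjoint hT m * LowerOp.fn (gaugeInv φ) -
      LowerOp.fn fun x => gaugeInv φ x * timeDer m (gauge φ x) := by
  rw [eq_sub_of_add_eq' (conj_sliceGen_add_conj_adjoint hW hT hC m), symGen]
  abel

theorem adjoint_symGen (hW : IsWavePair L Lb φ W Wb) (hT : IsTodaSolution L Lb φ)
    (hC : IsCToda L Lb φ) (m : ℕ+) : (symGen hT m).toOp.adjoint = -(symGen hT m).toOp := by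
  rw [← LowerOp.toOp_neg, neg_symGen hW hT hC, symGen, LowerOp.toOp_sub, ← adjointHom_apply,
    map_sub, adjointHom_apply, adjointHom_apply, LowerOp.adjoint_fn, LowerOp.toOp_mul,
    LowerOp.toOp_mul, DiffOp.adjoint_comp, DiffOp.adjoint_comp, LowerOp.adjoint_fn,
    LowerOp.adjoint_fn, adjoint_sliceGen, ← LowerOp.toOp_mul, ← LowerOp.toOp_mul, ← mul_assoc]
  rfl

theorem derivation_of_mul_eq_one {R : Type*} [CommRing R] (δ : Derivation ℤ R R) {a b : R}
    (hab : a * b = 1) : δ b = -(b * δ a * b) := by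
  have h := congrArg δ hab
  rw [Derivation.leibniz, Derivation.map_one_eq_zero, smul_eq_mul, smul_eq_mul] at h
  linear_combination b * h - δ b * hab

theorem der_fn_gaugeInv (m : ℕ) :
    LowerOp.der (timeDer m) (LowerOp.fn (gaugeInv φ) : LowerOp D TimeFun) =
      -((LowerOp.fn fun x => gaugeInv φ x * timeDer m (gauge φ x)) * LowerOp.fn (gaugeInv φ)) := by
  refine LowerOp.ext fun n x => ?_
  rw [LowerOp.der_fn, LowerOp.fn_mul_fn, LowerOp.toOp_neg, Pi.neg_apply, Pi.neg_apply,
    LowerOp.fn_apply, LowerOp.fn_apply]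
  split_ifs
  · exact derivation_of_mul_eq_one _ (gauge_mul_gaugeInv x)
  · rw [neg_zero]

/-- The operator `W^s` on the slice. -/
def symWaveOp (φ : D.Pt → TodaFun) (hW : W.OrderLE 0) : LowerOp D TimeFun :=
  LowerOp.fn (gaugeInv φ) * sliceHom (LowerOp.of W hW)

/-- The adjoint of the operator `W̄^s` on the slice. -/
def symWaveAdjoint (φ : D.Pt → TodaFun) (hWb : Wb.adjoint.OrderLE 0) : LowerOp D TimeFun :=
  sliceHom (LowerOp.of Wb.adjoint hWb) * LowerOp.fn (gaugeInv φ)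

theorem symWaveOp_apply (hW : W.OrderLE 0) (n : ℤ) (x : D.Pt) :
    (symWaveOp φ hW).toOp n x = gaugeInv φ x * restrict (W n x) := by
  rw [symWaveOp, LowerOp.fn_mul_apply, sliceHom_apply, LowerOp.toOp_of]

theorem symWaveAdjoint_apply (hWb : Wb.adjoint.OrderLE 0) (n : ℤ) (x : D.Pt) :
    (symWaveAdjoint φ hWb).toOp n x =
      restrict (Wb (-n) (D.shift n x)) * gaugeInv φ (D.shift n x) := by
  rw [symWaveAdjoint, LowerOp.mul_fn_apply, sliceHom_apply, LowerOp.toOp_of, DiffOp.adjoint]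

theorem orderLE_symWaveOp (hW : W.OrderLE 0) : (symWaveOp φ hW).toOp.OrderLE 0 := fun n hn x => by
  rw [symWaveOp_apply, hW n hn, restrict_zero, mul_zero]

theorem orderLE_symWaveAdjoint (hWb : Wb.adjoint.OrderLE 0) :
    (symWaveAdjoint φ hWb).toOp.OrderLE 0 := fun n hn x => by
  rw [symWaveAdjoint, LowerOp.mul_fn_apply, sliceHom_apply, LowerOp.toOp_of, hWb n hn,
    restrict_zero, zero_mul]

/-- The two equations of the normalization are adjoint to each other, so one of them suffices. -/
theorem symWaveOp_mul_symWaveAdjoint_eq_one_iff (hW : W.OrderLE 0) (hWb : Wb.adjoint.OrderLE 0) :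
    symWaveOp φ hW * symWaveAdjoint φ hWb = 1 ↔ IsCTodaWave φ W Wb := by
  have h : symWaveOp φ hW * symWaveAdjoint φ hWb = 1 ↔
      (restrictOp (symWave φ W)).comp (restrictOp (symWave φ Wb)).adjoint = DiffOp.shiftOp 0 := by
    rw [restrictOp_symWave hW, adjoint_restrictOp_symWave hWb]
    exact LowerOp.toOp_injective.eq_iff.symm
  rw [h, IsCTodaWave]
  refine ⟨fun h => ⟨?_, h⟩, fun h => h.2⟩
  have h1 := congrArg DiffOp.adjoint h
  rwa [DiffOp.adjoint_comp, DiffOp.adjoint_adjoint, DiffOp.adjoint_shiftOp, neg_zero] at h1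

namespace IsWavePair

variable (hW : IsWavePair L Lb φ W Wb)

theorem der_symWaveOp (hT : IsTodaSolution L Lb φ) (m : ℕ+) :
    LowerOp.der (timeDer m) (symWaveOp φ hW.orderLE_W) = symGen hT m * symWaveOp φ hW.orderLE_W -
      symWaveOp φ hW.orderLE_W * LowerOp.shiftBy (m : ℤ) := by
  have h : ∀ A : LowerOp D TimeFun, LowerOp.fn (gauge φ) * (LowerOp.fn (gaugeInv φ) * A) = A :=
    fun A => by rw [← mul_assoc, fn_gauge_mul_gaugeInv, one_mul]
  rw [symWaveOp, LowerOp.der_mul, hW.der_slice_W hT, der_fn_gaugeInv, symGen]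
  simp only [sub_mul, mul_sub, mul_assoc, h, neg_mul]
  abel

/-- Derived from the linear problem of W̄ and the antisymmetry of the generator, without vw = 1,
which is not yet available when the wave operators are being normalized. -/
theorem der_symWaveAdjoint (hT : IsTodaSolution L Lb φ) (hC : IsCToda L Lb φ) (m : ℕ+) :
    LowerOp.der (timeDer m) (symWaveAdjoint φ hW.orderLE_adjoint) =
      LowerOp.shiftBy (m : ℤ) * symWaveAdjoint φ hW.orderLE_adjoint -
        symWaveAdjoint φ hW.orderLE_adjoint * symGen hT m := by
  have h : ∀ A : LowerOp D TimeFun, LowerOp.fn (gaugeInv φ) * (LowerOp.fn (gauge φ) * A) = A :=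
    fun A => by rw [← mul_assoc, fn_gaugeInv_mul_gauge, one_mul]
  rw [sub_eq_add_neg, ← mul_neg, neg_symGen hW hT hC, symWaveAdjoint, LowerOp.der_mul,
    hW.der_slice_adjoint hT, der_fn_gaugeInv, LowerOp.fn_mul_comm]
  simp only [add_mul, mul_sub, mul_neg, mul_assoc, h]
  abel

/-- Both sides equal (W̄^s)† L^s W^s: on the right L^s W^s = W^s Λ, and on the left the constraint
gives (W̄^s)† L^s = Λ (W̄^s)†. -/
theorem symWaveAdjoint_mul_symWaveOp_comm (hT : IsTodaSolution L Lb φ)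
    (hC : IsCToda L Lb φ) :
    symWaveAdjoint φ hW.orderLE_adjoint * symWaveOp φ hW.orderLE_W * LowerOp.shiftBy 1 =
      LowerOp.shiftBy 1 * (symWaveAdjoint φ hW.orderLE_adjoint * symWaveOp φ hW.orderLE_W) := by
  have h : ∀ A : LowerOp D TimeFun, LowerOp.fn (gauge φ) * (LowerOp.fn (gaugeInv φ) * A) = A :=
    fun A => by rw [← mul_assoc, fn_gauge_mul_gaugeInv, one_mul]
  have h1 := congrArg sliceHom (hW.adjoint_mul_adjoint hT)
  have h2 : sliceHom (LowerOp.of L hT.orderLE_L) * sliceHom (LowerOp.of W hW.orderLE_W) =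
      sliceHom (LowerOp.of W hW.orderLE_W) * LowerOp.shiftBy 1 := by
    have h3 : LowerOp.of L hT.orderLE_L * LowerOp.of W hW.orderLE_W =
        LowerOp.of W hW.orderLE_W * LowerOp.shiftBy 1 := LowerOp.toOp_injective hW.dress_L
    have h4 := congrArg sliceHom h3
    rwa [map_mul, map_mul, sliceHom, LowerOp.mapHom_shiftBy] at h4
  rw [map_mul, map_mul, sliceHom, LowerOp.mapHom_shiftBy, ← sliceHom,
    hC.sliceHom_adjoint hT.orderLE_L hT.orderLE_adjoint] at h1
  rw [symWaveAdjoint, symWaveOp]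
  simp only [mul_assoc] at h1 ⊢
  rw [← h2, ← mul_assoc (LowerOp.shiftBy 1), ← h1]
  simp only [mul_assoc, h]

theorem isUnit_gaugeInv (x : D.Pt) : IsUnit (gaugeInv φ x) :=
  IsUnit.of_mul_eq_one _ ((mul_comm _ _).trans (gauge_mul_gaugeInv x))

theorem symWaveOp_zero (x : D.Pt) : (symWaveOp φ hW.orderLE_W).toOp 0 x = gaugeInv φ x := by
  rw [symWaveOp_apply, hW.W_lead, restrict_one, mul_one]

theorem symWaveAdjoint_zero (x : D.Pt) :
    (symWaveAdjoint φ hW.orderLE_adjoint).toOp 0 x = gauge φ x := by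
  rw [symWaveAdjoint_apply, neg_zero, D.shift_zero, hW.Wb_lead, restrict_expSeries,
    ← expSeries_half_sq]
  change gauge φ x ^ 2 * gaugeInv φ x = gauge φ x
  rw [pow_two, mul_assoc, gauge_mul_gaugeInv, mul_one]

/-- Normalized wave operators of a solution of the C-Toda hierarchy give a symmetric dressing. -/
theorem isSymmetricDressing (hT : IsTodaSolution L Lb φ) (hC : IsCToda L Lb φ)
    (hN : IsCTodaWave φ W Wb) :
    IsSymmetricDressing timeDer (symWaveOp φ hW.orderLE_W) (symWaveAdjoint φ hW.orderLE_adjoint)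
      fun j => if h : 0 < j then symGen hT ⟨j, h⟩ else 0 where
  w_le := orderLE_symWaveOp _
  v_le := orderLE_symWaveAdjoint _
  mul_v := (symWaveOp_mul_symWaveAdjoint_eq_one_iff _ _).2 hN
  v_mul := by
    refine LowerOp.mul_eq_one_symm (orderLE_symWaveAdjoint _) (fun x => ?_)
      ((symWaveOp_mul_symWaveAdjoint_eq_one_iff _ _).2 hN)
    rw [hW.symWaveAdjoint_zero]
    exact IsUnit.of_mul_eq_one _ (gauge_mul_gaugeInv x)
  A_zero := dif_neg (lt_irrefl 0)
  A_adjoint j := by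
    split_ifs with h
    · exact adjoint_symGen hW hT hC _
    · rw [LowerOp.toOp_zero, neg_zero]
      rfl
  der_w j hj := by
    rw [dif_pos hj]
    exact hW.der_symWaveOp hT ⟨j, hj⟩

end IsWavePair

end SymmetricGauge

end CToda

end

noncomputable section

namespace CToda

open Finset

/-! ### Normalization of the wave operators. -/

section SeriesOp

variable {η : ℂ} {D : ShiftDomain η} {R : Type} [CommRing R]

namespace LowerOp

/-- The operator `∑_{k ≥ 0} s_k(x) e^{-k η ∂_x}`. -/
def seriesOp (s : D.Pt → PowerSeries R) : LowerOp D R :=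
  of (fun n x => if n ≤ 0 then PowerSeries.coeff (-n).toNat (s x) else 0) (N := 0)
    fun n hn _ => if_neg (by omega)

theorem seriesOp_apply (s : D.Pt → PowerSeries R) (n : ℤ) (x : D.Pt) : (seriesOp s).toOp n x =
    if n ≤ 0 then PowerSeries.coeff (-n).toNat (s x) else 0 := rfl

theorem seriesOp_apply_neg (s : D.Pt → PowerSeries R) (k : ℕ) (x : D.Pt) :
    (seriesOp s).toOp (-(k : ℤ)) x = PowerSeries.coeff k (s x) := by
  rw [seriesOp_apply, if_pos (by omega), neg_neg, Int.toNat_natCast]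

theorem orderLE_seriesOp (s : D.Pt → PowerSeries R) : (seriesOp s).toOp.OrderLE 0 :=
  fun n hn _ => if_neg (by omega)

theorem ext_of_orderLE_zero {A B : LowerOp D R} (hA : A.toOp.OrderLE 0) (hB : B.toOp.OrderLE 0)
    (h : ∀ (k : ℕ) x, A.toOp (-(k : ℤ)) x = B.toOp (-(k : ℤ)) x) : A = B := by
  refine LowerOp.ext fun n x => ?_
  rcases lt_or_ge 0 n with hn | hn
  · rw [hA n hn, hB n hn]
  · obtain ⟨k, rfl⟩ : ∃ k : ℕ, n = -(k : ℤ) := ⟨(-n).toNat, by omega⟩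
    exact h k x

theorem seriesOp_one : (seriesOp fun _ => 1 : LowerOp D R) = 1 := by
  refine ext_of_orderLE_zero (orderLE_seriesOp _) (fun n hn _ => if_neg (by omega)) fun k x => ?_
  rw [seriesOp_apply_neg, PowerSeries.coeff_one, toOp_one, DiffOp.shiftOp]
  congr 1
  simp

theorem shift_eq_of_periodic {S : Type*} {t : D.Pt → S} (ht : ∀ x, t (D.shift 1 x) = t x) (n : ℤ)
    (x : D.Pt) : t (D.shift n x) = t x := by
  induction n with
  | zero => rw [D.shift_zero]
  | succ n ih => rw [← ih, ← ht (D.shift n x), D.shift_shift, add_comm]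
  | pred n ih => rw [← ih, ← ht (D.shift (-n - 1) x), D.shift_shift, add_sub_cancel]

/-- Powers of Λ pass through periodic coefficients, so composition becomes the product of power
series in Λ⁻¹. -/
theorem seriesOp_mul_seriesOp {s t : D.Pt → PowerSeries R} (ht : ∀ x, t (D.shift 1 x) = t x) :
    seriesOp s * seriesOp t = seriesOp fun x => s x * t x := by
  refine ext_of_orderLE_zero ((orderLE_seriesOp s).comp (orderLE_seriesOp t))
    (orderLE_seriesOp _) fun k x => ?_
  rw [mul_apply _ _ (orderLE_seriesOp s) (orderLE_seriesOp t) _ x (l := -k) (by omega) le_rfl,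
    seriesOp_apply_neg, PowerSeries.coeff_mul]
  refine sum_bij' (fun i _ => ((-i).toNat, (k + i).toNat)) (fun p _ => -(p.1 : ℤ)) ?_ ?_ ?_ ?_ ?_
  · intro i hi
    rw [mem_Icc] at hi
    rw [HasAntidiagonal.mem_antidiagonal]
    dsimp only
    omega
  · intro p hp
    rw [HasAntidiagonal.mem_antidiagonal] at hp
    rw [mem_Icc]
    omega
  · intro i hi
    rw [mem_Icc] at hi
    dsimp only
    omega
  · intro p hp
    rw [HasAntidiagonal.mem_antidiagonal] at hp
    ext <;> dsimp only <;> omega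
  · intro i hi
    rw [mem_Icc] at hi
    rw [seriesOp_apply, seriesOp_apply, if_pos hi.2, if_pos (by omega), shift_eq_of_periodic ht]
    congr 3
    omega

theorem commute_seriesOp_shiftBy {t : D.Pt → PowerSeries R} (ht : ∀ x, t (D.shift 1 x) = t x)
    (m : ℤ) : seriesOp t * shiftBy m = shiftBy m * seriesOp t := by
  refine LowerOp.ext fun n x => ?_
  rw [mul_shiftBy_apply, shiftBy_mul_apply, seriesOp_apply, seriesOp_apply, shift_eq_of_periodic ht]

theorem mapHom_seriesOp {S : Type} [CommRing S] (g : R →+* S) (s : D.Pt → PowerSeries R) :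
    mapHom g (seriesOp s) = seriesOp fun x => PowerSeries.map g (s x) := by
  refine LowerOp.ext fun n x => ?_
  rw [mapHom_apply, seriesOp_apply, seriesOp_apply]
  split_ifs <;> simp

end LowerOp

end SeriesOp

section Normalization

variable {η : ℂ} {D : ShiftDomain η} {L Lb W Wb : DiffOp D TodaFun} {φ : D.Pt → TodaFun}

/-- Multiplication of the wave operator by an operator with constant periodic coefficients. -/
theorem IsWavePair.mul_seriesOp (hW : IsWavePair L Lb φ W Wb) (hT : IsTodaSolution L Lb φ)
    {d : D.Pt → PowerSeries ℂ} (hd : ∀ x, d (D.shift 1 x) = d x)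
    (hd0 : ∀ x, PowerSeries.coeff 0 (d x) = 1) :
    IsWavePair L Lb φ (LowerOp.of W hW.orderLE_W *
      LowerOp.seriesOp fun x => PowerSeries.map MvPowerSeries.C (d x)).toOp Wb := by
  set δ : LowerOp D TodaFun := LowerOp.seriesOp fun x => PowerSeries.map MvPowerSeries.C (d x)
    with hδ
  have hδΛ : ∀ m : ℤ, δ * LowerOp.shiftBy m = LowerOp.shiftBy m * δ :=
    LowerOp.commute_seriesOp_shiftBy fun x => by rw [hd]
  have hder : ∀ i, LowerOp.der (todaDer i) δ = 0 := fun i => by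
    refine LowerOp.ext fun n x => ?_
    rw [LowerOp.der_apply, LowerOp.seriesOp_apply, todaDer_apply]
    split_ifs
    · rw [PowerSeries.coeff_map, MvPowerSeries.pderiv_C]
      rfl
    · exact map_zero _
  have hle : (LowerOp.of W hW.orderLE_W * δ).toOp.OrderLE 0 :=
    hW.orderLE_W.comp (LowerOp.orderLE_seriesOp _)
  have hderW : ∀ i, LowerOp.der (todaDer i) (LowerOp.of W hW.orderLE_W * δ) =
      LowerOp.der (todaDer i) (LowerOp.of W hW.orderLE_W) * δ := fun i => by
    rw [LowerOp.der_mul, hder, mul_zero, add_zero]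
  refine ⟨hle, fun x => ?_, hW.Wb_bot, hW.Wb_lead, ?_, hW.dress_Lb, fun m => ?_, hW.lin_t_Wb,
    fun m => ?_, hW.lin_tb_Wb⟩
  · have hW0 : (LowerOp.of W hW.orderLE_W).toOp.OrderLE 0 := hW.orderLE_W
    rw [LowerOp.mul_apply_zero hW0 (LowerOp.orderLE_seriesOp _), LowerOp.toOp_of, hW.W_lead,
      one_mul, LowerOp.seriesOp_apply, if_pos le_rfl]
    rw [neg_zero, Int.toNat_zero, PowerSeries.coeff_map, hd0, map_one]
  · have h : LowerOp.of L hT.orderLE_L * LowerOp.of W hW.orderLE_W =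
        LowerOp.of W hW.orderLE_W * LowerOp.shiftBy 1 := LowerOp.toOp_injective hW.dress_L
    have h' : LowerOp.of L hT.orderLE_L * (LowerOp.of W hW.orderLE_W * δ) =
        LowerOp.of W hW.orderLE_W * δ * LowerOp.shiftBy 1 := by
      rw [← mul_assoc, h, mul_assoc, mul_assoc, hδΛ]
    exact congrArg LowerOp.toOp h'
  · have h : LowerOp.der (todaDer (Sum.inl m)) (LowerOp.of W hW.orderLE_W) +
        LowerOp.of W hW.orderLE_W * LowerOp.shiftBy (m : ℤ) =
        LowerOp.of _ (orderLE_genB hT m) * LowerOp.of W hW.orderLE_W :=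
      LowerOp.toOp_injective (hW.lin_t_W m)
    have h' : LowerOp.der (todaDer (Sum.inl m)) (LowerOp.of W hW.orderLE_W * δ) +
        LowerOp.of W hW.orderLE_W * δ * LowerOp.shiftBy (m : ℤ) =
        LowerOp.of _ (orderLE_genB hT m) * (LowerOp.of W hW.orderLE_W * δ) := by
      rw [hderW, ← mul_assoc, ← h, add_mul, mul_assoc, mul_assoc, hδΛ]
    exact congrArg LowerOp.toOp h'
  · have h : LowerOp.der (todaDer (Sum.inr m)) (LowerOp.of W hW.orderLE_W) =
        LowerOp.of _ (orderLE_genBbar (Lb := Lb) m) * LowerOp.of W hW.orderLE_W :=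
      LowerOp.toOp_injective (hW.lin_tb_W m)
    have h' : LowerOp.der (todaDer (Sum.inr m)) (LowerOp.of W hW.orderLE_W * δ) =
        LowerOp.of _ (orderLE_genBbar (Lb := Lb) m) * (LowerOp.of W hW.orderLE_W * δ) := by
      rw [hderW, ← mul_assoc, ← h]
    exact congrArg LowerOp.toOp h'

/-- The product `(W̄^s)† W^s` has constant periodic coefficients on the slice. -/
theorem IsWavePair.exists_seriesOp_eq (hW : IsWavePair L Lb φ W Wb) (hT : IsTodaSolution L Lb φ)
    (hC : IsCToda L Lb φ) : ∃ c : D.Pt → PowerSeries ℂ, (∀ x, c (D.shift 1 x) = c x) ∧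
      (∀ x, PowerSeries.coeff 0 (c x) = 1) ∧
      symWaveAdjoint φ hW.orderLE_adjoint * symWaveOp φ hW.orderLE_W =
        LowerOp.seriesOp fun x => PowerSeries.map MvPowerSeries.C (c x) := by
  obtain ⟨Z, hZ⟩ : ∃ Z, symWaveAdjoint φ hW.orderLE_adjoint * symWaveOp φ hW.orderLE_W = Z :=
    ⟨_, rfl⟩
  have hle : Z.toOp.OrderLE 0 := by
    rw [← hZ]
    exact (orderLE_symWaveAdjoint hW.orderLE_adjoint).comp (orderLE_symWaveOp hW.orderLE_W)
  have hcomm := hW.symWaveAdjoint_mul_symWaveOp_comm hT hC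
  rw [hZ] at hcomm
  have hcomm' : ∀ m : ℕ, Z * LowerOp.shiftBy m = LowerOp.shiftBy m * Z := fun m => by
    rw [← LowerOp.shiftBy_one_pow]
    exact (Commute.pow_right (a := Z) hcomm m).eq
  -- The generators cancel in the derivative of the product and leave Λ^m Z − ZΛ^m = 0.
  have hder : ∀ m : ℕ+, LowerOp.der (timeDer m) Z = 0 := fun m => by
    have h := hcomm' m
    rw [← hZ] at h ⊢
    rw [LowerOp.der_mul, hW.der_symWaveOp hT, hW.der_symWaveAdjoint hT hC, sub_mul, mul_sub,
      mul_assoc, ← h]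
    simp only [mul_assoc]
    abel
  have hper : ∀ n x, Z.toOp n (D.shift 1 x) = Z.toOp n x := fun n x => by
    have h := congrArg (fun A => A.toOp (n + 1) x) hcomm
    simp only [LowerOp.mul_shiftBy_apply, LowerOp.shiftBy_mul_apply, add_sub_cancel_right] at h
    exact h.symm
  have hconst : ∀ n x, Z.toOp n x =
      MvPowerSeries.C (MvPowerSeries.constantCoeff (Z.toOp n x)) := fun n x => by
    refine MvPowerSeries.pderiv.ext (fun i => ?_) ?_
    · have h := congrArg (fun A => A.toOp n x) (hder i)
      rw [MvPowerSeries.pderiv_C, ← timeDer_coe]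
      exact h
    · rw [MvPowerSeries.constantCoeff_C]
  have hone : ∀ x, Z.toOp 0 x = 1 := fun x => by
    rw [← hZ, LowerOp.mul_apply_zero (orderLE_symWaveAdjoint _) (orderLE_symWaveOp _),
      hW.symWaveAdjoint_zero, hW.symWaveOp_zero, gauge_mul_gaugeInv]
  refine ⟨fun x => PowerSeries.mk fun k => MvPowerSeries.constantCoeff (Z.toOp (-(k : ℤ)) x),
    fun x => ?_, fun x => ?_, ?_⟩
  · simp only [hper]
  · rw [PowerSeries.coeff_mk, Nat.cast_zero, neg_zero, hone, map_one]
  · rw [hZ]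
    refine LowerOp.ext_of_orderLE_zero hle (LowerOp.orderLE_seriesOp _) fun k x => ?_
    rw [LowerOp.seriesOp_apply_neg, PowerSeries.coeff_map, PowerSeries.coeff_mk, ← hconst]

/-- The wave operators can be normalized. -/
theorem IsWavePair.exists_normalized (hW : IsWavePair L Lb φ W Wb) (hT : IsTodaSolution L Lb φ)
    (hC : IsCToda L Lb φ) : ∃ W', IsWavePair L Lb φ W' Wb ∧ IsCTodaWave φ W' Wb := by
  obtain ⟨c, hc, hc0, hcZ⟩ := hW.exists_seriesOp_eq hT hC
  have hc0' : ∀ x, PowerSeries.constantCoeff (c x) ≠ 0 := fun x => by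
    rw [← PowerSeries.coeff_zero_eq_constantCoeff_apply, hc0]
    exact one_ne_zero
  -- W' = W Z⁻¹. The coefficients of Z are complex numbers depending only on the orbit of x, so Z⁻¹
  -- makes sense off the slice too and has zero derivatives in all the Toda times.
  have hW' := hW.mul_seriesOp hT (d := fun x => (c x)⁻¹) (fun x => by rw [hc]) fun x => by
    rw [PowerSeries.coeff_zero_eq_constantCoeff_apply, PowerSeries.constantCoeff_inv,
      ← PowerSeries.coeff_zero_eq_constantCoeff_apply, hc0, inv_one]
  refine ⟨_, hW', ?_⟩
  rw [← symWaveOp_mul_symWaveAdjoint_eq_one_iff hW'.orderLE_W hW'.orderLE_adjoint]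
  -- The construction gives (W̄^s)† W'^s = 1; the order of the factors is reversed using the
  -- invertible leading coefficient.
  refine LowerOp.mul_eq_one_symm (orderLE_symWaveOp _) (fun x => ?_) ?_
  · rw [hW'.symWaveOp_zero]
    exact IsWavePair.isUnit_gaugeInv x
  · have h1 : symWaveOp φ hW'.orderLE_W = symWaveOp φ hW.orderLE_W *
        LowerOp.seriesOp fun x => PowerSeries.map MvPowerSeries.C (c x)⁻¹ := by
      have h2 : ∀ A : LowerOp D TodaFun, ∀ hA : A.toOp.OrderLE 0,
          symWaveOp φ hA = LowerOp.fn (gaugeInv φ) * sliceHom A := fun A hA => rfl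
      rw [h2, map_mul, ← mul_assoc]
      congr 1
      rw [sliceHom, LowerOp.mapHom_seriesOp]
      congr 1
      funext x
      ext k
      simp
    rw [h1, ← mul_assoc, hcZ, LowerOp.seriesOp_mul_seriesOp fun x => by rw [hc]]
    rw [← LowerOp.seriesOp_one]
    congr 1
    funext x
    rw [← map_mul, PowerSeries.mul_inv_cancel _ (hc0' x), map_one]

/-- Normalized wave operators have a tau-function. -/
theorem IsWavePair.exists_isCTodaTau (hη : η ≠ 0) (hW : IsWavePair L Lb φ W Wb)
    (hT : IsTodaSolution L Lb φ) (hC : IsCToda L Lb φ) (hN : IsCTodaWave φ W Wb) :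
    ∃ τ, IsCTodaTau φ W Wb τ := by
  refine (hW.isSymmetricDressing hT hC hN).exists_isCTodaTau hη (fun x => hW.symWaveAdjoint_zero x)
    (fun s x => ?_) fun s x => ?_
  · rw [hW.symWaveAdjoint_zero, symWaveOp_apply, ← mul_assoc, gauge_mul_gaugeInv, one_mul]
  · rw [hW.symWaveAdjoint_zero, symWaveAdjoint_apply, neg_neg, D.shift_shift, neg_add_cancel,
      D.shift_zero, mul_left_comm, gauge_mul_gaugeInv, mul_one]

end Normalization

end CToda

end

theorem theorem1 {η : ℂ} (hη : η ≠ 0) (D : CToda.ShiftDomain η)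
    (L Lb : CToda.DiffOp D CToda.TodaFun) (φ : D.Pt → CToda.TodaFun)
    (W Wb : CToda.DiffOp D CToda.TodaFun)
    (hToda : CToda.IsTodaSolution L Lb φ) (hC : CToda.IsCToda L Lb φ)
    (hW : CToda.IsWavePair L Lb φ W Wb) :
    (∃ W' : CToda.DiffOp D CToda.TodaFun,
      CToda.IsWavePair L Lb φ W' Wb ∧ CToda.IsCTodaWave φ W' Wb) ∧
    (CToda.IsCTodaWave φ W Wb →
      ∃ τ : D.Pt → CToda.TimeFun, CToda.IsCTodaTau φ W Wb τ) := by
  exact ⟨hW.exists_normalized hToda hC, hW.exists_isCTodaTau hη hToda hC⟩
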